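/- Let $\mu$ be a probability measure on the unit circle $\partial\mathbb D$ that is not supported on a finite set, let $\Phi_n$ and $\varphi_n=\Phi_n/\|\Phi_n\|$ be its monic and orthonormal polynomials, and let $\alpha_n=-\overline{\Phi_{n+1}(0)}$ be its Verblunsky coefficients. Let $w$ be the density of the absolutely continuous part of $\mu$ with respect to $d\theta/2\pi$, and $$D(z)=\exp\Bigl(\frac1{4\pi}\int \frac{e^{i\theta}+z}{e^{i\theta}-z}\,\log w(\theta)\,d\theta\Bigr),\qquad |z|<1,$$ the Szegő function. Assume the BLS condition: $\alpha_n=Cb^n+O((b\Delta)^n)$ with $b,\Delta\in(0,1)$ and $C\in\mathbb C$, $C\ne0$. Then there is $\Delta_2\in(0,1)$ such that $D^{-1}$ has a meromorphic continuation to $|z|<1/(b\Delta_2)$ which is analytic except possibly at $z=1/b$. Let $\Delta_2\in(0,1)$ be any number with this property, write $D^{-1}$ also for the continuation, and put, for $b\Delta_2<|z|<b\Delta_2^{-1}$, $$g(z)=\frac{\overline C\;\overline{D(1/\bar z)}}{D(z)\,(b-z)} .$$ Call a point $z$ with $|z|=b$ regular if $z\neq b$ and $D(1/\bar z)^{-1}\ne0$.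 Let $|z_0|=1$ and let $bz_0$ be regular. Then $g(bz_0)\neq0$. Put $a=|g(bz_0)|>0$, and let $\psi_n\in[0,2\pi)$ be defined by $z_0^{-n}g(bz_0)=a\,e^{i\psi_n}$. There is a constant $K$ such that the following holds for every $\delta>0$ for which the disk $|z-bz_0|<\delta$ lies in the annulus $b\Delta_2<|z|<b\Delta_2^{-1}$, contains neither $b$ nor a zero of $D(1/\bar z)^{-1}$, and satisfies $|g(z)-g(bz_0)|<a/4$ throughout. For integers $j_1\le j_2$ with $2\pi|j_k|<(n-1)\delta/2$ $(k=1,2)$ let $$I_n(j_1,j_2)=\Bigl\{z:\ \Bigl|\frac{|z|}b-1\Bigr|<\frac{\delta}{2b},\ \ \arg\frac z{z_0}\in\Bigl(\frac{\psi_n}{n}+\frac{2\pi j_1}{n}-\frac{\pi}{n},\ \frac{\psi_n}{n}+\frac{2\pi j_2}{n}+\frac{\pi}{n}\Bigr)\Bigr\},$$ where $\arg$ is the principal argument. There is $N$, independent of $j_1,j_2$, such that for all $n\ge N$ and all such $j_1\le j_2$ the polynomial $\varphi_n$ has exactly $j_2-j_1+1$ zeros in $I_n(j_1,j_2)$, counted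 with multiplicity; they are $z_\ell^{(n)}$, $j_1\le\ell\le j_2$, with $z^{(n)}_\ell\in I_n(\ell,\ell)$, so there is one in each slot. Moreover, uniformly in all $n\ge N$ and all integers $\ell$ with $2\pi|\ell|<(n-1)\delta/2$: (a) $\displaystyle |z_\ell^{(n)}|=b\Bigl(1+\frac1n\log|g(z_\ell^{(n)})|+O\Bigl(\frac1{n^2}\Bigr)\Bigr)=b\Bigl(1+\frac1n\log a+O\Bigl(\frac\delta n\Bigr)+O\Bigl(\frac1{n^2}\Bigr)\Bigr);$ (b) $\displaystyle \arg\frac{z_\ell^{(n)}}{z_0}=\frac{\arg\bigl(z_0^{-n}g(z_\ell^{(n)})\bigr)}n+\frac{2\pi\ell}n+O\Bigl(\frac1{n^2}\Bigr)=\frac{\psi_n}n+\frac{2\pi\ell}n+O\Bigl(\frac\delta n\Bigr)+O\Bigl(\frac1{n^2}\Bigr),$ where $\arg(z_0^{-n}g(z)):=\psi_n+\operatorname{Arg}\bigl(g(z)/g(bz_0)\bigr)$ is the continuous determination that equals $\psi_n$ at $bz_0$; (c) for each $J$, uniformly in $|\ell|\le J$, the second equalities in (a) and (b) hold without the $O(\delta/n)$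 term. Here $O(\delta/n)$ means a term bounded by $K\delta/n$ with the constant $K$ above, which does not depend on $\delta$; the constants in $O(1/n^2)$ may depend on $\delta$, and in (c) on $J$. -/

import Mathlib

open MeasureTheory Polynomial
open scoped ComplexConjugate

/-- The unit circle carries its Borel σ-algebra. -/
noncomputable instance instMeasurableSpaceCircleBorel : MeasurableSpace Circle := borel Circle

instance instBorelSpaceCircleBorel : BorelSpace Circle := ⟨rfl⟩

/-- Normalized arc length `dθ / 2π` on the unit circle. -/
noncomputable def circleArc : Measure Circle :=
  ENNReal.ofReal (2 * Real.pi)⁻¹ •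
    ((volume.restrict (Set.Ioc (-Real.pi) Real.pi)).map (fun θ : ℝ => Circle.exp θ))

/-- A measure on the unit circle is nontrivial if it is not supported on a finite set. -/
def IsNontrivialOnCircle (μ : Measure Circle) : Prop :=
  ∀ s : Set Circle, s.Finite → μ sᶜ ≠ 0

/-- The sesquilinear form `⟨P, Q⟩ = ∫ conj (P ζ) * Q ζ dμ(ζ)` on polynomials. -/
noncomputable def circleInner (μ : Measure Circle) (P Q : ℂ[X]) : ℂ :=
  ∫ ζ : Circle, conj (P.eval (ζ : ℂ)) * Q.eval (ζ : ℂ) ∂μ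

/-- The `L²(μ)` norm of a polynomial. -/
noncomputable def circleNorm (μ : Measure Circle) (P : ℂ[X]) : ℝ :=
  Real.sqrt (∫ ζ : Circle, ‖P.eval (ζ : ℂ)‖ ^ 2 ∂μ)

/-- The monic orthogonal polynomials `Φₙ` of `μ`: Gram-Schmidt applied to `1, z, z², …`. -/
noncomputable def monicOPUC (μ : Measure Circle) : ℕ → ℂ[X]
  | n => X ^ n - ∑ k : Fin n,
      C (circleInner μ (monicOPUC μ k) (X ^ n) / ((circleNorm μ (monicOPUC μ k) : ℂ) ^ 2)) *
        monicOPUC μ k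
  decreasing_by all_goals exact k.2

/-- The orthonormal polynomials `φₙ = Φₙ / ‖Φₙ‖`. -/
noncomputable def orthonormalOPUC (μ : Measure Circle) (n : ℕ) : ℂ[X] :=
  C ((circleNorm μ (monicOPUC μ n) : ℂ)⁻¹) * monicOPUC μ n

/-- The Verblunsky coefficients `αₙ = - conj (Φₙ₊₁(0))`. -/
noncomputable def verblunsky (μ : Measure Circle) (n : ℕ) : ℂ :=
  -conj ((monicOPUC μ (n + 1)).eval 0)

/-- The BLS condition `αₙ = c bⁿ + O((b Δ)ⁿ)` for some `Δ ∈ (0, 1)`. -/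
def BLSCondition (μ : Measure Circle) (b : ℝ) (c : ℂ) : Prop :=
  ∃ Δ : ℝ, 0 < Δ ∧ Δ < 1 ∧ ∃ M : ℝ, ∀ n : ℕ,
    ‖verblunsky μ n - c * (b : ℂ) ^ n‖ ≤ M * (b * Δ) ^ n

/-- The density `w` of the absolutely continuous part of `μ`, `dμ = w dθ/2π + dμ_s`. -/
noncomputable def circleWeight (μ : Measure Circle) (ζ : Circle) : ℝ :=
  (μ.rnDeriv circleArc ζ).toReal

/-- The Szegő function
`D(z) = exp ((1/4π) ∫ (e^{iθ} + z) / (e^{iθ} - z) log w(θ) dθ)`, for `|z| < 1`. -/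
noncomputable def szegoD (μ : Measure Circle) (z : ℂ) : ℂ :=
  Complex.exp ((1 / 2 : ℂ) * ∫ ζ : Circle,
    (((ζ : ℂ) + z) / ((ζ : ℂ) - z)) * (Real.log (circleWeight μ ζ) : ℂ) ∂circleArc)

/-- `F` is the meromorphic continuation of `1 / D` from the unit disk to the disk of radius
`1 / (b Δ₂)`, analytic except possibly at `1 / b`. -/
structure IsSzegoInvContinuation (μ : Measure Circle) (b Δ₂ : ℝ) (F : ℂ → ℂ) : Prop where
  eq_inv : ∀ z : ℂ, ‖z‖ < 1 → F z = (szegoD μ z)⁻¹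
  analytic : AnalyticOnNhd ℂ F (Metric.ball 0 (1 / (b * Δ₂)) \ {((1 / b : ℝ) : ℂ)})
  meromorphic : MeromorphicAt F ((1 / b : ℝ) : ℂ)

/-- A point `z` with `|z| = b` is regular if `z ≠ b` and `1 / D`, continued, does not vanish
at `1 / conj z`. -/
def IsRegularPoint (b : ℝ) (F : ℂ → ℂ) (z : ℂ) : Prop :=
  ‖z‖ = b ∧ z ≠ (b : ℂ) ∧ F (1 / conj z) ≠ 0

/-- `g(z) = conj c * conj (D(1 / conj z)) / (D(z) (b - z))`, written through `F = 1 / D`. -/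
noncomputable def ratioG (b : ℝ) (c : ℂ) (F : ℂ → ℂ) (z : ℂ) : ℂ :=
  conj c * F z / (conj (F (1 / conj z)) * ((b : ℂ) - z))

/-- The disk `|z - w| < δ` lies in the annulus `b Δ₂ < |z| < b / Δ₂`, the formula for `g` is
meaningful at each of its points, and `g` varies there by less than `|g(w)| / 4`. -/
def IsGoodRadius (b : ℝ) (c : ℂ) (Δ₂ : ℝ) (F : ℂ → ℂ) (w : ℂ) (δ : ℝ) : Prop :=
  0 < δ ∧ ∀ z : ℂ, ‖z - w‖ < δ →
    b * Δ₂ < ‖z‖ ∧ ‖z‖ < b / Δ₂ ∧ z ≠ (b : ℂ) ∧ F (1 / conj z) ≠ 0 ∧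
      ‖ratioG b c F z - ratioG b c F w‖ < ‖ratioG b c F w‖ / 4

/-- For `G ≠ 0` and `|z₀| = 1`: the argument in `[0, 2π)` of `z₀⁻ⁿ G`. -/
noncomputable def slotPhase (G z₀ : ℂ) (n : ℕ) : ℝ :=
  toIcoMod Real.two_pi_pos 0 (Complex.arg (G / z₀ ^ n))

/-- The sector-annulus that spans the angular slots `j₁, …, j₂`, the slot `ℓ` being the open
angle of size `2π/n` about `ψ/n + 2πℓ/n`, measured from `z₀`. -/
def sectorAnnulus (b δ ψ : ℝ) (z₀ : ℂ) (n : ℕ) (j₁ j₂ : ℤ) : Set ℂ :=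
  {z | |‖z‖ / b - 1| < δ / (2 * b) ∧
    Complex.arg (z / z₀) ∈ Set.Ioo
      (ψ / n + 2 * Real.pi * j₁ / n - Real.pi / n) (ψ / n + 2 * Real.pi * j₂ / n + Real.pi / n)}

/-- The slots `j` that are allowed: `2π |j| < (n - 1) δ / 2`. -/
def IsAdmissibleSlot (δ : ℝ) (n : ℕ) (j : ℤ) : Prop :=
  2 * Real.pi * |(j : ℝ)| < ((n : ℝ) - 1) * δ / 2

open Classical in
/-- The zeros of a polynomial in a set, with multiplicity. -/
noncomputable def zerosIn (P : ℂ[X]) (S : Set ℂ) : Multiset ℂ :=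
  P.roots.filter (fun z => z ∈ S)

/-! ### The inner product of polynomials on the circle -/

/-! Let Ψ be the limit of the reversed polynomials Φₙ*. Since αₙ = O(bⁿ), the recursion Φₙ₊₁* = Φₙ*
− αₙ z Φₙ converges geometrically on every disk |z| ≤ r with br < 1 (`dualOPUC_tendsto`).
Orthogonality passes to the limit, so |Ψ|²μ has no nonconstant moments and μ = k|Ψ|⁻² dθ/2π
(`exists_eq_withDensity`). The Schwarz formula then gives 1/D = κΨ with a constant κ > 0
(`exists_szegoD_inv_eq`).

In Φₙ₊₁ = zΦₙ − conj(αₙ)Φₙ* the last term is conj(c) bⁿ Ψ + O((bΘ)ⁿ). Solving this linear recurrence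
gives Φₙ = zⁿ R(z) + bⁿ conj(c) Ψ(z)/(z − b) + O((bΘ)ⁿ) on annuli reaching inside |z| = b
(`GeometricVerblunsky.norm_monicOPUC_sub_le`). Comparison with Φₙ/zⁿ → conj Ψ(1/conj z) outside the
critical circle shows that R continues this function across |z| = b, with at most a pole at b.
Reflecting R back yields the continuation of 1/D, and the identity theorem ties any other
continuation to Ψ and R. Factoring out bⁿR leaves (z/b)ⁿ − g(z): zeros near bz₀ are approximate
solutions of (z/b)ⁿ = g(z).

Put z = bz₀eᵘ. The error is absorbed exactly into a function Λ, so that Φₙ = 0 becomes e^{nu} = z₀⁻ⁿ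
g(bz₀) e^{Λ(u)}, where |Λ| ≤ 3/4, Λ is Lipschitz uniformly in n, and Λ = log(g/g(bz₀)) + O(Θⁿ)
(`CriticalChart.exists_log`). Taking logarithms, nu = log a + i(ψₙ + 2πℓ) + Λ(u), which is a
contraction problem with one solution for each ℓ; |Im Λ| ≤ 3/4 < π keeps it in its slot. A double
zero would force Λ' = n, which the uniform bound on Λ' forbids. Points of the sector with |Re u| >
s/2 are not zeros, because there one of the two leading terms dominates. So the count needs no
argument principle.

Real and imaginary parts of the equation for u give (a) and (b), using eˣ = 1 + x + O(x²) with x =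
O(1/n). The O(δ/n) term is the variation of log g over the disk, with a Lipschitz constant
independent of δ. In (c) it disappears because u = O((1 + |ℓ|)/n). -/

theorem Continuous.integrable_circle {E : Type*} [NormedAddCommGroup E]
    [SecondCountableTopology E] {μ : Measure Circle} [IsFiniteMeasure μ] {f : Circle → E}
    (hf : Continuous f) : Integrable f μ :=
  hf.integrable_of_hasCompactSupport (HasCompactSupport.of_compactSpace f)

section Inner

variable (μ : Measure Circle)

theorem circleInner_add_right [IsFiniteMeasure μ] (P Q R : ℂ[X]) :
    circleInner μ P (Q + R) = circleInner μ P Q + circleInner μ P R := by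
  unfold circleInner
  rw [← integral_add (Continuous.integrable_circle (by fun_prop))
    (Continuous.integrable_circle (by fun_prop))]
  simp [mul_add]

theorem circleInner_sub_right [IsFiniteMeasure μ] (P Q R : ℂ[X]) :
    circleInner μ P (Q - R) = circleInner μ P Q - circleInner μ P R := by
  unfold circleInner
  rw [← integral_sub (Continuous.integrable_circle (by fun_prop))
    (Continuous.integrable_circle (by fun_prop))]
  simp [mul_sub]

theorem circleInner_C_mul_right (P Q : ℂ[X]) (a : ℂ) :
    circleInner μ P (C a * Q) = a * circleInner μ P Q := by
  unfold circleInner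
  rw [← integral_const_mul]
  congr 1; ext ζ; simp; ring

theorem circleInner_sum_right [IsFiniteMeasure μ] {ι : Type*} (s : Finset ι) (P : ℂ[X]) (f : ι → ℂ[X]) :
    circleInner μ P (∑ i ∈ s, f i) = ∑ i ∈ s, circleInner μ P (f i) := by
  classical
  induction s using Finset.induction_on with
  | empty => simp [circleInner]
  | insert a s ha ih => rw [Finset.sum_insert ha, Finset.sum_insert ha, circleInner_add_right, ih]

theorem circleInner_conj_symm (P Q : ℂ[X]) :
    conj (circleInner μ P Q) = circleInner μ Q P := by
  unfold circleInner
  rw [← integral_conj]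
  congr 1; ext ζ; simp; ring

theorem circleInner_self (P : ℂ[X]) : circleInner μ P P = ((circleNorm μ P : ℂ)) ^ 2 := by
  unfold circleInner circleNorm
  rw [← Complex.ofReal_pow, Real.sq_sqrt (integral_nonneg fun ζ => by positivity),
    ← integral_complex_ofReal]
  congr 1; ext ζ
  rw [mul_comm, Complex.mul_conj, Complex.normSq_eq_norm_sq]

variable {μ}

/-- If the norm vanished, μ would be carried by the roots of P on the circle, a finite set. -/
theorem circleNorm_pos [IsFiniteMeasure μ] (hμ : IsNontrivialOnCircle μ) {P : ℂ[X]} (hP : P ≠ 0) :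
    0 < circleNorm μ P := by
  refine Real.sqrt_pos.2 (lt_of_le_of_ne (integral_nonneg fun ζ => by positivity) fun h => ?_)
  have h0 := (integral_eq_zero_iff_of_nonneg (μ := μ)
    (f := fun ζ : Circle => ‖P.eval (ζ : ℂ)‖ ^ 2) (fun ζ => by positivity)
    (Continuous.integrable_circle (by fun_prop))).1 h.symm
  have hfin : {ζ : Circle | P.eval (ζ : ℂ) = 0}.Finite := by
    refine Set.Finite.of_finite_image (f := fun ζ : Circle => (ζ : ℂ))
      (P.roots.toFinset.finite_toSet.subset ?_) Circle.coe_injective.injOn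
    rintro _ ⟨ζ, hζ, rfl⟩
    simpa [hP] using hζ
  refine hμ _ hfin ?_
  have h1 : ∀ᵐ ζ ∂μ, ζ ∈ {ζ : Circle | P.eval (ζ : ℂ) = 0} := by
    filter_upwards [h0] with ζ hζ
    simpa using hζ
  exact h1

theorem eq_zero_of_circleInner_self [IsFiniteMeasure μ] (hμ : IsNontrivialOnCircle μ) {P : ℂ[X]}
    (h : circleInner μ P P = 0) : P = 0 := by
  by_contra hP
  rw [circleInner_self] at h
  exact (circleNorm_pos hμ hP).ne' (by simpa using h)

theorem degree_C_mul_le_degree (a : ℂ) (P : ℂ[X]) : (C a * P).degree ≤ P.degree := by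
  rcases eq_or_ne a 0 with rfl | ha
  · simp
  · rw [degree_C_mul ha]

/-! ### Monic orthogonal polynomials -/

theorem monicOPUC_degree (n : ℕ) : (monicOPUC μ n).Monic ∧ (monicOPUC μ n).degree = n := by
  induction n using Nat.strong_induction_on with
  | _ n ih =>
    have hs : (∑ k : Fin n, C (circleInner μ (monicOPUC μ k) (X ^ n) /
        ((circleNorm μ (monicOPUC μ k) : ℂ) ^ 2)) * monicOPUC μ k).degree < (n : ℕ) := by
      refine lt_of_le_of_lt (degree_sum_le _ _) ((Finset.sup_lt_iff ?_).2 fun k _ => ?_)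
      · exact_mod_cast WithBot.bot_lt_coe n
      · refine lt_of_le_of_lt (degree_C_mul_le_degree _ _) ?_
        rw [(ih k k.2).2]
        exact_mod_cast k.2
    rw [monicOPUC]
    refine ⟨monic_X_pow_sub (n := n) ?_, ?_⟩
    · simpa using hs
    · rw [degree_sub_eq_left_of_degree_lt (by simpa using hs), degree_X_pow]

theorem monicOPUC_monic (n : ℕ) : (monicOPUC μ n).Monic := (monicOPUC_degree n).1

theorem monicOPUC_ne_zero (n : ℕ) : monicOPUC μ n ≠ 0 := (monicOPUC_monic n).ne_zero

theorem monicOPUC_orthogonal [IsFiniteMeasure μ] (hμ : IsNontrivialOnCircle μ) (n : ℕ) :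
    ∀ j < n, circleInner μ (monicOPUC μ j) (monicOPUC μ n) = 0 := by
  induction n using Nat.strong_induction_on with
  | _ n ih =>
    intro j hj
    conv_lhs => rw [monicOPUC.eq_def μ n]
    rw [circleInner_sub_right, circleInner_sum_right, Finset.sum_eq_single ⟨j, hj⟩]
    · rw [circleInner_C_mul_right, circleInner_self, div_mul_cancel₀, sub_self]
      have := (circleNorm_pos hμ (monicOPUC_ne_zero (μ := μ) j)).ne'
      simpa using this
    · intro k _ hk
      have hk' : (k : ℕ) ≠ j := fun h => hk (Fin.ext h)
      rw [circleInner_C_mul_right]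
      rcases lt_or_gt_of_ne hk' with h | h
      · rw [← circleInner_conj_symm μ (monicOPUC μ k), ih j hj k h]; simp
      · rw [ih k k.2 j h]; simp
    · simp

/-- Subtracting the top coefficient times Φₘ lowers the degree, so orthogonality to the earlier Φₘ
suffices. -/
theorem circleInner_monicOPUC_of_degree_lt [IsFiniteMeasure μ] (hμ : IsNontrivialOnCircle μ) {n : ℕ} {P : ℂ[X]}
    (hP : P.degree < n) : circleInner μ (monicOPUC μ n) P = 0 := by
  suffices H : ∀ m ≤ n, ∀ P : ℂ[X], P.degree < m → circleInner μ (monicOPUC μ n) P = 0 from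
    H n le_rfl P hP
  intro m
  induction m with
  | zero =>
    intro _ P hP
    have : P = 0 := by simpa using hP
    simp [this, circleInner]
  | succ m ih =>
    intro hm P hP
    have h1 : (P - C (P.coeff m) * monicOPUC μ m).degree < m := by
      rw [degree_lt_iff_coeff_zero]
      intro k hk
      rcases hk.eq_or_lt with rfl | hk
      · have : (monicOPUC μ m).coeff m = 1 := by
          have := monicOPUC_monic (μ := μ) m
          rwa [Monic, leadingCoeff, natDegree_eq_of_degree_eq_some (monicOPUC_degree m).2] at this
        simp [this]
      · rw [coeff_sub, coeff_C_mul, coeff_eq_zero_of_degree_lt (hP.trans_le (by exact_mod_cast hk)),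
          coeff_eq_zero_of_degree_lt (p := monicOPUC μ m) (by rw [(monicOPUC_degree m).2]; exact_mod_cast hk)]
        simp
    have h2 := ih (by omega) _ h1
    rw [circleInner_sub_right, circleInner_C_mul_right, ← circleInner_conj_symm μ (monicOPUC μ m),
      monicOPUC_orthogonal hμ n m (by omega)] at h2
    simpa using h2

end Inner

/-! ### The dual polynomials and the Szegő recursion -/

/-- The reversed polynomials `Φₙ*`, defined through their recursion. -/
noncomputable def dualOPUC (μ : Measure Circle) : ℕ → ℂ[X]
  | 0 => 1
  | n + 1 => dualOPUC μ n - C (verblunsky μ n) * (X * monicOPUC μ n)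

section Recursion

variable {μ : Measure Circle}

theorem dualOPUC_eval_succ (n : ℕ) (z : ℂ) : (dualOPUC μ (n + 1)).eval z =
    (dualOPUC μ n).eval z - verblunsky μ n * (z * (monicOPUC μ n).eval z) := by
  simp [dualOPUC]

theorem dualOPUC_eval_zero (n : ℕ) : (dualOPUC μ n).eval 0 = 1 := by
  induction n with
  | zero => simp [dualOPUC]
  | succ n ih => simp [dualOPUC_eval_succ, ih]

theorem dualOPUC_degree_le (n : ℕ) : (dualOPUC μ n).degree ≤ n := by
  induction n with
  | zero => simp [dualOPUC]
  | succ n ih =>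
    rw [dualOPUC]
    refine (degree_sub_le _ _).trans (max_le (ih.trans (by exact_mod_cast n.le_succ)) ?_)
    refine (degree_C_mul_le_degree _ _).trans ?_
    rw [degree_mul, degree_X, (monicOPUC_degree n).2]
    rw [add_comm]; rfl

theorem monicOPUC_zero : monicOPUC μ 0 = 1 := by
  rw [monicOPUC]; simp

theorem conj_circle (ζ : Circle) : conj (ζ : ℂ) = (ζ : ℂ)⁻¹ := by
  rw [← Circle.coe_inv_eq_conj, Circle.coe_inv]

variable [IsFiniteMeasure μ]

/-- On the circle conj ζ = ζ⁻¹, which turns ⟨zᵏ, Φₙ*⟩ into ⟨Φₙ, zⁿ⁻ᵏ⟩. The reversal identity is a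
hypothesis because this lemma is used in the induction that proves it. -/
theorem circleInner_X_pow_of_dual (hμ : IsNontrivialOnCircle μ) (n : ℕ)
    (h : ∀ z : ℂ, z ≠ 0 → (dualOPUC μ n).eval z =
      z ^ n * conj ((monicOPUC μ n).eval (1 / conj z))) :
    ∀ k, 1 ≤ k → k ≤ n → circleInner μ (X ^ k) (dualOPUC μ n) = 0 := by
  intro k hk1 hkn
  have h1 : circleInner μ (X ^ k) (dualOPUC μ n) =
      circleInner μ (monicOPUC μ n) (X ^ (n - k)) := by
    unfold circleInner
    congr 1; ext ζ
    have hz : (ζ : ℂ) ≠ 0 := ζ.coe_ne_zero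
    rw [h _ hz]
    simp only [eval_pow, eval_X, map_pow, conj_circle, one_div, inv_inv]
    rw [pow_sub₀ _ hz hkn, inv_pow]
    ring
  rw [h1]
  refine circleInner_monicOPUC_of_degree_lt hμ ?_
  rw [degree_X_pow]
  exact_mod_cast (by omega : n - k < n)

/-- The difference Q of the two sides has degree at most n (the leading terms cancel), no constant
term (by the definition of αₙ), and is orthogonal to z, …, zⁿ. Hence Q is orthogonal to itself. -/
theorem szego_recursion_of_dual (hμ : IsNontrivialOnCircle μ) (n : ℕ)
    (h : ∀ z : ℂ, z ≠ 0 → (dualOPUC μ n).eval z = z ^ n * conj ((monicOPUC μ n).eval (1 / conj z))) :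
    monicOPUC μ (n + 1) = X * monicOPUC μ n - C (conj (verblunsky μ n)) * dualOPUC μ n := by
  have hdual := circleInner_X_pow_of_dual hμ n h
  set Q := monicOPUC μ (n + 1) -
    (X * monicOPUC μ n - C (conj (verblunsky μ n)) * dualOPUC μ n) with hQ
  have hQ0 : Q.coeff 0 = 0 := by
    rw [coeff_zero_eq_eval_zero, hQ]
    simp [dualOPUC_eval_zero, verblunsky]
  have hQdeg : Q.degree < ((n + 1 : ℕ) : WithBot ℕ) := by
    have h1 : (X * monicOPUC μ n).degree = ((n + 1 : ℕ) : WithBot ℕ) := by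
      rw [degree_mul, degree_X, (monicOPUC_degree n).2]
      rw [add_comm]; rfl
    have h2 : (monicOPUC μ (n + 1) - X * monicOPUC μ n).degree < ((n + 1 : ℕ) : WithBot ℕ) := by
      have := degree_sub_lt_left (p := monicOPUC μ (n + 1)) (q := X * monicOPUC μ n)
        (by rw [(monicOPUC_degree _).2, h1]) (monicOPUC_ne_zero _)
        (by rw [(monicOPUC_monic _).leadingCoeff, (monic_X.mul (monicOPUC_monic n)).leadingCoeff])
      rwa [(monicOPUC_degree _).2] at this
    rw [hQ, ← sub_add]
    refine lt_of_le_of_lt (degree_add_le _ _) (max_lt h2 ?_)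
    refine lt_of_le_of_lt ((degree_C_mul_le_degree _ _).trans (dualOPUC_degree_le n)) ?_
    exact_mod_cast n.lt_succ_self
  have horth : ∀ k, 1 ≤ k → k ≤ n → circleInner μ (X ^ k) Q = 0 := by
    intro k hk1 hkn
    rw [hQ, circleInner_sub_right, circleInner_sub_right, circleInner_C_mul_right,
      hdual k hk1 hkn, ← circleInner_conj_symm μ (monicOPUC μ (n + 1)),
      circleInner_monicOPUC_of_degree_lt hμ (by rw [degree_X_pow]; exact_mod_cast (by omega))]
    have : circleInner μ (X ^ k) (X * monicOPUC μ n) =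
        circleInner μ (X ^ (k - 1)) (monicOPUC μ n) := by
      unfold circleInner
      congr 1; ext ζ
      have hz : (ζ : ℂ) ≠ 0 := ζ.coe_ne_zero
      obtain ⟨m, rfl⟩ := Nat.exists_eq_add_of_le' hk1
      simp only [eval_pow, eval_X, map_pow, conj_circle, eval_mul, Nat.add_sub_cancel]
      rw [pow_succ]
      field_simp
    rw [this, ← circleInner_conj_symm, circleInner_monicOPUC_of_degree_lt hμ
      (by rw [degree_X_pow]; exact_mod_cast (by omega : k - 1 < n))]
    simp
  have hQQ : circleInner μ Q Q = 0 := by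
    by_cases hQz : Q = 0
    · simp [hQz, circleInner]
    have hsum := Q.as_sum_range_C_mul_X_pow' ((natDegree_lt_iff_degree_lt hQz).2 hQdeg)
    have : circleInner μ Q (∑ i ∈ Finset.range (n + 1), C (Q.coeff i) * X ^ i) = 0 := by
      rw [circleInner_sum_right]
      refine Finset.sum_eq_zero fun i hi => ?_
      rw [circleInner_C_mul_right]
      rcases Nat.eq_zero_or_pos i with rfl | hpos
      · simp [hQ0]
      · rw [← circleInner_conj_symm, horth i hpos (by simpa [Nat.lt_succ_iff] using hi)]; simp
    rwa [← hsum] at this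
  exact sub_eq_zero.1 (eq_zero_of_circleInner_self hμ hQQ)

/-- `Φₙ*(z) = zⁿ conj (Φₙ(1 / conj z))`. -/
theorem dualOPUC_eval (hμ : IsNontrivialOnCircle μ) (n : ℕ) : ∀ z : ℂ, z ≠ 0 →
    (dualOPUC μ n).eval z = z ^ n * conj ((monicOPUC μ n).eval (1 / conj z)) := by
  induction n with
  | zero => intro z _; simp [dualOPUC, monicOPUC_zero]
  | succ n ih =>
    intro z hz
    have hz' : conj z ≠ 0 := by simpa using hz
    -- The recursion for Φₙ₊₁ is evaluated at 1/conj z, so the induction hypothesis is needed both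
    -- there and at z.
    have h1 := ih (1 / conj z) (by simpa using hz)
    rw [dualOPUC_eval_succ, szego_recursion_of_dual hμ n ih]
    simp only [eval_sub, eval_mul, eval_X, eval_C, map_sub, map_mul, h1, ih z hz]
    simp only [map_pow, Complex.conj_conj, one_div]
    rw [map_inv₀, Complex.conj_conj, pow_succ, inv_pow]
    field_simp

theorem szego_recursion (hμ : IsNontrivialOnCircle μ) (n : ℕ) (z : ℂ) :
    (monicOPUC μ (n + 1)).eval z =
      z * (monicOPUC μ n).eval z - conj (verblunsky μ n) * (dualOPUC μ n).eval z := by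
  rw [szego_recursion_of_dual hμ n (dualOPUC_eval hμ n)]
  simp

theorem monicOPUC_eval (hμ : IsNontrivialOnCircle μ) (n : ℕ) {z : ℂ} (hz : z ≠ 0) :
    (monicOPUC μ n).eval z = z ^ n * conj ((dualOPUC μ n).eval (1 / conj z)) := by
  rw [dualOPUC_eval hμ n _ (by simpa using hz)]
  simp only [map_mul, map_pow, Complex.conj_conj, one_div, inv_inv, map_inv₀, inv_pow]
  field_simp

theorem circleInner_X_pow_dualOPUC (hμ : IsNontrivialOnCircle μ) {n k : ℕ} (hk : 1 ≤ k)
    (hkn : k ≤ n) : circleInner μ (X ^ k) (dualOPUC μ n) = 0 :=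
  circleInner_X_pow_of_dual hμ n (dualOPUC_eval hμ n) k hk hkn

/-- Pythagoras in zΦₙ = Φₙ₊₁ + conj(αₙ)Φₙ*: the summands are orthogonal, and zΦₙ and Φₙ* both have
the norm of Φₙ. Thus ‖Φₙ₊₁‖² = (1 − |αₙ|²)‖Φₙ‖², which is positive. -/
theorem norm_verblunsky_lt_one (hμ : IsNontrivialOnCircle μ) (n : ℕ) : ‖verblunsky μ n‖ < 1 := by
  have hstar : circleNorm μ (dualOPUC μ n) = circleNorm μ (monicOPUC μ n) := by
    unfold circleNorm
    congr 2; ext ζ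
    rw [dualOPUC_eval hμ n _ ζ.coe_ne_zero]
    simp [conj_circle, Circle.norm_coe]
  have hX : circleNorm μ (X * monicOPUC μ n) = circleNorm μ (monicOPUC μ n) := by
    unfold circleNorm
    congr 2; ext ζ
    simp [Circle.norm_coe]
  have hrec : X * monicOPUC μ n =
      monicOPUC μ (n + 1) + C (conj (verblunsky μ n)) * dualOPUC μ n := by
    rw [szego_recursion_of_dual hμ n (dualOPUC_eval hμ n)]; ring
  have horth : circleInner μ (monicOPUC μ (n + 1)) (dualOPUC μ n) = 0 :=
    circleInner_monicOPUC_of_degree_lt hμ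
      ((dualOPUC_degree_le n).trans_lt (by exact_mod_cast n.lt_succ_self))
  have horth' : circleInner μ (dualOPUC μ n) (monicOPUC μ (n + 1)) = 0 := by
    rw [← circleInner_conj_symm, horth]; simp
  have h := circleInner_self μ (X * monicOPUC μ n)
  rw [hX] at h
  conv_lhs at h => rw [hrec]
  rw [circleInner_add_right, circleInner_C_mul_right, ← circleInner_conj_symm,
    ← circleInner_conj_symm μ (dualOPUC μ n), circleInner_add_right, circleInner_add_right,
    circleInner_C_mul_right, circleInner_C_mul_right, horth, horth', circleInner_self,
    circleInner_self, hstar] at h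
  simp only [mul_zero, add_zero, zero_add, map_mul, map_pow, Complex.conj_ofReal,
    Complex.conj_conj] at h
  rw [← mul_assoc, mul_comm (conj _), Complex.mul_conj, Complex.normSq_eq_norm_sq] at h
  have h' : circleNorm μ (monicOPUC μ (n + 1)) ^ 2 +
      ‖verblunsky μ n‖ ^ 2 * circleNorm μ (monicOPUC μ n) ^ 2 =
      circleNorm μ (monicOPUC μ n) ^ 2 := by exact_mod_cast h
  have p1 := circleNorm_pos hμ (monicOPUC_ne_zero (μ := μ) (n + 1))
  have p2 := circleNorm_pos hμ (monicOPUC_ne_zero (μ := μ) n)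
  by_contra! hge
  nlinarith [sq_nonneg (‖verblunsky μ n‖ - 1), mul_le_mul hge hge (by positivity) (by positivity),
    pow_pos p1 2, pow_pos p2 2, mul_nonneg (sub_nonneg.2 hge) (pow_pos p2 2).le]

theorem norm_monicOPUC_le_dual (hμ : IsNontrivialOnCircle μ) (n : ℕ) {z : ℂ} (hz : ‖z‖ ≤ 1) :
    ‖(monicOPUC μ n).eval z‖ ≤ ‖(dualOPUC μ n).eval z‖ := by
  induction n with
  | zero => simp [monicOPUC_zero, dualOPUC]
  | succ n ih =>
    have h1 : ‖z * (monicOPUC μ n).eval z‖ ≤ ‖(dualOPUC μ n).eval z‖ := by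
      rw [norm_mul]
      exact (mul_le_of_le_one_left (norm_nonneg _) hz).trans ih
    have hα := (norm_verblunsky_lt_one hμ n).le
    rw [szego_recursion hμ, dualOPUC_eval_succ]
    -- The step of the recursion, with u = zΦₙ and v = Φₙ*, multiplies |v|² − |u|² by 1 − |α|² ≥ 0,
    -- so the inequality propagates.
    have key : ∀ u v α : ℂ, Complex.normSq (v - α * u) - Complex.normSq (u - conj α * v) =
        (1 - Complex.normSq α) * (Complex.normSq v - Complex.normSq u) := by
      intro u v α
      simp only [Complex.normSq_apply, Complex.sub_re, Complex.sub_im, Complex.mul_re,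
        Complex.mul_im, Complex.conj_re, Complex.conj_im]
      ring
    have := key (z * (monicOPUC μ n).eval z) ((dualOPUC μ n).eval z) (verblunsky μ n)
    simp only [Complex.normSq_eq_norm_sq] at this
    refine le_of_sq_le_sq ?_ (norm_nonneg _)
    have h2 : 0 ≤ (1 - ‖verblunsky μ n‖ ^ 2) := by nlinarith [norm_nonneg (verblunsky μ n)]
    have h3 : 0 ≤ ‖(dualOPUC μ n).eval z‖ ^ 2 - ‖z * (monicOPUC μ n).eval z‖ ^ 2 := by
      nlinarith [norm_nonneg (z * (monicOPUC μ n).eval z)]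
    linarith [mul_nonneg h2 h3]

theorem norm_dualOPUC_succ_le (hμ : IsNontrivialOnCircle μ) (n : ℕ) {z : ℂ} (hz : ‖z‖ ≤ 1) :
    ‖(dualOPUC μ (n + 1)).eval z‖ ≤ (1 + ‖verblunsky μ n‖) * ‖(dualOPUC μ n).eval z‖ := by
  rw [dualOPUC_eval_succ]
  refine (norm_sub_le _ _).trans ?_
  rw [norm_mul, norm_mul, add_mul, one_mul]
  gcongr
  exact (mul_le_of_le_one_left (norm_nonneg _) hz).trans (norm_monicOPUC_le_dual hμ n hz)

theorem le_norm_dualOPUC_succ (hμ : IsNontrivialOnCircle μ) (n : ℕ) {z : ℂ} (hz : ‖z‖ ≤ 1) :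
    (1 - ‖verblunsky μ n‖) * ‖(dualOPUC μ n).eval z‖ ≤ ‖(dualOPUC μ (n + 1)).eval z‖ := by
  rw [dualOPUC_eval_succ]
  refine le_trans ?_ (norm_sub_norm_le _ _)
  rw [norm_mul, norm_mul, sub_mul, one_mul]
  gcongr
  exact (mul_le_of_le_one_left (norm_nonneg _) hz).trans (norm_monicOPUC_le_dual hμ n hz)

theorem norm_dualOPUC_le (hμ : IsNontrivialOnCircle μ) (hα : Summable fun n => ‖verblunsky μ n‖) :
    ∃ M : ℝ, 0 < M ∧ ∀ n, ∀ z : ℂ, ‖z‖ ≤ 1 → ‖(dualOPUC μ n).eval z‖ ≤ M := by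
  refine ⟨Real.exp (∑' n, ‖verblunsky μ n‖), Real.exp_pos _, fun n z hz => ?_⟩
  have h : ‖(dualOPUC μ n).eval z‖ ≤ Real.exp (∑ k ∈ Finset.range n, ‖verblunsky μ k‖) := by
    induction n with
    | zero => simp [dualOPUC]
    | succ n ih =>
      refine (norm_dualOPUC_succ_le hμ n hz).trans ?_
      rw [Finset.sum_range_succ, add_comm (∑ k ∈ _, _), Real.exp_add]
      gcongr
      linarith [Real.add_one_le_exp ‖verblunsky μ n‖]
  exact h.trans (Real.exp_le_exp.2 (hα.sum_le_tsum _ fun _ _ => norm_nonneg _))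

/-- Each step costs a factor 1 − |αₙ| > 0. From an index N on, the sum of |αₙ| is at most 1/2, and
∏(1 − |αₙ|) ≥ 1 − ∑|αₙ| bounds the remaining product below by 1/2. -/
theorem exists_le_norm_dualOPUC (hμ : IsNontrivialOnCircle μ)
    (hα : Summable fun n => ‖verblunsky μ n‖) :
    ∃ m : ℝ, 0 < m ∧ ∃ N, ∀ n ≥ N, ∀ z : ℂ, ‖z‖ ≤ 1 → m ≤ ‖(dualOPUC μ n).eval z‖ := by
  have hpos : ∀ n, ∃ m : ℝ, 0 < m ∧ ∀ z : ℂ, ‖z‖ ≤ 1 → m ≤ ‖(dualOPUC μ n).eval z‖ := by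
    intro n
    induction n with
    | zero => exact ⟨1, one_pos, fun z _ => by simp [dualOPUC]⟩
    | succ n ih =>
      obtain ⟨m, hm, h⟩ := ih
      have h1 := sub_pos.2 (norm_verblunsky_lt_one hμ n)
      exact ⟨(1 - ‖verblunsky μ n‖) * m, by positivity, fun z hz =>
        (mul_le_mul_of_nonneg_left (h z hz) h1.le).trans (le_norm_dualOPUC_succ hμ n hz)⟩
  obtain ⟨N, hN⟩ := ((tendsto_sum_nat_add fun n => ‖verblunsky μ n‖).eventually
    (gt_mem_nhds (show (0 : ℝ) < 1 / 2 by norm_num))).exists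
  obtain ⟨m, hm, h⟩ := hpos N
  have hle : ∀ k, ∑ i ∈ Finset.range k, ‖verblunsky μ (i + N)‖ ≤ 1 / 2 := fun k =>
    (((summable_nat_add_iff N).2 hα).sum_le_tsum _ fun _ _ => norm_nonneg _).trans hN.le
  refine ⟨1 / 2 * m, by positivity, N, fun n hn z hz => ?_⟩
  obtain ⟨k, rfl⟩ := Nat.exists_eq_add_of_le' hn
  have key : (1 - ∑ i ∈ Finset.range k, ‖verblunsky μ (i + N)‖) * m ≤
      ‖(dualOPUC μ (k + N)).eval z‖ := by
    clear hn
    induction k with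
    | zero => simpa using h z hz
    | succ k ih =>
      have h1 := le_norm_dualOPUC_succ hμ (k + N) hz
      have h2 := norm_verblunsky_lt_one hμ (k + N)
      have h3 := hle k
      have h4 : 0 ≤ ∑ i ∈ Finset.range k, ‖verblunsky μ (i + N)‖ :=
        Finset.sum_nonneg fun _ _ => norm_nonneg _
      rw [show k + 1 + N = k + N + 1 by ring, Finset.sum_range_succ]
      refine le_trans ?_ (h1.trans' (mul_le_mul_of_nonneg_left ih (sub_nonneg.2 h2.le)))
      rw [← mul_assoc]
      gcongr
      nlinarith [mul_nonneg (norm_nonneg (verblunsky μ (k + N))) h4]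
  refine le_trans ?_ key
  gcongr
  linarith [hle k]

end Recursion

/-! ### Measures on the circle are determined by their moments -/

theorem Circle.norm_coe_pow (ζ : Circle) (n : ℕ) : ‖(ζ : ℂ) ^ n‖ = 1 := by
  rw [norm_pow, Circle.norm_coe, one_pow]

theorem exists_poly_conj_eval (P : ℂ[X]) :
    ∃ (M : ℕ) (Q : ℂ[X]), ∀ ζ : Circle, (ζ : ℂ) ^ M * conj (P.eval (ζ : ℂ)) = Q.eval (ζ : ℂ) := by
  induction P using Polynomial.induction_on' with
  | add P Q hP hQ =>
    obtain ⟨M, P', hP⟩ := hP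
    obtain ⟨N, Q', hQ⟩ := hQ
    refine ⟨M + N, X ^ N * P' + X ^ M * Q', fun ζ => ?_⟩
    simp only [eval_add, eval_mul, eval_pow, eval_X, ← hP, ← hQ, map_add]
    ring
  | monomial n a =>
    refine ⟨n, C (conj a), fun ζ => ?_⟩
    have := ζ.coe_ne_zero
    simp only [eval_monomial, map_mul, map_pow, conj_circle, eval_C, inv_pow]
    field_simp

/-- Negative moments are conjugates of positive ones, so all Laurent polynomials have equal
integrals. They form a star subalgebra that separates points, and such an algebra determines a
finite measure. -/
theorem Circle.measure_ext_of_moments {μ ν : Measure Circle} [IsFiniteMeasure μ]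
    [IsFiniteMeasure ν]
    (h : ∀ k : ℕ, ∫ ζ : Circle, (ζ : ℂ) ^ k ∂μ = ∫ ζ : Circle, (ζ : ℂ) ^ k ∂ν) : μ = ν := by
  have hc : ∀ k : ℕ, ∫ ζ : Circle, conj (ζ : ℂ) ^ k ∂μ = ∫ ζ : Circle, conj (ζ : ℂ) ^ k ∂ν := by
    intro k
    simp only [← map_pow, integral_conj, h k]
  have hm : ∀ j N : ℕ, ∫ ζ : Circle, (ζ : ℂ) ^ j * conj (ζ : ℂ) ^ N ∂μ =
      ∫ ζ : Circle, (ζ : ℂ) ^ j * conj (ζ : ℂ) ^ N ∂ν := by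
    intro j N
    rcases le_total N j with hle | hle
    · obtain ⟨d, rfl⟩ := Nat.exists_eq_add_of_le hle
      convert h d using 2 <;>
      · ext ζ
        have := ζ.coe_ne_zero
        rw [conj_circle, pow_add, inv_pow]; field_simp
    · obtain ⟨d, rfl⟩ := Nat.exists_eq_add_of_le hle
      convert hc d using 2 <;>
      · ext ζ
        have := ζ.coe_ne_zero
        rw [conj_circle, pow_add, inv_pow, inv_pow]; field_simp
  let A : StarSubalgebra ℂ (BoundedContinuousFunction Circle ℂ) :=
    -- Laurent polynomials, described by clearing the negative powers.
    { carrier := {f | ∃ (N : ℕ) (P : ℂ[X]), ∀ ζ : Circle, (ζ : ℂ) ^ N * f ζ = P.eval (ζ : ℂ)}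
      mul_mem' := by
        rintro f g ⟨N, P, hP⟩ ⟨M, Q, hQ⟩
        refine ⟨N + M, P * Q, fun ζ => ?_⟩
        rw [eval_mul, ← hP, ← hQ, BoundedContinuousFunction.mul_apply]; ring
      add_mem' := by
        rintro f g ⟨N, P, hP⟩ ⟨M, Q, hQ⟩
        refine ⟨N + M, X ^ M * P + X ^ N * Q, fun ζ => ?_⟩
        simp only [eval_add, eval_mul, eval_pow, eval_X, ← hP, ← hQ,
          BoundedContinuousFunction.add_apply]
        ring
      algebraMap_mem' := fun r => ⟨0, C r, fun ζ => by simp⟩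
      star_mem' := by
        rintro f ⟨N, P, hP⟩
        obtain ⟨M, Q, hQ⟩ := exists_poly_conj_eval P
        refine ⟨M, X ^ N * Q, fun ζ => ?_⟩
        have := ζ.coe_ne_zero
        simp only [eval_mul, eval_pow, eval_X, ← hQ, ← hP, map_mul, map_pow, conj_circle, inv_pow,
          BoundedContinuousFunction.star_apply]
        field_simp
        rfl }
  refine ext_of_forall_mem_subalgebra_integral_eq_of_polish (𝕜 := ℂ) (A := A) ?_ ?_
  · intro x y hxy
    let f : BoundedContinuousFunction Circle ℂ :=
      BoundedContinuousFunction.mkOfCompact ⟨fun ζ : Circle => (ζ : ℂ), by fun_prop⟩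
    refine ⟨f, ⟨f, ?_, ?_⟩, fun h => hxy (Circle.coe_injective h)⟩
    · refine ⟨f, ?_, rfl⟩
      exact ⟨0, X, fun ζ => by simp only [pow_zero, one_mul, eval_X]; rfl⟩
    · rfl
  · rintro f ⟨N, P, hP⟩
    have hf : ∀ ζ : Circle, f ζ = ∑ j ∈ Finset.range (P.natDegree + 1),
        P.coeff j * ((ζ : ℂ) ^ j * conj (ζ : ℂ) ^ N) := by
      intro ζ
      have hz := ζ.coe_ne_zero
      have h1 : f ζ = conj (ζ : ℂ) ^ N * P.eval (ζ : ℂ) := by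
        rw [← hP, conj_circle, inv_pow]; field_simp
      rw [h1, eval_eq_sum_range, Finset.mul_sum]
      exact Finset.sum_congr rfl fun j _ => by ring
    simp only [hf]
    rw [integral_finsetSum _ fun j _ => Continuous.integrable_circle (by fun_prop),
      integral_finsetSum _ fun j _ => Continuous.integrable_circle (by fun_prop)]
    refine Finset.sum_congr rfl fun j _ => ?_
    rw [integral_const_mul, integral_const_mul, hm]

/-! ### Normalized arc length -/

theorem integral_circleArc {E : Type*} [NormedAddCommGroup E] [NormedSpace ℝ E] (f : Circle → E)
    (hf : Continuous f) : ∫ ζ, f ζ ∂circleArc =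
      (2 * Real.pi)⁻¹ • ∫ θ in (-Real.pi)..Real.pi, f (Circle.exp θ) := by
  unfold circleArc
  rw [integral_smul_measure, ENNReal.toReal_ofReal (by positivity), integral_map
    (by fun_prop) hf.aestronglyMeasurable,
    intervalIntegral.integral_of_le (by linarith [Real.pi_pos])]

theorem integral_circleArc_eq_circleAverage {E : Type*} [NormedAddCommGroup E] [NormedSpace ℝ E]
    (f : ℂ → E) (hf : Continuous fun ζ : Circle => f ζ) :
    ∫ ζ : Circle, f ζ ∂circleArc = Real.circleAverage f 0 1 := by
  rw [integral_circleArc _ hf, Real.circleAverage_eq_integral_add (-Real.pi),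
    intervalIntegral.integral_comp_add_right (fun θ => f (circleMap 0 1 θ))]
  congr 2
  · ext θ; simp [circleMap]
  · ring
  · ring

instance isProbabilityMeasure_circleArc : IsProbabilityMeasure circleArc := by
  constructor
  unfold circleArc
  rw [Measure.smul_apply, Measure.map_apply (by fun_prop) MeasurableSet.univ]
  simp only [Set.preimage_univ, Measure.restrict_apply MeasurableSet.univ, Set.univ_inter,
    Real.volume_Ioc, smul_eq_mul]
  rw [← ENNReal.ofReal_mul (by positivity), ← ENNReal.ofReal_one]
  congr 1
  field_simp [Real.pi_pos.ne']
  ring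

theorem integral_circleArc_pow {k : ℕ} (hk : k ≠ 0) : ∫ ζ : Circle, (ζ : ℂ) ^ k ∂circleArc = 0 := by
  rw [integral_circleArc_eq_circleAverage (fun z => z ^ k) (by fun_prop)]
  have h : DiffContOnCl ℂ (fun z : ℂ => z ^ k) (Metric.ball 0 |1|) :=
    (Differentiable.diffContOnCl (by fun_prop))
  rw [h.circleAverage]
  simp [hk]

theorem eq_smul_circleArc {ν : Measure Circle} [IsFiniteMeasure ν]
    (h : ∀ k : ℕ, k ≠ 0 → ∫ ζ : Circle, (ζ : ℂ) ^ k ∂ν = 0) : ν = ν Set.univ • circleArc := by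
  have : IsFiniteMeasure (ν Set.univ • circleArc) :=
    Measure.smul_finite _ (measure_ne_top ν _)
  refine Circle.measure_ext_of_moments fun k => ?_
  rw [integral_smul_measure]
  rcases eq_or_ne k 0 with rfl | hk
  · simp [Measure.real]
  · rw [h k hk, integral_circleArc_pow hk, smul_zero]

/-! ### The limit of the dual polynomials -/

/-- The limit of the dual polynomials `Φₙ*`. -/
noncomputable def dualLimit (μ : Measure Circle) (z : ℂ) : ℂ :=
  1 - ∑' n, verblunsky μ n * (z * (monicOPUC μ n).eval z)

section Limit

variable {μ : Measure Circle} {A b : ℝ}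

theorem dualOPUC_eval_eq_sum (n : ℕ) (z : ℂ) : (dualOPUC μ n).eval z =
    1 - ∑ k ∈ Finset.range n, verblunsky μ k * (z * (monicOPUC μ k).eval z) := by
  induction n with
  | zero => simp [dualOPUC]
  | succ n ih => rw [dualOPUC_eval_succ, ih, Finset.sum_range_succ]; ring

theorem summable_verblunsky (hb0 : 0 < b) (hb1 : b < 1) (hα : ∀ n, ‖verblunsky μ n‖ ≤ A * b ^ n) :
    Summable fun n => ‖verblunsky μ n‖ :=
  Summable.of_nonneg_of_le (fun _ => norm_nonneg _) hα
    ((summable_geometric_of_lt_one hb0.le hb1).mul_left A)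

theorem dualLimit_zero : dualLimit μ 0 = 1 := by simp [dualLimit]

variable [IsFiniteMeasure μ]

/-- In the disk Φₙ is dominated by Φₙ*; outside, the reversal identity reduces Φₙ to Φₙ* at a point
of the disk, at the cost of |z|ⁿ. -/
theorem norm_monicOPUC_le (hμ : IsNontrivialOnCircle μ)
    (hs : Summable fun n => ‖verblunsky μ n‖) : ∃ M : ℝ, 0 < M ∧ ∀ n, ∀ r : ℝ, 1 ≤ r →
      ∀ z : ℂ, ‖z‖ ≤ r → ‖(monicOPUC μ n).eval z‖ ≤ M * r ^ n := by
  obtain ⟨M, hM, h⟩ := norm_dualOPUC_le hμ hs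
  refine ⟨M, hM, fun n r hr z hz => ?_⟩
  rcases le_or_gt ‖z‖ 1 with h1 | h1
  · exact (norm_monicOPUC_le_dual hμ n h1).trans ((h n z h1).trans
      (le_mul_of_one_le_right hM.le (one_le_pow₀ hr)))
  · have hz0 : z ≠ 0 := by rintro rfl; simp at h1; linarith
    rw [monicOPUC_eval hμ n hz0, norm_mul, norm_pow, RCLike.norm_conj, mul_comm]
    gcongr
    refine h n _ ?_
    rw [norm_div, norm_one, RCLike.norm_conj, div_le_one (by positivity)]
    exact h1.le

theorem norm_dualLimit_term_le (hμ : IsNontrivialOnCircle μ) (hb0 : 0 < b) (hb1 : b < 1)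
    (hα : ∀ n, ‖verblunsky μ n‖ ≤ A * b ^ n) : ∃ M : ℝ, 0 ≤ M ∧ ∀ n, ∀ r : ℝ, 1 ≤ r →
      ∀ z : ℂ, ‖z‖ ≤ r →
        ‖verblunsky μ n * (z * (monicOPUC μ n).eval z)‖ ≤ M * r * (b * r) ^ n := by
  obtain ⟨M, hM, h⟩ := norm_monicOPUC_le hμ (summable_verblunsky hb0 hb1 hα)
  have hA : 0 ≤ A := by simpa using (norm_nonneg _).trans (hα 0)
  refine ⟨A * M, by positivity, fun n r hr z hz => ?_⟩
  rw [norm_mul, norm_mul]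
  calc _ ≤ (A * b ^ n) * (r * (M * r ^ n)) := by
        gcongr
        · exact hα n
        · exact h n r hr z hz
    _ = _ := by rw [mul_pow]; ring

/-- The error is the tail of a series with terms O((br)ⁿ). Allowing r > 1 is what makes Ψ analytic
up to |z| = 1/b. -/
theorem dualOPUC_tendsto (hμ : IsNontrivialOnCircle μ) (hb0 : 0 < b) (hb1 : b < 1)
    (hα : ∀ n, ‖verblunsky μ n‖ ≤ A * b ^ n) {r : ℝ} (hr : 1 ≤ r) (hbr : b * r < 1) :
    ∃ M : ℝ, 0 ≤ M ∧ ∀ n, ∀ z : ℂ, ‖z‖ ≤ r →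
      ‖(dualOPUC μ n).eval z - dualLimit μ z‖ ≤ M * (b * r) ^ n := by
  obtain ⟨M, hM, h⟩ := norm_dualLimit_term_le hμ hb0 hb1 hα
  have hr0 : 0 < r := by linarith
  have hgeo := summable_geometric_of_lt_one (by positivity : 0 ≤ b * r) hbr
  refine ⟨M * r * (1 - b * r)⁻¹, by have := sub_pos.2 hbr; positivity, fun n z hz => ?_⟩
  have hsum : Summable fun n => verblunsky μ n * (z * (monicOPUC μ n).eval z) :=
    Summable.of_norm_bounded (hgeo.mul_left (M * r)) fun n => h n r hr z hz
  have h1 : (dualOPUC μ n).eval z - dualLimit μ z =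
      ∑' k, verblunsky μ (k + n) * (z * (monicOPUC μ (k + n)).eval z) := by
    rw [dualOPUC_eval_eq_sum, dualLimit, ← hsum.sum_add_tsum_nat_add n]
    exact sub_sub_sub_cancel_left _ _ _ |>.trans (add_sub_cancel_left _ _)
  rw [h1]
  refine tsum_of_norm_bounded (g := fun k => M * r * (b * r) ^ n * (b * r) ^ k) ?_ fun k => ?_
  · have := (hasSum_geometric_of_lt_one (by positivity : 0 ≤ b * r) hbr).mul_left
      (M * r * (b * r) ^ n)
    rwa [show M * r * (1 - b * r)⁻¹ * (b * r) ^ n = M * r * (b * r) ^ n * (1 - b * r)⁻¹ by ring]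
  · refine (h (k + n) r hr z hz).trans (le_of_eq ?_)
    rw [pow_add]; ring

theorem differentiableOn_dualLimit (hμ : IsNontrivialOnCircle μ) (hb0 : 0 < b) (hb1 : b < 1)
    (hα : ∀ n, ‖verblunsky μ n‖ ≤ A * b ^ n) :
    DifferentiableOn ℂ (dualLimit μ) (Metric.ball 0 (1 / b)) := by
  obtain ⟨M, hM, h⟩ := norm_dualLimit_term_le hμ hb0 hb1 hα
  intro z hz
  have hz' : ‖z‖ < 1 / b := by simpa using hz
  have h1b : 1 < 1 / b := by rw [lt_div_iff₀ hb0]; linarith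
  obtain ⟨r, hr1, hr2⟩ := exists_between (max_lt hz' h1b)
  have hr : 1 ≤ r := (le_max_right _ _).trans hr1.le
  have hbr : b * r < 1 := by rw [mul_comm]; exact (lt_div_iff₀ hb0).1 hr2
  have hr0 : 0 < r := by linarith
  have hgeo := summable_geometric_of_lt_one (by positivity : 0 ≤ b * r) hbr
  have hd : DifferentiableOn ℂ (dualLimit μ) (Metric.ball 0 r) := by
    refine DifferentiableOn.const_sub ?_ _
    refine Complex.differentiableOn_tsum_of_summable_norm (hgeo.mul_left (M * r))
      (fun n => Differentiable.differentiableOn (by fun_prop)) Metric.isOpen_ball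
      fun n w hw => h n r hr w (by simpa using (mem_ball_zero_iff.1 hw).le)
  exact (hd.differentiableAt (Metric.isOpen_ball.mem_nhds (by
    simpa using (le_max_left _ _).trans_lt hr1))).differentiableWithinAt

theorem exists_le_norm_dualLimit (hμ : IsNontrivialOnCircle μ) (hb0 : 0 < b) (hb1 : b < 1)
    (hα : ∀ n, ‖verblunsky μ n‖ ≤ A * b ^ n) :
    ∃ m : ℝ, 0 < m ∧ ∀ z : ℂ, ‖z‖ ≤ 1 → m ≤ ‖dualLimit μ z‖ := by
  obtain ⟨m, hm, N, h⟩ := exists_le_norm_dualOPUC hμ (summable_verblunsky hb0 hb1 hα)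
  obtain ⟨M, hM, hlim⟩ := dualOPUC_tendsto hμ hb0 hb1 hα le_rfl (by simpa using hb1)
  refine ⟨m, hm, fun z hz => ?_⟩
  have ht : Filter.Tendsto (fun n => (dualOPUC μ n).eval z) Filter.atTop
      (nhds (dualLimit μ z)) := by
    rw [tendsto_iff_norm_sub_tendsto_zero]
    refine squeeze_zero (fun _ => norm_nonneg _) (fun n => hlim n z hz) ?_
    simpa using (tendsto_pow_atTop_nhds_zero_of_lt_one hb0.le hb1).const_mul M
  exact ge_of_tendsto ht.norm (Filter.eventually_atTop.2 ⟨N, fun n hn => h n hn z hz⟩)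

theorem continuous_dualLimit_circle (hμ : IsNontrivialOnCircle μ) (hb0 : 0 < b) (hb1 : b < 1)
    (hα : ∀ n, ‖verblunsky μ n‖ ≤ A * b ^ n) : Continuous fun ζ : Circle => dualLimit μ ζ := by
  refine (differentiableOn_dualLimit hμ hb0 hb1 hα).continuousOn.comp_continuous
    (by fun_prop) fun ζ => ?_
  rw [mem_ball_zero_iff, Circle.norm_coe, lt_div_iff₀ hb0]; linarith

theorem integral_conj_pow_mul_dualLimit (hμ : IsNontrivialOnCircle μ) (hb0 : 0 < b) (hb1 : b < 1)
    (hα : ∀ n, ‖verblunsky μ n‖ ≤ A * b ^ n) {k : ℕ} (hk : k ≠ 0) :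
    ∫ ζ : Circle, conj ((ζ : ℂ) ^ k) * dualLimit μ ζ ∂μ = 0 := by
  obtain ⟨M, hM, hlim⟩ := dualOPUC_tendsto hμ hb0 hb1 hα le_rfl (by simpa using hb1)
  have hcont := continuous_dualLimit_circle hμ hb0 hb1 hα
  have hle : ∀ n ≥ k, ‖∫ ζ : Circle, conj ((ζ : ℂ) ^ k) * dualLimit μ ζ ∂μ‖ ≤
      M * b ^ n * μ.real Set.univ := by
    intro n hn
    have h0 := circleInner_X_pow_dualOPUC hμ (Nat.one_le_iff_ne_zero.2 hk) hn
    unfold circleInner at h0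
    simp only [eval_pow, eval_X] at h0
    rw [← norm_neg, ← zero_sub, ← h0, ← integral_sub (Continuous.integrable_circle (by fun_prop))
      (Continuous.integrable_circle (by fun_prop))]
    refine norm_integral_le_of_norm_le_const (Filter.Eventually.of_forall fun ζ => ?_)
    rw [← mul_sub, norm_mul, RCLike.norm_conj, Circle.norm_coe_pow, one_mul]
    simpa using hlim n ζ (Circle.norm_coe ζ).le
  have ht : Filter.Tendsto (fun n => M * b ^ n * μ.real Set.univ) Filter.atTop (nhds 0) := by
    simpa using ((tendsto_pow_atTop_nhds_zero_of_lt_one hb0.le hb1).const_mul M).mul_const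
      (μ.real Set.univ)
  exact norm_le_zero_iff.1 (ge_of_tendsto ht (Filter.eventually_atTop.2 ⟨k, hle⟩))

/-- The factor conj Ψ is a uniform limit of conjugated polynomials on the circle, and a conjugated
monomial only raises the exponent k, which stays positive. So the orthogonality of Ψ to zᵏ, k ≥ 1,
applies. -/
theorem integral_conj_pow_mul_normSq_dualLimit (hμ : IsNontrivialOnCircle μ) (hb0 : 0 < b)
    (hb1 : b < 1) (hα : ∀ n, ‖verblunsky μ n‖ ≤ A * b ^ n) {k : ℕ} (hk : k ≠ 0) :
    ∫ ζ : Circle, conj ((ζ : ℂ) ^ k) * (conj (dualLimit μ ζ) * dualLimit μ ζ) ∂μ = 0 := by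
  obtain ⟨M, hM, hlim⟩ := dualOPUC_tendsto hμ hb0 hb1 hα le_rfl (by simpa using hb1)
  have hcont := continuous_dualLimit_circle hμ hb0 hb1 hα
  have hpoly : ∀ P : ℂ[X],
      ∫ ζ : Circle, conj ((ζ : ℂ) ^ k) * (conj (P.eval (ζ : ℂ)) * dualLimit μ ζ) ∂μ = 0 := by
    intro P
    induction P using Polynomial.induction_on' with
    | add P Q hP hQ =>
      rw [← add_zero (0 : ℂ)]
      nth_rw 1 [← hP]
      nth_rw 1 [← hQ]
      rw [← integral_add (Continuous.integrable_circle (by fun_prop))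
        (Continuous.integrable_circle (by fun_prop))]
      congr 1; ext ζ; simp; ring
    | monomial n a =>
      have := integral_conj_pow_mul_dualLimit hμ hb0 hb1 hα (k := k + n) (by omega)
      have h2 : ∀ ζ : Circle, conj ((ζ : ℂ) ^ k) * (conj ((monomial n a).eval (ζ : ℂ)) *
          dualLimit μ ζ) = conj a * (conj ((ζ : ℂ) ^ (k + n)) * dualLimit μ ζ) := by
        intro ζ; simp [pow_add]; ring
      simp only [h2]
      rw [integral_const_mul, this, mul_zero]
  obtain ⟨B, hB⟩ := isCompact_univ.exists_bound_of_continuousOn hcont.continuousOn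
  have hle : ∀ n, ‖∫ ζ : Circle, conj ((ζ : ℂ) ^ k) * (conj (dualLimit μ ζ) * dualLimit μ ζ) ∂μ‖ ≤
      M * b ^ n * B * μ.real Set.univ := by
    intro n
    rw [← norm_neg, ← zero_sub, ← hpoly (dualOPUC μ n),
      ← integral_sub (Continuous.integrable_circle (by fun_prop))
      (Continuous.integrable_circle (by fun_prop))]
    refine norm_integral_le_of_norm_le_const (Filter.Eventually.of_forall fun ζ => ?_)
    rw [← mul_sub, norm_mul, RCLike.norm_conj, Circle.norm_coe_pow, one_mul, ← sub_mul, norm_mul,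
      ← map_sub, RCLike.norm_conj]
    have h1 := hlim n ζ (Circle.norm_coe ζ).le
    rw [mul_one] at h1
    exact mul_le_mul h1 (hB ζ trivial) (norm_nonneg _) (by positivity)
  have ht : Filter.Tendsto (fun n => M * b ^ n * B * μ.real Set.univ) Filter.atTop (nhds 0) := by
    simpa using (((tendsto_pow_atTop_nhds_zero_of_lt_one hb0.le hb1).const_mul M).mul_const
      B).mul_const (μ.real Set.univ)
  exact norm_le_zero_iff.1 (ge_of_tendsto ht (Filter.Eventually.of_forall hle))

/-- The measure is `k |Ψ|⁻² dθ / 2π`, with `Ψ` the limit of the dual polynomials. -/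
theorem exists_eq_withDensity (hμ : IsNontrivialOnCircle μ) (hb0 : 0 < b) (hb1 : b < 1)
    (hα : ∀ n, ‖verblunsky μ n‖ ≤ A * b ^ n) : ∃ k : ℝ, 0 < k ∧
      μ = circleArc.withDensity fun ζ => ENNReal.ofReal (k / ‖dualLimit μ ζ‖ ^ 2) := by
  obtain ⟨m, hm, hlow⟩ := exists_le_norm_dualLimit hμ hb0 hb1 hα
  have hcont := continuous_dualLimit_circle hμ hb0 hb1 hα
  have hne : ∀ ζ : Circle, 0 < ‖dualLimit μ ζ‖ := fun ζ => hm.trans_le (hlow ζ (Circle.norm_coe ζ).le)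
  set f : Circle → NNReal := fun ζ => ‖dualLimit μ ζ‖₊ ^ 2 with hf
  have hfc : Continuous f := by fun_prop
  have hfne : ∀ ζ, f ζ ≠ 0 := fun ζ => by
    have := (hne ζ).ne'
    simpa [hf] using this
  -- The measure |Ψ|²μ has vanishing nonconstant moments, hence is a multiple of arc length;
  -- dividing by |Ψ|² > 0 recovers μ.
  set ν := μ.withDensity fun ζ => (f ζ : ENNReal) with hν
  have hfin : IsFiniteMeasure ν := by
    refine isFiniteMeasure_withDensity ?_
    obtain ⟨B, hB⟩ := isCompact_univ.exists_bound_of_continuousOn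
      hcont.continuousOn
    refine (lt_of_le_of_lt (lintegral_mono (g := fun _ => ENNReal.ofReal (B ^ 2)) fun ζ => ?_) ?_).ne
    · rw [← ENNReal.ofReal_coe_nnreal]
      exact ENNReal.ofReal_le_ofReal (by
        simpa [hf] using pow_le_pow_left₀ (norm_nonneg _) (hB ζ trivial) 2)
    · rw [lintegral_const]
      exact ENNReal.mul_lt_top ENNReal.ofReal_lt_top (measure_lt_top μ _)
  have hmom : ∀ k : ℕ, k ≠ 0 → ∫ ζ : Circle, (ζ : ℂ) ^ k ∂ν = 0 := by
    intro k hk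
    rw [hν, integral_withDensity_eq_integral_smul hfc.measurable]
    have h := congrArg conj (integral_conj_pow_mul_normSq_dualLimit hμ hb0 hb1 hα hk)
    rw [← integral_conj, map_zero] at h
    rw [← h]
    congr 1; ext ζ
    rw [NNReal.smul_def, map_mul, Complex.conj_conj, map_mul, Complex.conj_conj, Complex.mul_conj,
      Complex.normSq_eq_norm_sq, hf]
    simp [mul_comm]
  have hνeq := eq_smul_circleArc hmom
  have hinv : μ = ν.withDensity fun ζ => (f ζ : ENNReal)⁻¹ := by
    rw [hν, withDensity_inv_same (by fun_prop) (by simp [hfne]) (by simp)]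
  have hμ0 : μ ≠ 0 := fun h => hμ ∅ Set.finite_empty (by simp [h])
  have hk0 : ν Set.univ ≠ 0 := by
    intro h0
    have : ν = 0 := Measure.measure_univ_eq_zero.1 h0
    rw [this] at hinv
    exact hμ0 (by simpa using hinv)
  refine ⟨(ν Set.univ).toReal, ENNReal.toReal_pos hk0 (measure_ne_top _ _), ?_⟩
  conv_lhs => rw [hinv, hνeq, withDensity_smul_measure,
    ← withDensity_smul _ (by fun_prop)]
  congr 1; ext ζ
  rw [ENNReal.ofReal_div_of_pos (pow_pos (hne ζ) 2),
    ENNReal.ofReal_toReal (measure_ne_top _ _), Pi.smul_apply, smul_eq_mul, div_eq_mul_inv, hf,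
    ENNReal.ofReal_pow (norm_nonneg _), ofReal_norm]
  simp [enorm]

end Limit

/-! ### The Schwarz integral formula and the Szegő function -/

/-- The Schwarz integral formula on the unit disk. -/
theorem integral_herglotz_re {U : ℂ → ℂ} (hU : DiffContOnCl ℂ U (Metric.ball 0 1)) {z : ℂ}
    (hz : ‖z‖ < 1) : ∫ ζ : Circle, (((ζ : ℂ) + z) / ((ζ : ℂ) - z)) * ((U ζ).re : ℂ) ∂circleArc =
      U z - (U 0).im * Complex.I := by
  have hUc : Continuous fun ζ : Circle => U ζ := by
    refine hU.2.comp_continuous (by fun_prop) fun ζ => ?_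
    rw [closure_ball _ one_ne_zero, mem_closedBall_zero_iff, Circle.norm_coe]
  have hne : ∀ ζ : Circle, (ζ : ℂ) - z ≠ 0 := fun ζ h => by
    rw [← sub_eq_zero.1 h, Circle.norm_coe] at hz; exact lt_irrefl _ hz
  have hne' : ∀ ζ : ℂ, ‖ζ‖ ≤ 1 → 1 - conj z * ζ ≠ 0 := fun ζ hζ h => by
    have h1 : ‖conj z * ζ‖ = 1 := by rw [← sub_eq_zero.1 h, norm_one]
    rw [norm_mul, RCLike.norm_conj] at h1
    nlinarith [norm_nonneg z, norm_nonneg ζ]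
  have h1 : ∫ ζ : Circle, ((ζ : ℂ) / ((ζ : ℂ) - z)) * U ζ ∂circleArc = U z := by
    rw [integral_circleArc_eq_circleAverage (fun ζ => ζ / (ζ - z) * U ζ)
      ((Continuous.div (by fun_prop) (by fun_prop) hne).mul hUc)]
    have := DiffContOnCl.circleAverage_smul_div (c := 0) (R := 1) (w := z) (f := U)
      (by simpa using hU) (by simpa using hz)
    simpa using this
  have h2 : ∫ ζ : Circle, U ζ ∂circleArc = U 0 := by
    rw [integral_circleArc_eq_circleAverage _ hUc]
    exact DiffContOnCl.circleAverage (by simpa using hU)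
  have hV : DiffContOnCl ℂ (fun ζ => (1 + conj z * ζ) / (1 - conj z * ζ) * U ζ)
      (Metric.ball 0 1) := by
    have hq : DifferentiableOn ℂ (fun ζ : ℂ => (1 + conj z * ζ) / (1 - conj z * ζ))
        (closure (Metric.ball 0 1)) := by
      rw [closure_ball _ one_ne_zero]
      intro ζ hζ
      have := hne' ζ (by simpa using hζ)
      exact (DifferentiableAt.fun_div (c := fun ζ : ℂ => 1 + conj z * ζ)
        (d := fun ζ : ℂ => 1 - conj z * ζ) (by fun_prop)
        (by fun_prop) this).differentiableWithinAt
    exact hq.diffContOnCl.smul hU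
  have hVc : Continuous fun ζ : Circle => (1 + conj z * (ζ : ℂ)) / (1 - conj z * (ζ : ℂ)) * U ζ :=
    (Continuous.div (f := fun ζ : Circle => 1 + conj z * (ζ : ℂ)) (by fun_prop) (by fun_prop)
      fun ζ : Circle => hne' ζ (Circle.norm_coe ζ).le).mul hUc
  have h3 : ∫ ζ : Circle, (1 + conj z * (ζ : ℂ)) / (1 - conj z * (ζ : ℂ)) * U ζ ∂circleArc = U 0 := by
    rw [integral_circleArc_eq_circleAverage
      (fun ζ => (1 + conj z * ζ) / (1 - conj z * ζ) * U ζ) hVc,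
      DiffContOnCl.circleAverage (by simpa using hV)]
    simp
  have h4 := congrArg conj h3
  rw [← integral_conj] at h4
  -- Write Re U = (U + conj U)/2. Against U the kernel is 2ζ/(ζ − z) − 1, handled by Cauchy; against
  -- conj U it is, on the circle, the conjugate of (1 + conj(z)ζ)/(1 − conj(z)ζ), analytic in the
  -- disk, handled by the mean value property.
  have hpt : ∀ ζ : Circle, (((ζ : ℂ) + z) / ((ζ : ℂ) - z)) * ((U ζ).re : ℂ) =
      (ζ : ℂ) / ((ζ : ℂ) - z) * U ζ - 1 / 2 * U ζ +
        1 / 2 * conj ((1 + conj z * ζ) / (1 - conj z * ζ) * U ζ) := by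
    intro ζ
    have hζ := ζ.coe_ne_zero
    have hn := hne ζ
    have : conj ((1 + conj z * ζ) / (1 - conj z * ζ)) = ((ζ : ℂ) + z) / ((ζ : ℂ) - z) := by
      simp only [map_div₀, map_add, map_sub, map_mul, map_one, Complex.conj_conj, conj_circle]
      have : 1 - z * (ζ : ℂ)⁻¹ ≠ 0 := by
        intro h; apply hn; field_simp at h; simpa using h
      field_simp
    rw [map_mul, this, Complex.re_eq_add_conj]
    field_simp
    ring
  have hi1 : Integrable (fun ζ : Circle => (ζ : ℂ) / ((ζ : ℂ) - z) * U ζ) circleArc :=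
    Continuous.integrable_circle ((Continuous.div (by fun_prop) (by fun_prop) hne).mul hUc)
  have hi2 : Integrable (fun ζ : Circle => 1 / 2 * U ζ) circleArc :=
    Continuous.integrable_circle (continuous_const.mul hUc)
  have hi3 : Integrable (fun ζ : Circle =>
      1 / 2 * conj ((1 + conj z * ζ) / (1 - conj z * ζ) * U ζ)) circleArc :=
    Continuous.integrable_circle (continuous_const.mul (Complex.continuous_conj.comp hVc))
  have hsum := integral_add (hi1.sub hi2) hi3
  simp only [Pi.sub_apply] at hsum
  rw [integral_congr_ae (Filter.Eventually.of_forall hpt), hsum, integral_sub hi1 hi2,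
    integral_const_mul, integral_const_mul, h1, h2, h4]
  have h5 := Complex.sub_conj (U 0)
  push_cast at h5
  linear_combination (-1 / 2 : ℂ) * h5

/-- L is the primitive of f'/f that vanishes at 0; then f·e^{−L} has zero derivative. -/
theorem exists_exp_eq_of_ne_zero {f : ℂ → ℂ} {r : ℝ} (hr : 0 < r)
    (hf : DifferentiableOn ℂ f (Metric.ball 0 r)) (h0 : ∀ z ∈ Metric.ball 0 r, f z ≠ 0)
    (hf0 : f 0 = 1) : ∃ L : ℂ → ℂ, L 0 = 0 ∧ DifferentiableOn ℂ L (Metric.ball 0 r) ∧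
      ∀ z ∈ Metric.ball 0 r, Complex.exp (L z) = f z := by
  have hmem : (0 : ℂ) ∈ Metric.ball (0 : ℂ) r := Metric.mem_ball_self hr
  have hd : DifferentiableOn ℂ (fun z => deriv f z / f z) (Metric.ball 0 r) :=
    (hf.deriv Metric.isOpen_ball).div hf h0
  obtain ⟨L, hL0, hL⟩ := hd.isExactOn_ball.with_val_at 0 0
  refine ⟨L, hL0, fun z hz => (hL z hz).differentiableAt.differentiableWithinAt, fun z hz => ?_⟩
  have hderiv : ∀ z ∈ Metric.ball (0 : ℂ) r,
      HasDerivAt (fun z => f z * Complex.exp (-L z)) 0 z := by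
    intro z hz
    have h1 := (hf.differentiableAt (Metric.isOpen_ball.mem_nhds hz)).hasDerivAt
    have h2 := (hL z hz).neg.cexp
    refine (h1.mul h2).congr_deriv ?_
    have := h0 z hz
    simp only [Pi.neg_apply]
    field_simp
    ring
  have hconst := (convex_ball (0 : ℂ) r).is_const_of_fderivWithin_eq_zero (𝕜 := ℂ)
    (f := fun z => f z * Complex.exp (-L z))
    (fun z hz => (hderiv z hz).differentiableAt.differentiableWithinAt)
    (fun z hz => by
      rw [fderivWithin_of_isOpen Metric.isOpen_ball hz, (hderiv z hz).hasFDerivAt.fderiv]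
      ext; simp) hz hmem
  simp only [hL0, hf0, neg_zero, Complex.exp_zero, mul_one] at hconst
  rw [Complex.exp_neg] at hconst
  have := Complex.exp_ne_zero (L z)
  field_simp at hconst
  exact hconst.symm

/-- The Szegő function is a constant multiple of the inverse of the limit of the dual
polynomials. -/
theorem exists_szegoD_inv_eq {μ : Measure Circle} [IsFiniteMeasure μ] {A b : ℝ}
    (hμ : IsNontrivialOnCircle μ) (hb0 : 0 < b) (hb1 : b < 1)
    (hα : ∀ n, ‖verblunsky μ n‖ ≤ A * b ^ n) : ∃ κ : ℝ, 0 < κ ∧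
      ∀ z : ℂ, ‖z‖ < 1 → (szegoD μ z)⁻¹ = κ * dualLimit μ z := by
  obtain ⟨k, hk, hμk⟩ := exists_eq_withDensity hμ hb0 hb1 hα
  obtain ⟨m, hm, hlow⟩ := exists_le_norm_dualLimit hμ hb0 hb1 hα
  have hdiff := differentiableOn_dualLimit hμ hb0 hb1 hα
  have hcont := continuous_dualLimit_circle hμ hb0 hb1 hα
  have h1b : 1 < 1 / b := by rw [lt_div_iff₀ hb0]; linarith
  -- Ψ has no zero on the closed unit disk, hence none on a slightly larger disk, by compactness. A
  -- logarithm of Ψ is therefore analytic past the circle.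
  obtain ⟨r, hr1, hrb, hr0⟩ : ∃ r : ℝ, 1 < r ∧ r ≤ 1 / b ∧
      ∀ z ∈ Metric.ball (0 : ℂ) r, dualLimit μ z ≠ 0 := by
    have hopen : IsOpen (Metric.ball (0 : ℂ) (1 / b) ∩ dualLimit μ ⁻¹' {0}ᶜ) :=
      hdiff.continuousOn.isOpen_inter_preimage Metric.isOpen_ball isOpen_compl_singleton
    obtain ⟨e, he, hsub⟩ := (isCompact_closedBall (0 : ℂ) 1).exists_thickening_subset_open hopen
      (fun z hz => by
        have hz' : ‖z‖ ≤ 1 := by simpa using hz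
        refine ⟨by simpa using hz'.trans_lt h1b, fun h => ?_⟩
        have := hlow z hz'
        rw [Set.mem_singleton_iff.1 h, norm_zero] at this
        linarith)
    rw [thickening_closedBall he zero_le_one] at hsub
    refine ⟨min (e + 1) (1 / b), lt_min (by linarith) h1b, min_le_right _ _, fun z hz => ?_⟩
    exact (hsub (Metric.ball_subset_ball (min_le_left _ _) hz)).2
  obtain ⟨L, hL0, hLd, hL⟩ := exists_exp_eq_of_ne_zero (by linarith)
    (hdiff.mono (Metric.ball_subset_ball hrb)) hr0 dualLimit_zero
  -- Chosen so that Re U = log(k/|Ψ|²) = log w almost everywhere on the circle. Since Ψ(0) = 1, U(0)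
  -- is real and the Schwarz formula has no imaginary correction.
  set U : ℂ → ℂ := fun z => (Real.log k : ℂ) - 2 * L z with hU
  have hUd : DiffContOnCl ℂ U (Metric.ball 0 1) := by
    refine DifferentiableOn.diffContOnCl ?_
    rw [closure_ball _ one_ne_zero]
    exact ((hLd.const_mul 2).const_sub _).mono (Metric.closedBall_subset_ball hr1)
  have hw : (fun ζ => Real.log (circleWeight μ ζ)) =ᵐ[circleArc] fun ζ => (U ζ).re := by
    have hmeas : AEMeasurable (fun ζ : Circle => ENNReal.ofReal (k / ‖dualLimit μ ζ‖ ^ 2))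
        circleArc := by
      have : ∀ ζ : Circle, ‖dualLimit μ ζ‖ ^ 2 ≠ 0 := fun ζ =>
        pow_ne_zero _ (hm.trans_le (hlow ζ (Circle.norm_coe ζ).le)).ne'
      exact (ENNReal.continuous_ofReal.comp
        (continuous_const.div (by fun_prop) this)).aemeasurable
    have hrn := Measure.rnDeriv_withDensity₀ circleArc hmeas
    rw [← hμk] at hrn
    filter_upwards [hrn] with ζ hζ
    have hmem : (ζ : ℂ) ∈ Metric.ball (0 : ℂ) r := by
      rw [mem_ball_zero_iff, Circle.norm_coe]; exact hr1
    have hpos : 0 < ‖dualLimit μ ζ‖ := norm_pos_iff.2 (hr0 _ hmem)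
    rw [circleWeight, hζ, ENNReal.toReal_ofReal (by positivity), Real.log_div hk.ne'
      (by positivity), Real.log_pow, ← hL _ hmem, Complex.norm_exp, Real.log_exp]
    simp [hU]
  refine ⟨(Real.sqrt k)⁻¹, inv_pos.2 (Real.sqrt_pos.2 hk), fun z hz => ?_⟩
  have hint : ∫ ζ : Circle, (((ζ : ℂ) + z) / ((ζ : ℂ) - z)) *
      (Real.log (circleWeight μ ζ) : ℂ) ∂circleArc = U z := by
    have h1 := integral_herglotz_re hUd hz
    have h2 : (U 0).im = 0 := by simp only [hU, hL0, mul_zero, sub_zero, Complex.ofReal_im]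
    rw [h2] at h1
    simp only [Complex.ofReal_zero, zero_mul, sub_zero] at h1
    rw [← h1]
    refine integral_congr_ae ?_
    filter_upwards [hw] with ζ hζ
    rw [hζ]
  have hzr : z ∈ Metric.ball (0 : ℂ) r := by simpa using hz.trans hr1
  rw [szegoD, hint, hU, ← Complex.exp_neg]
  have : -((1 / 2 : ℂ) * ((Real.log k : ℂ) - 2 * L z)) =
      ((-Real.log (Real.sqrt k) : ℝ) : ℂ) + L z := by
    rw [Real.log_sqrt hk.le]; push_cast; ring
  rw [this, Complex.exp_add, hL z hzr, ← Complex.ofReal_exp, Real.exp_neg,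
    Real.exp_log (Real.sqrt_pos.2 hk)]

/-! ### Asymptotics of the monic polynomials near the critical circle -/

/-- The deviation of `conj αₙ Φₙ*` from its leading term `conj c bⁿ Ψ`. -/
noncomputable def dualDeviation (μ : Measure Circle) (b : ℝ) (c : ℂ) (n : ℕ) (z : ℂ) : ℂ :=
  conj (verblunsky μ n) * (dualOPUC μ n).eval z - conj c * (b : ℂ) ^ n * dualLimit μ z

/-- The regular part of the continuation of `conj Ψ(1 / conj z)` across `|z| = b`. -/
noncomputable def reflectedRegular (μ : Measure Circle) (b : ℝ) (c : ℂ) (z : ℂ) : ℂ :=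
  1 - ∑' j, dualDeviation μ b c j z / z ^ (j + 1)

/-- The continuation of `conj Ψ(1 / conj z)` across `|z| = b`. -/
noncomputable def reflectedLimit (μ : Measure Circle) (b : ℝ) (c : ℂ) (z : ℂ) : ℂ :=
  reflectedRegular μ b c z - conj c * dualLimit μ z / (z - b)

/-- The hypotheses on the measure, with the rate `b Θ` of the error terms, `b ≤ Θ < 1`. -/
structure GeometricVerblunsky (μ : Measure Circle) (b Θ : ℝ) (c : ℂ) (A : ℝ) : Prop where
  nontrivial : IsNontrivialOnCircle μ
  b_pos : 0 < b
  b_lt : b < 1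
  le_rate : b ≤ Θ
  rate_lt : Θ < 1
  norm_le : ∀ n, ‖verblunsky μ n‖ ≤ A * b ^ n
  norm_sub_geometric_le : ∀ n, ‖verblunsky μ n - c * (b : ℂ) ^ n‖ ≤ A * (b * Θ) ^ n

/-- The rate is max(Δ, b) because replacing Φₙ* by Ψ inside conj(αₙ)Φₙ* costs a further error of
order bⁿ·bⁿ. -/
theorem BLSCondition.geometric {μ : Measure Circle} {b : ℝ} {c : ℂ} (h : BLSCondition μ b c)
    (hμ : IsNontrivialOnCircle μ) (hb0 : 0 < b) (hb1 : b < 1) :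
    ∃ Θ A : ℝ, GeometricVerblunsky μ b Θ c A := by
  obtain ⟨Δ, hΔ0, hΔ1, M, hM⟩ := h
  have hM0 : 0 ≤ M := by simpa using (norm_nonneg _).trans (hM 0)
  have h1 : ∀ n, ‖verblunsky μ n - c * (b : ℂ) ^ n‖ ≤ M * b ^ n := fun n => by
    refine (hM n).trans ?_
    gcongr
    exact mul_le_of_le_one_right hb0.le hΔ1.le
  refine ⟨max Δ b, ‖c‖ + M, hμ, hb0, hb1, le_max_right _ _, max_lt hΔ1 hb1, fun n => ?_,
    fun n => (hM n).trans ?_⟩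
  · have h2 := norm_add_le (verblunsky μ n - c * (b : ℂ) ^ n) (c * (b : ℂ) ^ n)
    rw [sub_add_cancel, norm_mul, norm_pow, Complex.norm_real, Real.norm_of_nonneg hb0.le] at h2
    linarith [h1 n]
  · gcongr
    · linarith [norm_nonneg c]
    · exact le_max_left _ _

namespace GeometricVerblunsky

variable {μ : Measure Circle} {b Θ : ℝ} {c : ℂ} {A : ℝ}

theorem rate_pos (h : GeometricVerblunsky μ b Θ c A) : 0 < Θ := h.b_pos.trans_le h.le_rate

theorem mul_rate_pos (h : GeometricVerblunsky μ b Θ c A) : 0 < b * Θ := mul_pos h.b_pos h.rate_pos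

theorem mul_rate_lt (h : GeometricVerblunsky μ b Θ c A) : b * Θ < b :=
  mul_lt_of_lt_one_right h.b_pos h.rate_lt

theorem const_nonneg (h : GeometricVerblunsky μ b Θ c A) : 0 ≤ A := by
  simpa using (norm_nonneg _).trans (h.norm_le 0)

variable [IsFiniteMeasure μ]

theorem exists_norm_dualLimit_le (h : GeometricVerblunsky μ b Θ c A) :
    ∃ B : ℝ, 0 < B ∧ ∀ z : ℂ, ‖z‖ ≤ 1 → ‖dualLimit μ z‖ ≤ B := by
  obtain ⟨M, hM, hlim⟩ := dualOPUC_tendsto h.nontrivial h.b_pos h.b_lt h.norm_le le_rfl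
    (by simpa using h.b_lt)
  refine ⟨M + 1, by positivity, fun z hz => ?_⟩
  have h1 := hlim 0 z hz
  have h2 := norm_sub_norm_le (dualLimit μ z) ((dualOPUC μ 0).eval z)
  rw [norm_sub_rev] at h2
  simp [dualOPUC] at h1 h2
  linarith

/-- Two errors: αₙ(Φₙ* − Ψ) = O(b²ⁿ), absorbed by b ≤ Θ, and (αₙ − cbⁿ)Ψ = O((bΘ)ⁿ), up to
conjugation of the coefficients. -/
theorem exists_norm_dualDeviation_le (h : GeometricVerblunsky μ b Θ c A) :
    ∃ B : ℝ, 0 < B ∧ ∀ n, ∀ z : ℂ, ‖z‖ ≤ 1 → ‖dualDeviation μ b c n z‖ ≤ B * (b * Θ) ^ n := by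
  obtain ⟨M, hM, hlim⟩ := dualOPUC_tendsto h.nontrivial h.b_pos h.b_lt h.norm_le le_rfl
    (by simpa using h.b_lt)
  obtain ⟨B, hB, hΨ⟩ := h.exists_norm_dualLimit_le
  have hA := h.const_nonneg
  have hb := h.b_pos
  refine ⟨A * M + A * B + 1, by positivity, fun n z hz => ?_⟩
  have heq : dualDeviation μ b c n z =
      conj (verblunsky μ n) * ((dualOPUC μ n).eval z - dualLimit μ z) +
        conj (verblunsky μ n - c * (b : ℂ) ^ n) * dualLimit μ z := by
    simp only [dualDeviation, map_sub, map_mul, map_pow, Complex.conj_ofReal]; ring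
  have hpos : 0 < (b * Θ) ^ n := pow_pos h.mul_rate_pos n
  calc ‖dualDeviation μ b c n z‖ ≤ (A * b ^ n) * (M * b ^ n) + (A * (b * Θ) ^ n) * B := by
        rw [heq]
        refine (norm_add_le _ _).trans ?_
        rw [norm_mul, norm_mul, RCLike.norm_conj, RCLike.norm_conj]
        have h1 := h.norm_le n
        have h2 := h.norm_sub_geometric_le n
        have h3 := hlim n z hz
        rw [mul_one] at h3
        have h4 := hΨ z hz
        gcongr
    _ ≤ A * M * (b * Θ) ^ n + A * B * (b * Θ) ^ n := by
        have : b ^ n * b ^ n ≤ (b * Θ) ^ n := by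
          rw [mul_pow]
          have := h.le_rate
          gcongr
        have h5 : A * M * (b ^ n * b ^ n) ≤ A * M * (b * Θ) ^ n := by gcongr
        linarith
    _ ≤ _ := by linarith


/-- The exact solution of Φₙ₊₁ = zΦₙ − (deviation + conj(c) bⁿ Ψ): the geometric part sums to (zⁿ −
bⁿ)/(z − b), which produces both the pole at b and the competing bⁿ term. -/
theorem monicOPUC_eval_eq (h : GeometricVerblunsky μ b Θ c A) (n : ℕ) {z : ℂ} (hz : z ≠ 0)
    (hzb : z ≠ b) : (monicOPUC μ n).eval z =
      z ^ n * (1 - ∑ j ∈ Finset.range n, dualDeviation μ b c j z / z ^ (j + 1) -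
        conj c * dualLimit μ z / (z - b)) + (b : ℂ) ^ n * (conj c * dualLimit μ z / (z - b)) := by
  have hzb' : z - b ≠ 0 := sub_ne_zero.2 hzb
  induction n with
  | zero => simp [monicOPUC_zero]
  | succ n ih =>
    have hd : conj (verblunsky μ n) * (dualOPUC μ n).eval z =
        dualDeviation μ b c n z + conj c * (b : ℂ) ^ n * dualLimit μ z := by
      simp [dualDeviation]
    rw [szego_recursion h.nontrivial, ih, hd, Finset.sum_range_succ]
    field_simp
    ring

theorem summable_dualDeviation (h : GeometricVerblunsky μ b Θ c A) {z : ℂ} (hz : b * Θ < ‖z‖)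
    (hz1 : ‖z‖ ≤ 1) : Summable fun j => dualDeviation μ b c j z / z ^ (j + 1) := by
  obtain ⟨B, hB, hβ⟩ := h.exists_norm_dualDeviation_le
  have h0 : 0 < ‖z‖ := h.mul_rate_pos.trans hz
  refine Summable.of_norm_bounded (g := fun j => B / ‖z‖ * (b * Θ / ‖z‖) ^ j)
    ((summable_geometric_of_lt_one (by have := h.mul_rate_pos; positivity)
      ((div_lt_one h0).2 hz)).mul_left _) fun j => ?_
  rw [norm_div, norm_pow]
  calc _ ≤ B * (b * Θ) ^ j / ‖z‖ ^ (j + 1) := by gcongr; exact hβ j z hz1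
    _ = _ := by rw [div_pow, pow_succ]; field_simp

/-- In the annulus `ρ ≤ |z| ≤ 1`, up to an error `O((b Θ)ⁿ)`, the polynomial `Φₙ` is the sum of
its two leading terms. -/
theorem norm_monicOPUC_sub_le (h : GeometricVerblunsky μ b Θ c A) {ρ : ℝ} (hρ : b * Θ < ρ) :
    ∃ E : ℝ, 0 < E ∧ ∀ n, ∀ z : ℂ, ρ ≤ ‖z‖ → ‖z‖ ≤ 1 → z ≠ b →
      ‖(monicOPUC μ n).eval z - (z ^ n * reflectedLimit μ b c z +
        (b : ℂ) ^ n * (conj c * dualLimit μ z / (z - b)))‖ ≤ E * (b * Θ) ^ n := by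
  obtain ⟨B, hB, hβ⟩ := h.exists_norm_dualDeviation_le
  have hρ0 : 0 < ρ := h.mul_rate_pos.trans hρ
  have hbΘ := h.mul_rate_pos
  have hq1 : b * Θ / ρ < 1 := (div_lt_one hρ0).2 hρ
  refine ⟨B / ρ * (1 - b * Θ / ρ)⁻¹, by have := sub_pos.2 hq1; positivity,
    fun n z hz hz1 hzb => ?_⟩
  have h0 : 0 < ‖z‖ := hρ0.trans_le hz
  have hz0 : z ≠ 0 := norm_pos_iff.1 h0
  have hs := h.summable_dualDeviation (hρ.trans_le hz) hz1
  have heq : (monicOPUC μ n).eval z - (z ^ n * reflectedLimit μ b c z +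
        (b : ℂ) ^ n * (conj c * dualLimit μ z / (z - b))) =
      ∑' j, z ^ n * (dualDeviation μ b c (j + n) z / z ^ (j + n + 1)) := by
    rw [tsum_mul_left, h.monicOPUC_eval_eq n hz0 hzb, reflectedLimit, reflectedRegular,
      ← hs.sum_add_tsum_nat_add n]
    ring
  rw [heq]
  refine tsum_of_norm_bounded (g := fun j => B / ρ * (b * Θ) ^ n * (b * Θ / ρ) ^ j) ?_ fun j => ?_
  · have := (hasSum_geometric_of_lt_one (by positivity : 0 ≤ b * Θ / ρ) hq1).mul_left
      (B / ρ * (b * Θ) ^ n)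
    rwa [show B / ρ * (1 - b * Θ / ρ)⁻¹ * (b * Θ) ^ n =
      B / ρ * (b * Θ) ^ n * (1 - b * Θ / ρ)⁻¹ by ring]
  · have h1 : z ^ n * (dualDeviation μ b c (j + n) z / z ^ (j + n + 1)) =
        dualDeviation μ b c (j + n) z / z ^ (j + 1) := by
      rw [show j + n + 1 = (j + 1) + n by ring, pow_add z (j + 1)]
      field_simp
    rw [h1, norm_div, norm_pow]
    calc _ ≤ B * (b * Θ) ^ (j + n) / ρ ^ (j + 1) := by gcongr; exact hβ _ z hz1
      _ = _ := by rw [div_pow, pow_succ, pow_add]; field_simp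

/-- Inside the critical circle, `Φₙ` is governed by the term of order `bⁿ`. -/
theorem norm_monicOPUC_sub_le_inner (h : GeometricVerblunsky μ b Θ c A) {ρ : ℝ}
    (hρ : b * Θ < ρ) (hρb : ρ < b) : ∃ E : ℝ, 0 < E ∧ ∀ n, ∀ z : ℂ, ‖z‖ ≤ ρ →
      ‖(monicOPUC μ n).eval z - (b : ℂ) ^ n * (conj c * dualLimit μ z / (z - b))‖ ≤
        E * ρ ^ n := by
  obtain ⟨B, hB, hβ⟩ := h.exists_norm_dualDeviation_le
  obtain ⟨P, hP, hΨ⟩ := h.exists_norm_dualLimit_le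
  have hbΘ := h.mul_rate_pos
  have hρ0 : 0 < ρ := hbΘ.trans hρ
  have hq1 : b * Θ / ρ < 1 := (div_lt_one hρ0).2 hρ
  have hbρ := sub_pos.2 hρb
  set E₀ : ℝ := 1 + ‖c‖ * P / (b - ρ) with hE₀
  have hE₀pos : 0 < E₀ := by positivity
  refine ⟨E₀ + B / ρ * (1 - b * Θ / ρ)⁻¹, by have := sub_pos.2 hq1; positivity,
    fun n z hz => ?_⟩
  have hz1 : ‖z‖ ≤ 1 := hz.trans (hρb.le.trans h.b_lt.le)
  have hlow : b - ρ ≤ ‖z - b‖ := by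
    have := norm_sub_norm_le (b : ℂ) z
    rw [Complex.norm_real, Real.norm_of_nonneg h.b_pos.le, norm_sub_rev] at this
    linarith
  have hzb' : z - b ≠ 0 := norm_pos_iff.1 (hbρ.trans_le hlow)
  -- The subtracted term solves the recursion without deviations exactly, so the error obeys eₙ₊₁ =
  -- z eₙ − deviation. This avoids dividing by powers of z and works down to z = 0.
  have key : ‖(monicOPUC μ n).eval z - (b : ℂ) ^ n * (conj c * dualLimit μ z / (z - b))‖ ≤
      (E₀ + B / ρ * ∑ j ∈ Finset.range n, (b * Θ / ρ) ^ j) * ρ ^ n := by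
    induction n with
    | zero =>
      simp only [monicOPUC_zero, eval_one, pow_zero, one_mul, Finset.range_zero, Finset.sum_empty,
        mul_zero, add_zero, mul_one]
      refine (norm_sub_le _ _).trans ?_
      rw [norm_one, norm_div, norm_mul, RCLike.norm_conj, hE₀]
      have := hΨ z hz1
      gcongr
    | succ n ih =>
      have hd : conj (verblunsky μ n) * (dualOPUC μ n).eval z =
          dualDeviation μ b c n z + conj c * (b : ℂ) ^ n * dualLimit μ z := by
        simp [dualDeviation]
      have hrec : (monicOPUC μ (n + 1)).eval z -
          (b : ℂ) ^ (n + 1) * (conj c * dualLimit μ z / (z - b)) =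
          z * ((monicOPUC μ n).eval z - (b : ℂ) ^ n * (conj c * dualLimit μ z / (z - b))) -
            dualDeviation μ b c n z := by
        rw [szego_recursion h.nontrivial, hd]
        field_simp
        ring
      rw [hrec]
      refine (norm_sub_le _ _).trans ?_
      rw [norm_mul]
      calc _ ≤ ρ * ((E₀ + B / ρ * ∑ j ∈ Finset.range n, (b * Θ / ρ) ^ j) * ρ ^ n) +
            B * (b * Θ) ^ n := by
            gcongr
            exact hβ n z hz1
        _ = _ := by
            rw [Finset.sum_range_succ, div_pow (b * Θ) ρ n, pow_succ]
            field_simp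
            ring
  refine key.trans ?_
  gcongr
  rw [← tsum_geometric_of_lt_one (by positivity) hq1]
  exact (summable_geometric_of_lt_one (by positivity) hq1).sum_le_tsum _ fun _ _ => by positivity

/-- Outside the critical circle, `Φₙ` is governed by the term of order `zⁿ`. -/
theorem norm_monicOPUC_div_sub_le (h : GeometricVerblunsky μ b Θ c A) {ρ : ℝ} (hρ : b < ρ)
    (hρ1 : ρ ≤ 1) : ∃ E : ℝ, 0 ≤ E ∧ ∀ n, ∀ z : ℂ, ρ ≤ ‖z‖ →
      ‖(monicOPUC μ n).eval z / z ^ n - conj (dualLimit μ (1 / conj z))‖ ≤ E * (b / ρ) ^ n := by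
  have hρ0 : 0 < ρ := h.b_pos.trans hρ
  obtain ⟨M, hM, hlim⟩ := dualOPUC_tendsto h.nontrivial h.b_pos h.b_lt h.norm_le
    (one_le_one_div hρ0 hρ1) (by rw [mul_one_div]; exact (div_lt_one hρ0).2 hρ)
  refine ⟨M, hM, fun n z hz => ?_⟩
  have hz0 : z ≠ 0 := norm_pos_iff.1 (hρ0.trans_le hz)
  rw [monicOPUC_eval h.nontrivial n hz0, mul_div_cancel_left₀ _ (pow_ne_zero n hz0), ← map_sub,
    RCLike.norm_conj]
  have := hlim n (1 / conj z) (by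
    rw [norm_div, norm_one, RCLike.norm_conj]
    exact one_div_le_one_div_of_le hρ0 hz)
  rwa [mul_one_div] at this

/-- For b < |z| ≤ 1 both expressions are the limit of Φₙ(z)/zⁿ: one from the two-term asymptotics,
where (b/z)ⁿ dies, the other from the reversal identity. -/
theorem reflectedLimit_eq (h : GeometricVerblunsky μ b Θ c A) {z : ℂ} (hz : b < ‖z‖)
    (hz1 : ‖z‖ ≤ 1) : reflectedLimit μ b c z = conj (dualLimit μ (1 / conj z)) := by
  have h0 : 0 < ‖z‖ := h.b_pos.trans hz
  have hz0 : z ≠ 0 := norm_pos_iff.1 h0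
  have hzb : z ≠ b := by
    rintro rfl
    rw [Complex.norm_real, Real.norm_of_nonneg h.b_pos.le] at hz
    exact lt_irrefl _ hz
  obtain ⟨E, hE, h1⟩ := h.norm_monicOPUC_sub_le (h.mul_rate_lt.trans hz)
  obtain ⟨E', hE', h2⟩ := h.norm_monicOPUC_div_sub_le hz hz1
  have ht1 : Filter.Tendsto (fun n => (monicOPUC μ n).eval z / z ^ n) Filter.atTop
      (nhds (conj (dualLimit μ (1 / conj z)))) := by
    rw [tendsto_iff_norm_sub_tendsto_zero]
    refine squeeze_zero (fun _ => norm_nonneg _) (fun n => h2 n z le_rfl) ?_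
    simpa using (tendsto_pow_atTop_nhds_zero_of_lt_one (by have := h.b_pos; positivity)
      ((div_lt_one h0).2 hz)).const_mul E'
  have ht2 : Filter.Tendsto (fun n => (monicOPUC μ n).eval z / z ^ n) Filter.atTop
      (nhds (reflectedLimit μ b c z)) := by
    have hb : Filter.Tendsto (fun n : ℕ => ((b : ℂ) / z) ^ n * (conj c * dualLimit μ z / (z - b)))
        Filter.atTop (nhds 0) := by
      simpa using (tendsto_pow_atTop_nhds_zero_of_norm_lt_one (x := (b : ℂ) / z) (by
        rw [norm_div, Complex.norm_real, Real.norm_of_nonneg h.b_pos.le]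
        exact (div_lt_one h0).2 hz)).mul_const (conj c * dualLimit μ z / (z - b))
    have hd : Filter.Tendsto (fun n : ℕ => (monicOPUC μ n).eval z / z ^ n -
        (reflectedLimit μ b c z + ((b : ℂ) / z) ^ n * (conj c * dualLimit μ z / (z - b))))
        Filter.atTop (nhds 0) := by
      rw [tendsto_zero_iff_norm_tendsto_zero]
      refine squeeze_zero (g := fun n => E * (b * Θ / ‖z‖) ^ n) (fun _ => norm_nonneg _)
        (fun n => ?_) ?_
      · have h3 := h1 n z le_rfl hz1 hzb
        have h4 : (monicOPUC μ n).eval z / z ^ n - (reflectedLimit μ b c z +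
            ((b : ℂ) / z) ^ n * (conj c * dualLimit μ z / (z - b))) =
            ((monicOPUC μ n).eval z - (z ^ n * reflectedLimit μ b c z +
              (b : ℂ) ^ n * (conj c * dualLimit μ z / (z - b)))) / z ^ n := by
          rw [div_pow]; field_simp
        rw [h4, norm_div, norm_pow, div_pow (b * Θ), mul_div_assoc' E]
        exact div_le_div_of_nonneg_right h3 (by positivity)
      · simpa using (tendsto_pow_atTop_nhds_zero_of_lt_one
          (by have := h.mul_rate_pos; positivity)
          ((div_lt_one h0).2 (h.mul_rate_lt.trans hz))).const_mul E
    have := (hd.add hb).add_const (reflectedLimit μ b c z)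
    simp only [add_zero, zero_add] at this
    refine this.congr fun n => ?_
    ring
  exact tendsto_nhds_unique ht2 ht1

theorem differentiableOn_reflectedRegular (h : GeometricVerblunsky μ b Θ c A) :
    DifferentiableOn ℂ (reflectedRegular μ b c) {z | b * Θ < ‖z‖ ∧ ‖z‖ < 1} := by
  obtain ⟨B, hB, hβ⟩ := h.exists_norm_dualDeviation_le
  have hbΘ := h.mul_rate_pos
  have hΨ := differentiableOn_dualLimit h.nontrivial h.b_pos h.b_lt h.norm_le
  have h1b : 1 < 1 / b := by rw [lt_div_iff₀ h.b_pos]; linarith [h.b_lt]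
  intro z hz
  obtain ⟨ρ, hρ, hρz⟩ := exists_between hz.1
  have hρ0 : 0 < ρ := hbΘ.trans hρ
  have hopen : IsOpen {z : ℂ | ρ < ‖z‖ ∧ ‖z‖ < 1} :=
    (isOpen_lt continuous_const continuous_norm).inter (isOpen_lt continuous_norm continuous_const)
  have hd : DifferentiableOn ℂ (reflectedRegular μ b c) {z : ℂ | ρ < ‖z‖ ∧ ‖z‖ < 1} := by
    refine DifferentiableOn.const_sub ?_ _
    refine Complex.differentiableOn_tsum_of_summable_norm
      (u := fun j => B / ρ * (b * Θ / ρ) ^ j)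
      ((summable_geometric_of_lt_one (by positivity) ((div_lt_one hρ0).2 hρ)).mul_left _)
      (fun j w hw => ?_) hopen fun j w hw => ?_
    · have hw0 : w ≠ 0 := norm_pos_iff.1 (hρ0.trans hw.1)
      have h1 : DifferentiableAt ℂ (dualLimit μ) w :=
        hΨ.differentiableAt (Metric.isOpen_ball.mem_nhds (by simpa using hw.2.trans h1b))
      refine DifferentiableAt.differentiableWithinAt (DifferentiableAt.fun_div ?_ (by fun_prop)
        (pow_ne_zero _ hw0))
      unfold dualDeviation
      fun_prop
    · rw [norm_div, norm_pow]
      calc _ ≤ B * (b * Θ) ^ j / ρ ^ (j + 1) := by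
            gcongr
            · exact hβ j w hw.2.le
            · exact hw.1.le
        _ = _ := by rw [div_pow, pow_succ]; field_simp
  exact (hd.differentiableAt (hopen.mem_nhds ⟨hρz, hz.2⟩)).differentiableWithinAt

end GeometricVerblunsky

/-! ### The meromorphic continuation of the inverse Szegő function -/

/-- The function is conj ∘ f ∘ conj composed with z ↦ 1/z, and conjugating on both sides preserves
holomorphy. -/
theorem DifferentiableAt.conj_comp_one_div_conj {f : ℂ → ℂ} {z : ℂ} (hz : z ≠ 0)
    (hf : DifferentiableAt ℂ f (1 / conj z)) :
    DifferentiableAt ℂ (fun z => conj (f (1 / conj z))) z := by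
  have h1 : DifferentiableAt ℂ (conj ∘ f ∘ conj) (1 / z) := by
    rw [differentiableAt_conj_conj_iff]
    simpa using hf
  have h2 : DifferentiableAt ℂ (fun z : ℂ => 1 / z) z := by
    simpa using differentiableAt_inv hz
  have h3 := DifferentiableAt.comp z h1 h2
  refine h3.congr_of_eventuallyEq (Filter.Eventually.of_forall fun w => ?_)
  simp

theorem norm_one_div_conj (z : ℂ) : ‖1 / conj z‖ = 1 / ‖z‖ := by
  rw [norm_div, norm_one, RCLike.norm_conj]

namespace GeometricVerblunsky

variable {μ : Measure Circle} {b Θ : ℝ} {c : ℂ} {A : ℝ}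

theorem one_lt_one_div (h : GeometricVerblunsky μ b Θ c A) : 1 < 1 / b := by
  rw [lt_div_iff₀ h.b_pos]; linarith [h.b_lt]

variable [IsFiniteMeasure μ]

theorem differentiableAt_dualLimit (h : GeometricVerblunsky μ b Θ c A) {z : ℂ}
    (hz : ‖z‖ < 1 / b) : DifferentiableAt ℂ (dualLimit μ) z :=
  (differentiableOn_dualLimit h.nontrivial h.b_pos h.b_lt h.norm_le).differentiableAt
    (Metric.isOpen_ball.mem_nhds (by simpa using hz))

theorem differentiableAt_reflectedRegular (h : GeometricVerblunsky μ b Θ c A) {z : ℂ}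
    (hz : b * Θ < ‖z‖) (hz1 : ‖z‖ < 1) : DifferentiableAt ℂ (reflectedRegular μ b c) z :=
  h.differentiableOn_reflectedRegular.differentiableAt
    (((isOpen_lt continuous_const continuous_norm).inter
      (isOpen_lt continuous_norm continuous_const)).mem_nhds ⟨hz, hz1⟩)

theorem differentiableAt_reflectedLimit (h : GeometricVerblunsky μ b Θ c A) {z : ℂ}
    (hz : b * Θ < ‖z‖) (hz1 : ‖z‖ < 1) (hzb : z ≠ b) :
    DifferentiableAt ℂ (reflectedLimit μ b c) z := by
  have h1 := h.differentiableAt_reflectedRegular hz hz1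
  have h2 := h.differentiableAt_dualLimit (hz1.trans h.one_lt_one_div)
  exact h1.sub ((h2.const_mul _).fun_div (by fun_prop) (sub_ne_zero.2 hzb))

/-- The function `Ψ`, continued from `|z| < 1 / b` to `|z| < 1 / (b Θ)`. -/
noncomputable def _root_.dualContinuation (μ : Measure Circle) (b : ℝ) (c : ℂ) (z : ℂ) : ℂ :=
  open Classical in
  if ‖z‖ < 1 / b then dualLimit μ z else conj (reflectedLimit μ b c (1 / conj z))

/-- The two branches agree on the overlap 1 ≤ |z| < 1/b, so the case split at 1/b creates no seam.
-/
theorem dualContinuation_eq (h : GeometricVerblunsky μ b Θ c A) {z : ℂ} (hz : 1 ≤ ‖z‖) :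
    dualContinuation μ b c z = conj (reflectedLimit μ b c (1 / conj z)) := by
  unfold dualContinuation
  split_ifs with h1
  · have h0 : 0 < ‖z‖ := by linarith
    rw [h.reflectedLimit_eq]
    · simp
    · rw [norm_div, norm_one, RCLike.norm_conj, lt_div_iff₀ h0]
      rwa [lt_div_iff₀ h.b_pos, mul_comm] at h1
    · rw [norm_div, norm_one, RCLike.norm_conj]
      exact (div_le_one h0).2 hz
  · rfl

theorem differentiableAt_dualContinuation (h : GeometricVerblunsky μ b Θ c A) {z : ℂ}
    (hz : ‖z‖ < 1 / (b * Θ)) (hzb : z ≠ ((1 / b : ℝ) : ℂ)) :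
    DifferentiableAt ℂ (dualContinuation μ b c) z := by
  rcases lt_or_ge ‖z‖ (1 / b) with h1 | h1
  · refine (h.differentiableAt_dualLimit h1).congr_of_eventuallyEq ?_
    filter_upwards [(isOpen_lt continuous_norm continuous_const).mem_nhds h1] with w hw
    exact if_pos hw
  · have h2 : 1 < ‖z‖ := h.one_lt_one_div.trans_le h1
    have h0 : 0 < ‖z‖ := by linarith
    have h3 : DifferentiableAt ℂ (fun w => conj (reflectedLimit μ b c (1 / conj w))) z := by
      refine DifferentiableAt.conj_comp_one_div_conj (norm_pos_iff.1 h0)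
        (h.differentiableAt_reflectedLimit ?_ ?_ ?_)
      · rw [norm_one_div_conj]
        rwa [lt_one_div h.mul_rate_pos h0]
      · rw [norm_one_div_conj]
        exact (div_lt_one h0).2 h2
      · intro heq
        apply hzb
        have := congrArg (fun w => 1 / conj w) heq
        simpa using this
    refine h3.congr_of_eventuallyEq ?_
    filter_upwards [(isOpen_lt continuous_const continuous_norm).mem_nhds h2] with w hw
    exact h.dualContinuation_eq (le_of_lt hw)

/-- Near 1/b the continuation is the reflection of an analytic part minus conj(c)Ψ/(z − b);
reflection moves the singular denominator from b to 1/b. -/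
theorem meromorphicAt_dualContinuation (h : GeometricVerblunsky μ b Θ c A) :
    MeromorphicAt (dualContinuation μ b c) ((1 / b : ℝ) : ℂ) := by
  have hb := h.b_pos
  have hnorm : ‖((1 / b : ℝ) : ℂ)‖ = 1 / b := by
    rw [Complex.norm_real, Real.norm_of_nonneg (by positivity)]
  have hopen : IsOpen {z : ℂ | 1 < ‖z‖ ∧ ‖z‖ < 1 / (b * Θ)} :=
    (isOpen_lt continuous_const continuous_norm).inter (isOpen_lt continuous_norm continuous_const)
  have hmem : ((1 / b : ℝ) : ℂ) ∈ {z : ℂ | 1 < ‖z‖ ∧ ‖z‖ < 1 / (b * Θ)} := by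
    rw [Set.mem_ofPred_eq, hnorm]
    refine ⟨h.one_lt_one_div, ?_⟩
    exact one_div_lt_one_div_of_lt h.mul_rate_pos h.mul_rate_lt
  have hpt : ∀ z ∈ {z : ℂ | 1 < ‖z‖ ∧ ‖z‖ < 1 / (b * Θ)},
      z ≠ 0 ∧ b * Θ < ‖1 / conj z‖ ∧ ‖1 / conj z‖ < 1 := by
    intro z hz
    have h0 : 0 < ‖z‖ := by linarith [hz.1]
    refine ⟨norm_pos_iff.1 h0, ?_, ?_⟩
    · rw [norm_one_div_conj]
      exact (lt_one_div h.mul_rate_pos h0).2 hz.2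
    · rw [norm_one_div_conj]
      exact (div_lt_one h0).2 hz.1
  have hreg : AnalyticAt ℂ (fun z => conj (reflectedRegular μ b c (1 / conj z)))
      ((1 / b : ℝ) : ℂ) := by
    refine DifferentiableOn.analyticAt (s := {z : ℂ | 1 < ‖z‖ ∧ ‖z‖ < 1 / (b * Θ)})
      (fun z hz => ?_) (hopen.mem_nhds hmem)
    obtain ⟨h0, h1, h2⟩ := hpt z hz
    exact (DifferentiableAt.conj_comp_one_div_conj h0
      (h.differentiableAt_reflectedRegular h1 h2)).differentiableWithinAt
  have hlim : AnalyticAt ℂ (fun z => conj (dualLimit μ (1 / conj z))) ((1 / b : ℝ) : ℂ) := by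
    refine DifferentiableOn.analyticAt (s := {z : ℂ | 1 < ‖z‖ ∧ ‖z‖ < 1 / (b * Θ)})
      (fun z hz => ?_) (hopen.mem_nhds hmem)
    obtain ⟨h0, h1, h2⟩ := hpt z hz
    exact (DifferentiableAt.conj_comp_one_div_conj h0
      (h.differentiableAt_dualLimit (h2.trans h.one_lt_one_div))).differentiableWithinAt
  have hden : AnalyticAt ℂ (fun z : ℂ => 1 / z - b) ((1 / b : ℝ) : ℂ) := by
    refine (analyticAt_const.div analyticAt_id ?_).sub analyticAt_const
    simpa using hb.ne'
  refine (hreg.meromorphicAt.sub ((analyticAt_const (v := c)).meromorphicAt.mul hlim.meromorphicAt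
    |>.div hden.meromorphicAt)).congr (Filter.Eventually.filter_mono nhdsWithin_le_nhds ?_)
  filter_upwards [hopen.mem_nhds hmem] with z hz
  rw [h.dualContinuation_eq hz.1.le]
  simp [reflectedLimit]

theorem exists_continuation (h : GeometricVerblunsky μ b Θ c A) :
    ∃ F : ℂ → ℂ, IsSzegoInvContinuation μ b Θ F := by
  obtain ⟨κ, hκ, hD⟩ := exists_szegoD_inv_eq h.nontrivial h.b_pos h.b_lt h.norm_le
  refine ⟨fun z => κ * dualContinuation μ b c z, fun z hz => ?_, ?_, ?_⟩
  · rw [hD z hz, dualContinuation, if_pos (hz.trans h.one_lt_one_div)]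
  · refine DifferentiableOn.analyticOnNhd (fun z hz => ?_)
      (Metric.isOpen_ball.sdiff isClosed_singleton)
    exact ((h.differentiableAt_dualContinuation (by simpa using hz.1) hz.2).const_mul
      _).differentiableWithinAt
  · exact (analyticAt_const (v := (κ : ℂ))).meromorphicAt.mul h.meromorphicAt_dualContinuation

/-- Any continuation agrees with a multiple of `Ψ` on `|z| < 1 / b`. -/
theorem exists_continuation_eq (h : GeometricVerblunsky μ b Θ c A) : ∃ κ : ℝ, 0 < κ ∧
    ∀ (Δ₂ : ℝ) (F : ℂ → ℂ), 0 < Δ₂ → Δ₂ < 1 → IsSzegoInvContinuation μ b Δ₂ F →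
      ∀ z : ℂ, ‖z‖ < 1 / b → F z = κ * dualLimit μ z := by
  obtain ⟨κ, hκ, hD⟩ := exists_szegoD_inv_eq h.nontrivial h.b_pos h.b_lt h.norm_le
  refine ⟨κ, hκ, fun Δ₂ F h0 h1 hF z hz => ?_⟩
  have hb := h.b_pos
  have hF' : AnalyticOnNhd ℂ F (Metric.ball 0 (1 / b)) := by
    refine hF.analytic.mono fun w hw => ⟨?_, ?_⟩
    · refine Metric.ball_subset_ball (one_div_le_one_div_of_le (by positivity) ?_) hw
      exact mul_le_of_le_one_right hb.le h1.le
    · rintro rfl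
      rw [mem_ball_zero_iff, Complex.norm_real, Real.norm_of_nonneg (by positivity)] at hw
      exact lt_irrefl _ hw
  have hG : AnalyticOnNhd ℂ (fun z => (κ : ℂ) * dualLimit μ z) (Metric.ball 0 (1 / b)) :=
    ((differentiableOn_dualLimit h.nontrivial h.b_pos h.b_lt h.norm_le).const_mul
      _).analyticOnNhd Metric.isOpen_ball
  -- Both sides equal 1/D near 0, and the possible pole 1/b lies on the boundary of this ball.
  refine hF'.eqOn_of_preconnected_of_eventuallyEq hG (convex_ball _ _).isPreconnected
    (z₀ := 0) (by simpa using hb) ?_ (by simpa using hz)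
  filter_upwards [Metric.ball_mem_nhds (0 : ℂ) one_pos] with w hw
  have hw' : ‖w‖ < 1 := by simpa using hw
  rw [hF.eq_inv w hw', hD w hw']

end GeometricVerblunsky

/-! ### The disk of a good radius -/

theorem norm_ofReal_mul_of_norm_one {b : ℝ} (hb : 0 < b) {z₀ : ℂ} (hz₀ : ‖z₀‖ = 1) :
    ‖(b : ℂ) * z₀‖ = b := by
  rw [norm_mul, hz₀, mul_one, Complex.norm_real, Real.norm_of_nonneg hb.le]

/-- A larger disk would contain 0, which is not in the annulus. -/
theorem IsGoodRadius.le_of_norm_one {b : ℝ} {c : ℂ} {Δ₂ : ℝ} {F : ℂ → ℂ} {z₀ : ℂ} {δ : ℝ}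
    (hδ : IsGoodRadius b c Δ₂ F (b * z₀) δ) (hb : 0 < b) (hΔ : 0 < Δ₂) (hz₀ : ‖z₀‖ = 1) :
    δ ≤ b := by
  by_contra! hlt
  have := (hδ.2 0 (by rwa [zero_sub, norm_neg, norm_ofReal_mul_of_norm_one hb hz₀])).1
  rw [norm_zero] at this
  have : 0 < b * Δ₂ := by positivity
  linarith

/-- The numerator of g contains F(z), which may have a pole at 1/b, and the annulus may reach that
far. But b is no farther from bz₀ than 1/b is, and the disk avoids b. -/
theorem IsGoodRadius.ne_one_div {b : ℝ} {c : ℂ} {Δ₂ : ℝ} {F : ℂ → ℂ} {z₀ : ℂ} {δ : ℝ}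
    (hδ : IsGoodRadius b c Δ₂ F (b * z₀) δ) (hb : 0 < b) (hb1 : b < 1) (hz₀ : ‖z₀‖ = 1) {z : ℂ}
    (hz : ‖z - b * z₀‖ < δ) : z ≠ ((1 / b : ℝ) : ℂ) := by
  rintro rfl
  have hbδ : δ ≤ ‖(b : ℂ) - b * z₀‖ := by
    by_contra! hlt
    exact (hδ.2 _ hlt).2.2.1 rfl
  have hlt := hz.trans_le hbδ
  have hre : z₀.re ≤ 1 := (Complex.re_le_norm z₀).trans hz₀.le
  have h1b : 1 < 1 / b := by rw [lt_div_iff₀ hb]; linarith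
  have hsq : ‖((1 / b : ℝ) : ℂ) - b * z₀‖ ^ 2 < ‖(b : ℂ) - b * z₀‖ ^ 2 :=
    pow_lt_pow_left₀ hlt (norm_nonneg _) two_ne_zero
  rw [← Complex.normSq_eq_norm_sq, ← Complex.normSq_eq_norm_sq, Complex.normSq_apply,
    Complex.normSq_apply] at hsq
  simp only [Complex.sub_re, Complex.sub_im, Complex.ofReal_re, Complex.ofReal_im, Complex.mul_re,
    Complex.mul_im, zero_mul, sub_zero, add_zero, zero_sub] at hsq
  nlinarith [mul_le_mul_of_nonneg_left hre hb.le, mul_pos (sub_pos.2 h1b) (sub_pos.2 hb1)]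

theorem IsSzegoInvContinuation.differentiableAt_ratioG {μ : Measure Circle} {b : ℝ} {c : ℂ}
    {Δ₂ : ℝ} {F : ℂ → ℂ} (hF : IsSzegoInvContinuation μ b Δ₂ F) (hb : 0 < b) (hb1 : b < 1)
    (hΔ : 0 < Δ₂) {z : ℂ} (h1 : b * Δ₂ < ‖z‖) (h2 : ‖z‖ < b / Δ₂)
    (hzb : z ≠ b) (hzb' : z ≠ ((1 / b : ℝ) : ℂ)) (h0 : F (1 / conj z) ≠ 0) :
    DifferentiableAt ℂ (fun z => conj (F (1 / conj z))) z ∧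
      DifferentiableAt ℂ (ratioG b c F) z := by
  have hpos : 0 < ‖z‖ := (mul_pos hb hΔ).trans h1
  have hz0 : z ≠ 0 := norm_pos_iff.1 hpos
  have hlt : b / Δ₂ < 1 / (b * Δ₂) := by
    rw [div_lt_div_iff₀ hΔ (by positivity)]
    nlinarith [mul_pos hb hΔ, mul_lt_mul_of_pos_right hb1 (mul_pos hb hΔ)]
  have hF1 : DifferentiableAt ℂ F z :=
    (hF.analytic z ⟨by simpa using h2.trans (by simpa using hlt), hzb'⟩).differentiableAt
  have hF2 : DifferentiableAt ℂ F (1 / conj z) := by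
    refine (hF.analytic _ ⟨?_, fun h => hzb ?_⟩).differentiableAt
    · rw [mem_ball_zero_iff, norm_one_div_conj]
      exact one_div_lt_one_div_of_lt (by positivity) h1
    · have := congrArg (fun w => 1 / conj w) (Set.mem_singleton_iff.1 h)
      simpa using this
  have hF3 := DifferentiableAt.conj_comp_one_div_conj hz0 hF2
  refine ⟨hF3, (hF1.const_mul _).fun_div (hF3.fun_mul (by fun_prop)) (mul_ne_zero ?_ ?_)⟩
  · simpa using h0
  · exact sub_ne_zero.2 hzb.symm

theorem IsSzegoInvContinuation.differentiableAt_of_good {μ : Measure Circle} {b : ℝ} {c : ℂ}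
    {Δ₂ : ℝ} {F : ℂ → ℂ} (hF : IsSzegoInvContinuation μ b Δ₂ F) (hb : 0 < b) (hb1 : b < 1)
    (hΔ : 0 < Δ₂) {z₀ : ℂ} (hz₀ : ‖z₀‖ = 1) {δ : ℝ} (hδ : IsGoodRadius b c Δ₂ F (b * z₀) δ)
    {z : ℂ} (hz : ‖z - b * z₀‖ < δ) :
    DifferentiableAt ℂ (fun z => conj (F (1 / conj z))) z ∧
      DifferentiableAt ℂ (ratioG b c F) z := by
  obtain ⟨h1, h2, h3, h4, -⟩ := hδ.2 z hz
  exact hF.differentiableAt_ratioG hb hb1 hΔ h1 h2 h3 (hδ.ne_one_div hb hb1 hz₀ hz) h4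

theorem IsSzegoInvContinuation.ratioG_ne_zero {μ : Measure Circle} {b : ℝ} {c : ℂ} {Δ₂ : ℝ}
    {F : ℂ → ℂ} (hF : IsSzegoInvContinuation μ b Δ₂ F) (hb1 : b < 1) (hc : c ≠ 0) {z : ℂ}
    (hz : IsRegularPoint b F z) : ratioG b c F z ≠ 0 := by
  obtain ⟨h1, h2, h3⟩ := hz
  have hz1 : ‖z‖ < 1 := h1.trans_lt hb1
  rw [ratioG, hF.eq_inv z hz1]
  refine div_ne_zero (mul_ne_zero (by simpa using hc) (inv_ne_zero (Complex.exp_ne_zero _)))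
    (mul_ne_zero (by simpa using h3) (sub_ne_zero.2 h2.symm))

/-- The variation of `log g` on a good disk is Lipschitz, uniformly in the radius. -/
theorem IsSzegoInvContinuation.exists_norm_log_ratioG_le {μ : Measure Circle} {b : ℝ} {c : ℂ}
    {Δ₂ : ℝ} {F : ℂ → ℂ} (hF : IsSzegoInvContinuation μ b Δ₂ F) (hb : 0 < b) (hb1 : b < 1)
    (hc : c ≠ 0) (hΔ : 0 < Δ₂) (hΔ1 : Δ₂ < 1) {w : ℂ} (hw : IsRegularPoint b F w) :
    ∃ K : ℝ, 0 ≤ K ∧ ∀ δ : ℝ, IsGoodRadius b c Δ₂ F w δ → ∀ z : ℂ, ‖z - w‖ < δ →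
      ‖Complex.log (ratioG b c F z / ratioG b c F w)‖ ≤ K * ‖z - w‖ := by
  have hG0 := hF.ratioG_ne_zero hb1 hc hw
  have hd : DifferentiableAt ℂ (ratioG b c F) w := by
    refine (hF.differentiableAt_ratioG hb hb1 hΔ ?_ ?_ hw.2.1 ?_ hw.2.2).2
    · rw [hw.1]; exact mul_lt_of_lt_one_right hb hΔ1
    · rw [hw.1, lt_div_iff₀ hΔ]; exact mul_lt_of_lt_one_right hb hΔ1
    · intro h
      have := congrArg norm h
      rw [hw.1, Complex.norm_real, Real.norm_of_nonneg (by positivity), eq_div_iff hb.ne'] at this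
      nlinarith
  obtain ⟨L, hL⟩ := hd.isBigO_sub.bound
  obtain ⟨ε, hε, hball⟩ := Metric.eventually_nhds_iff.1 hL
  set a := ‖ratioG b c F w‖ with ha
  have ha0 : 0 < a := norm_pos_iff.2 hG0
  -- The first term serves |z − w| < ε, where g is Lipschitz at w. For |z − w| ≥ ε the bound |log q|
  -- ≤ 3/8, valid in every good disk, is below |z − w|/ε. Neither term involves δ.
  refine ⟨3 / 2 * (|L| / a) + 1 / ε, by positivity, fun δ hδ z hz => ?_⟩
  have hgood := (hδ.2 z hz).2.2.2.2
  set q := ratioG b c F z / ratioG b c F w with hq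
  have hq1 : q - 1 = (ratioG b c F z - ratioG b c F w) / ratioG b c F w := by
    rw [hq]; field_simp
  have hq4 : ‖q - 1‖ ≤ 1 / 4 := by
    rw [hq1, norm_div, div_le_iff₀ ha0]
    linarith
  have hlog : ‖Complex.log q‖ ≤ 3 / 2 * ‖q - 1‖ := by
    have := Complex.norm_log_one_add_half_le_self (z := q - 1) (by linarith)
    rwa [add_sub_cancel] at this
  rcases lt_or_ge ‖z - w‖ ε with h1 | h1
  · have h2 : ‖q - 1‖ ≤ |L| / a * ‖z - w‖ := by
      rw [hq1, norm_div, div_mul_eq_mul_div]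
      gcongr
      refine (hball (by rwa [dist_eq_norm])).trans ?_
      gcongr
      exact le_abs_self L
    have : 0 ≤ 1 / ε * ‖z - w‖ := by positivity
    linarith
  · have h2 : 1 ≤ 1 / ε * ‖z - w‖ := by
      rw [one_div_mul_eq_div]; exact (one_le_div hε).2 h1
    have : 0 ≤ 3 / 2 * (|L| / a) * ‖z - w‖ := by positivity
    linarith

/-! ### Logarithmic coordinates near a point of the critical circle -/

theorem norm_mul_exp_sub_le {b : ℝ} (hb : 0 < b) {z₀ : ℂ} (hz₀ : ‖z₀‖ = 1) (u : ℂ) :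
    ‖b * z₀ * Complex.exp u - b * z₀‖ ≤ b * |Real.exp u.re - 1| + b * |u.im| := by
  have h1 : b * z₀ * Complex.exp u - b * z₀ =
      b * z₀ * (((Real.exp u.re - 1 : ℝ) : ℂ) * Complex.exp (u.im * Complex.I) +
        (Complex.exp (Complex.I * u.im) - 1)) := by
    conv_lhs => rw [← Complex.re_add_im u, Complex.exp_add]
    push_cast
    rw [mul_comm Complex.I]
    ring
  rw [h1, norm_mul, norm_ofReal_mul_of_norm_one hb hz₀, ← mul_add]
  gcongr
  refine (norm_add_le _ _).trans ?_
  rw [norm_mul, Complex.norm_exp_ofReal_mul_I, mul_one, Complex.norm_real, Real.norm_eq_abs]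
  gcongr
  exact Real.norm_exp_I_mul_ofReal_sub_one_le

theorem norm_mul_exp {b : ℝ} (hb : 0 < b) {z₀ : ℂ} (hz₀ : ‖z₀‖ = 1) (u : ℂ) :
    ‖b * z₀ * Complex.exp u‖ = b * Real.exp u.re := by
  rw [norm_mul, norm_ofReal_mul_of_norm_one hb hz₀, Complex.norm_exp]

/-- Mean value inequality on the disk |x − 1| ≤ 1/2, where |1/x| ≤ 2. -/
theorem norm_log_sub_log_le {p q : ℂ} (hp : ‖p - 1‖ ≤ 1 / 2) (hq : ‖q - 1‖ ≤ 1 / 2) :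
    ‖Complex.log p - Complex.log q‖ ≤ 2 * ‖p - q‖ := by
  have hslit : ∀ x ∈ Metric.closedBall (1 : ℂ) (1 / 2), x ∈ Complex.slitPlane := by
    intro x hx
    left
    have h1 : ‖x - 1‖ ≤ 1 / 2 := by simpa [dist_eq_norm] using hx
    have h2 := (Complex.abs_re_le_norm (x - 1)).trans h1
    rw [Complex.sub_re, Complex.one_re, abs_le] at h2
    linarith
  refine (convex_closedBall (1 : ℂ) (1 / 2)).norm_image_sub_le_of_norm_hasDerivWithin_le
    (f' := fun x => x⁻¹)
    (fun x hx => (Complex.hasDerivAt_log (hslit x hx)).hasDerivWithinAt) (fun x hx => ?_)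
    (by simpa [dist_eq_norm] using hq) (by simpa [dist_eq_norm] using hp)
  have h1 : ‖x - 1‖ ≤ 1 / 2 := by simpa [dist_eq_norm] using hx
  have h2 := norm_sub_norm_le (1 : ℂ) x
  rw [norm_one, norm_sub_rev] at h2
  rw [norm_inv]
  exact inv_le_of_inv_le₀ (by norm_num) (by norm_num; linarith)

/-- The closed rectangle `|Re u| ≤ s`, `|Im u| ≤ t`. -/
def logRectangle (s t : ℝ) : Set ℂ := Set.Icc (-s) s ×ℂ Set.Icc (-t) t

/-- The open rectangle `|Re u| < s`, `|Im u| < t`. -/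
def openLogRectangle (s t : ℝ) : Set ℂ := Set.Ioo (-s) s ×ℂ Set.Ioo (-t) t

theorem mem_logRectangle {s t : ℝ} {u : ℂ} : u ∈ logRectangle s t ↔ |u.re| ≤ s ∧ |u.im| ≤ t := by
  rw [logRectangle, Complex.mem_reProdIm, Set.mem_Icc, Set.mem_Icc, abs_le, abs_le]

theorem mem_openLogRectangle {s t : ℝ} {u : ℂ} :
    u ∈ openLogRectangle s t ↔ |u.re| < s ∧ |u.im| < t := by
  rw [openLogRectangle, Complex.mem_reProdIm, Set.mem_Ioo, Set.mem_Ioo, abs_lt, abs_lt]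

theorem isCompact_logRectangle (s t : ℝ) : IsCompact (logRectangle s t) :=
  isCompact_Icc.reProdIm isCompact_Icc

theorem convex_logRectangle (s t : ℝ) : Convex ℝ (logRectangle s t) :=
  ((convex_Icc (-s) s).linear_preimage Complex.reLm).inter
    ((convex_Icc (-t) t).linear_preimage Complex.imLm)

theorem isOpen_openLogRectangle (s t : ℝ) : IsOpen (openLogRectangle s t) :=
  isOpen_Ioo.reProdIm isOpen_Ioo

theorem convex_openLogRectangle (s t : ℝ) : Convex ℝ (openLogRectangle s t) :=
  ((convex_Ioo (-s) s).linear_preimage Complex.reLm).inter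
    ((convex_Ioo (-t) t).linear_preimage Complex.imLm)

theorem openLogRectangle_subset (s t : ℝ) : openLogRectangle s t ⊆ logRectangle s t := fun _ hu =>
  mem_logRectangle.2 ((mem_openLogRectangle.1 hu).imp le_of_lt le_of_lt)

theorem closedBall_subset_openLogRectangle {s t r : ℝ} {u : ℂ} (hr : 0 < r)
    (hu : u ∈ logRectangle s t) :
    Metric.closedBall u (r / 2) ⊆ openLogRectangle (s + r) (t + r) := by
  intro v hv
  have hv' : ‖v - u‖ ≤ r / 2 := by simpa [dist_eq_norm] using hv
  obtain ⟨h1, h2⟩ := mem_logRectangle.1 hu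
  have h3 := (Complex.abs_re_le_norm (v - u)).trans hv'
  have h4 := (Complex.abs_im_le_norm (v - u)).trans hv'
  rw [Complex.sub_re] at h3
  rw [Complex.sub_im] at h4
  rw [mem_openLogRectangle]
  constructor
  · linarith [abs_sub_abs_le_abs_sub v.re u.re]
  · linarith [abs_sub_abs_le_abs_sub v.im u.im]

/-- A good disk about a regular point `b z₀`, with a rectangle of half-width `s` in the coordinate
`u = log (z / (b z₀))` that it contains. -/
structure CriticalChart (μ : Measure Circle) (b Θ : ℝ) (c : ℂ) (A Δ₂ : ℝ) (F : ℂ → ℂ) (κ : ℝ)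
    (z₀ : ℂ) (δ s : ℝ) : Prop where
  geometric : GeometricVerblunsky μ b Θ c A
  c_ne : c ≠ 0
  continuation : IsSzegoInvContinuation μ b Δ₂ F
  radius_pos : 0 < Δ₂
  κ_pos : 0 < κ
  eq_dual : ∀ z : ℂ, ‖z‖ < 1 / b → F z = κ * dualLimit μ z
  norm_base : ‖z₀‖ = 1
  regular : IsRegularPoint b F (b * z₀)
  good : IsGoodRadius b c Δ₂ F (b * z₀) δ
  s_pos : 0 < s
  s_le : s ≤ δ / 4
  exp_le : b * (Real.exp s - 1) ≤ δ / 4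
  exp_lt : b * Real.exp s < 1
  rate_lt : b * Θ < b * Real.exp (-s)

/-- The angular half-width of the rectangle on which the zeros are located. -/
noncomputable def angularWidth (b δ : ℝ) : ℝ := δ * (1 + b) / (4 * b)

theorem exists_chart_width {b Θ δ : ℝ} (hb : 0 < b) (hb1 : b < 1) (hΘ : Θ < 1) (hδ : 0 < δ) :
    ∃ s : ℝ, 0 < s ∧ s ≤ δ / 4 ∧ b * (Real.exp s - 1) ≤ δ / 4 ∧ b * Real.exp s < 1 ∧
      b * Θ < b * Real.exp (-s) := by
  have h1 : ∀ᶠ s in nhds (0 : ℝ), s < δ / 4 := gt_mem_nhds (by positivity)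
  have h2 : ∀ᶠ s in nhds (0 : ℝ), b * (Real.exp s - 1) < δ / 4 :=
    (show Continuous fun s : ℝ => b * (Real.exp s - 1) by fun_prop).continuousAt.eventually
      (gt_mem_nhds (by simpa using hδ))
  have h3 : ∀ᶠ s in nhds (0 : ℝ), b * Real.exp s < 1 :=
    (show Continuous fun s : ℝ => b * Real.exp s by fun_prop).continuousAt.eventually
      (gt_mem_nhds (by simpa using hb1))
  have h4 : ∀ᶠ s in nhds (0 : ℝ), b * Θ < b * Real.exp (-s) :=
    (show Continuous fun s : ℝ => b * Real.exp (-s) by fun_prop).continuousAt.eventually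
      (lt_mem_nhds (by simpa using mul_lt_of_lt_one_right hb hΘ))
  have h5 : ∀ᶠ s in nhdsWithin (0 : ℝ) (Set.Ioi 0), s < δ / 4 ∧ b * (Real.exp s - 1) < δ / 4 ∧
      b * Real.exp s < 1 ∧ b * Θ < b * Real.exp (-s) :=
    (h1.and (h2.and (h3.and h4))).filter_mono nhdsWithin_le_nhds
  obtain ⟨s, ⟨hs1, hs2, hs3, hs4⟩, hs⟩ := (h5.and self_mem_nhdsWithin).exists
  exact ⟨s, hs, hs1.le, hs2.le, hs3, hs4⟩

/-! ### The zero equation in the logarithmic coordinate -/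

namespace CriticalChart

variable {μ : Measure Circle} {b Θ : ℝ} {c : ℂ} {A Δ₂ : ℝ} {F : ℂ → ℂ} {κ : ℝ} {z₀ : ℂ} {δ s : ℝ}

theorem b_pos (h : CriticalChart μ b Θ c A Δ₂ F κ z₀ δ s) : 0 < b := h.geometric.b_pos

theorem δ_pos (h : CriticalChart μ b Θ c A Δ₂ F κ z₀ δ s) : 0 < δ := h.good.1

theorem δ_le (h : CriticalChart μ b Θ c A Δ₂ F κ z₀ δ s) : δ ≤ b :=
  h.good.le_of_norm_one h.b_pos h.radius_pos h.norm_base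

theorem base_ne_zero (h : CriticalChart μ b Θ c A Δ₂ F κ z₀ δ s) : z₀ ≠ 0 :=
  norm_pos_iff.1 (by rw [h.norm_base]; exact one_pos)

theorem ratioG_ne_zero (h : CriticalChart μ b Θ c A Δ₂ F κ z₀ δ s) :
    ratioG b c F (b * z₀) ≠ 0 :=
  h.continuation.ratioG_ne_zero h.geometric.b_lt h.c_ne h.regular

theorem mul_angularWidth (h : CriticalChart μ b Θ c A Δ₂ F κ z₀ δ s) :
    b * angularWidth b δ = δ * (1 + b) / 4 := by
  have := h.b_pos
  rw [angularWidth]; field_simp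

/-- Admissible slots reach angles up to δ/2 + O(1/n), so the rectangle must be strictly wider than
δ/2. The condition b < 1 gives this room while the arc length δ(1 + b)/4 stays below δ/2. -/
theorem lt_angularWidth (h : CriticalChart μ b Θ c A Δ₂ F κ z₀ δ s) :
    δ / 2 < angularWidth b δ := by
  have hb := h.b_pos
  have hδ := h.δ_pos
  rw [angularWidth, div_lt_div_iff₀ (by norm_num) (by positivity)]
  nlinarith [mul_pos hδ (sub_pos.2 h.geometric.b_lt)]

theorem angularWidth_le (h : CriticalChart μ b Θ c A Δ₂ F κ z₀ δ s) :
    angularWidth b δ ≤ 1 / 2 := by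
  have hb := h.b_pos
  rw [angularWidth, div_le_div_iff₀ (by positivity) (by norm_num)]
  nlinarith [h.δ_le, h.geometric.b_lt, h.δ_pos]

/-- Budget: δ/4 radially, δ(1 + b)/4 for the angular width, and less than δ/4 for the margin s; in
total below δ(3 + b)/4 < δ. -/
theorem norm_sub_lt (h : CriticalChart μ b Θ c A Δ₂ F κ z₀ δ s) {u : ℂ}
    (hu : u ∈ logRectangle s (angularWidth b δ + s)) :
    ‖b * z₀ * Complex.exp u - b * z₀‖ < δ := by
  obtain ⟨h1, h2⟩ := mem_logRectangle.1 hu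
  have hb := h.b_pos
  refine (norm_mul_exp_sub_le hb h.norm_base u).trans_lt ?_
  have h3 : |Real.exp u.re - 1| ≤ Real.exp s - 1 := by
    obtain ⟨h4, h5⟩ := abs_le.1 h1
    rw [abs_le]
    constructor
    · have h6 : Real.exp (-s) ≤ Real.exp u.re := Real.exp_le_exp.2 h4
      have h7 : 2 ≤ Real.exp s + Real.exp (-s) := by
        linarith [Real.add_one_le_exp s, Real.add_one_le_exp (-s)]
      linarith
    · linarith [Real.exp_le_exp.2 h5]
  have h4 : b * |u.im| ≤ δ * (1 + b) / 4 + b * s := by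
    rw [← h.mul_angularWidth, ← mul_add]; gcongr
  have h5 : b * |Real.exp u.re - 1| ≤ δ / 4 := le_trans (by gcongr) h.exp_le
  have h6 : b * s < δ / 4 := by
    nlinarith [h.s_pos, h.s_le, h.geometric.b_lt]
  nlinarith [h.geometric.b_lt, h.δ_pos]

theorem norm_bounds (h : CriticalChart μ b Θ c A Δ₂ F κ z₀ δ s) {u : ℂ} {t : ℝ}
    (hu : u ∈ logRectangle s t) : b * Real.exp (-s) ≤ ‖b * z₀ * Complex.exp u‖ ∧
      ‖b * z₀ * Complex.exp u‖ < 1 := by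
  obtain ⟨h1, -⟩ := mem_logRectangle.1 hu
  obtain ⟨h4, h5⟩ := abs_le.1 h1
  have hb := h.b_pos
  rw [norm_mul_exp hb h.norm_base]
  refine ⟨by gcongr, lt_of_le_of_lt ?_ h.exp_lt⟩
  gcongr

theorem differentiableAt_comp (h : CriticalChart μ b Θ c A Δ₂ F κ z₀ δ s) {u : ℂ}
    (hu : u ∈ logRectangle s (angularWidth b δ + s)) :
    DifferentiableAt ℂ (fun u => conj (F (1 / conj (b * z₀ * Complex.exp u)))) u ∧
      DifferentiableAt ℂ (fun u => ratioG b c F (b * z₀ * Complex.exp u)) u := by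
  obtain ⟨h1, h2⟩ := h.continuation.differentiableAt_of_good h.b_pos h.geometric.b_lt h.radius_pos
    h.norm_base h.good (h.norm_sub_lt hu)
  have h3 : DifferentiableAt ℂ (fun u => (b : ℂ) * z₀ * Complex.exp u) u := by fun_prop
  exact ⟨DifferentiableAt.comp (g := fun z => conj (F (1 / conj z))) u h1 h3,
    DifferentiableAt.comp (g := ratioG b c F) u h2 h3⟩

variable [IsFiniteMeasure μ]

/-- The continuation of `conj Ψ(1 / conj z)` from the recursion agrees with the one from `F`. -/
theorem mul_reflectedLimit_eq (h : CriticalChart μ b Θ c A Δ₂ F κ z₀ δ s) {u : ℂ}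
    (hu : u ∈ openLogRectangle s (angularWidth b δ + s)) :
    κ * reflectedLimit μ b c (b * z₀ * Complex.exp u) =
      conj (F (1 / conj (b * z₀ * Complex.exp u))) := by
  have hb := h.b_pos
  have hopen := isOpen_openLogRectangle s (angularWidth b δ + s)
  have hw : 0 < angularWidth b δ + s := by linarith [h.lt_angularWidth, h.δ_pos, h.s_pos]
  have h1 : AnalyticOnNhd ℂ (fun u => (κ : ℂ) * reflectedLimit μ b c (b * z₀ * Complex.exp u))
      (openLogRectangle s (angularWidth b δ + s)) := by
    refine DifferentiableOn.analyticOnNhd (fun v hv => ?_) hopen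
    have hv' := openLogRectangle_subset _ _ hv
    obtain ⟨h2, h3⟩ := h.norm_bounds hv'
    have h4 : DifferentiableAt ℂ (fun u => (b : ℂ) * z₀ * Complex.exp u) v := by fun_prop
    have h5 := h.geometric.differentiableAt_reflectedLimit (h.rate_lt.trans_le h2) h3
      (h.good.2 _ (h.norm_sub_lt hv')).2.2.1
    exact ((h5.comp v h4).const_mul _).differentiableWithinAt
  have h2 : AnalyticOnNhd ℂ (fun u => conj (F (1 / conj (b * z₀ * Complex.exp u))))
      (openLogRectangle s (angularWidth b δ + s)) :=
    DifferentiableOn.analyticOnNhd (fun v hv =>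
      (h.differentiableAt_comp (openLogRectangle_subset _ _ hv)).1.differentiableWithinAt) hopen
  -- Re v > 0 means |z| > b, where both sides are κ·conj Ψ(1/conj z); the identity theorem spreads
  -- this over the rectangle.
  have hpos : ((s / 2 : ℝ) : ℂ) ∈ openLogRectangle s (angularWidth b δ + s) ∩ {v | 0 < v.re} := by
    refine ⟨mem_openLogRectangle.2 ⟨?_, ?_⟩, ?_⟩
    · rw [Complex.ofReal_re, abs_of_pos (half_pos h.s_pos)]; linarith [h.s_pos]
    · simpa using hw
    · simpa using h.s_pos
  refine h1.eqOn_of_preconnected_of_eventuallyEq h2 (convex_openLogRectangle _ _).isPreconnected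
    hpos.1 ?_ hu
  filter_upwards [(hopen.inter (isOpen_lt continuous_const Complex.continuous_re)).mem_nhds hpos]
    with v hv
  obtain ⟨-, h3⟩ := h.norm_bounds (openLogRectangle_subset _ _ hv.1)
  have h4 : b < ‖b * z₀ * Complex.exp v‖ := by
    rw [norm_mul_exp hb h.norm_base]
    exact lt_mul_of_one_lt_right hb (Real.one_lt_exp_iff.2 hv.2)
  rw [h.geometric.reflectedLimit_eq h4 h3.le, h.eq_dual]
  · simp
  · rw [norm_one_div_conj]
    exact one_div_lt_one_div_of_lt hb h4

theorem exists_le_norm_reflected (h : CriticalChart μ b Θ c A Δ₂ F κ z₀ δ s) :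
    ∃ m : ℝ, 0 < m ∧ ∀ u ∈ openLogRectangle s (angularWidth b δ + s),
      m ≤ ‖reflectedLimit μ b c (b * z₀ * Complex.exp u)‖ := by
  have hcont : ContinuousOn (fun u => ‖conj (F (1 / conj (b * z₀ * Complex.exp u)))‖)
      (logRectangle s (angularWidth b δ + s)) := fun v hv =>
    (h.differentiableAt_comp hv).1.continuousAt.norm.continuousWithinAt
  obtain ⟨m, hm, hle⟩ := (isCompact_logRectangle _ _).exists_forall_le' hcont (a := 0)
    fun v hv => by
      have := (h.good.2 _ (h.norm_sub_lt hv)).2.2.2.1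
      simpa using this
  have hκ := h.κ_pos
  refine ⟨m / κ, by positivity, fun u hu => ?_⟩
  have h1 := hle u (openLogRectangle_subset _ _ hu)
  rw [← h.mul_reflectedLimit_eq hu, norm_mul, Complex.norm_real, Real.norm_of_nonneg hκ.le] at h1
  rw [div_le_iff₀ hκ, mul_comm]
  exact h1

/-- The two-term asymptotics with bⁿR factored out: κ cancels in g, so conj(c)Ψ/(z − b) = −R g, and
zⁿ = bⁿ z₀ⁿ e^{nu}. -/
theorem norm_monicOPUC_sub_le (h : CriticalChart μ b Θ c A Δ₂ F κ z₀ δ s) :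
    ∃ E : ℝ, 0 < E ∧ ∀ n, ∀ u ∈ openLogRectangle s (angularWidth b δ + s),
      ‖(monicOPUC μ n).eval (b * z₀ * Complex.exp u) -
        b ^ n * reflectedLimit μ b c (b * z₀ * Complex.exp u) *
          (z₀ ^ n * Complex.exp (n * u) - ratioG b c F (b * z₀ * Complex.exp u))‖ ≤
        E * (b * Θ) ^ n := by
  obtain ⟨E, hE, hle⟩ := h.geometric.norm_monicOPUC_sub_le h.rate_lt
  obtain ⟨m, hm, hlow⟩ := h.exists_le_norm_reflected
  refine ⟨E, hE, fun n u hu => ?_⟩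
  have hu' := openLogRectangle_subset _ _ hu
  obtain ⟨h1, h2⟩ := h.norm_bounds hu'
  have hzb := (h.good.2 _ (h.norm_sub_lt hu')).2.2.1
  convert hle n _ h1 h2.le hzb using 3
  have hR : reflectedLimit μ b c (b * z₀ * Complex.exp u) ≠ 0 :=
    norm_pos_iff.1 (hm.trans_le (hlow u hu))
  have hκ : (κ : ℂ) ≠ 0 := by exact_mod_cast h.κ_pos.ne'
  rw [ratioG, ← h.mul_reflectedLimit_eq hu,
    h.eq_dual _ (h2.trans h.geometric.one_lt_one_div), Complex.exp_nat_mul]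
  have h3 : (b : ℂ) - b * z₀ * Complex.exp u ≠ 0 := sub_ne_zero.2 hzb.symm
  have h4 : (b : ℂ) * z₀ * Complex.exp u - b ≠ 0 := sub_ne_zero.2 hzb
  generalize hz : (b : ℂ) * z₀ * Complex.exp u = z at *
  have h5 : z ^ n = b ^ n * (z₀ ^ n * Complex.exp u ^ n) := by rw [← hz, mul_pow, mul_pow]; ring
  rw [h5]
  have h6 : (b : ℂ) - z = -(z - b) := by ring
  rw [h6]
  field_simp
  ring

/-- In the rectangle, the zeros of `Φₙ` are the solutions of `e^{n u} = z₀⁻ⁿ g(b z₀) e^{Λ(u)}`,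
they are simple, and `Λ` is close to `log (g / g(b z₀))` and Lipschitz. -/
theorem exists_log (h : CriticalChart μ b Θ c A Δ₂ F κ z₀ δ s) : ∃ (L E : ℝ) (N : ℕ), 0 ≤ L ∧
    0 ≤ E ∧ ∀ n ≥ N, ∃ Λ : ℂ → ℂ, (∀ u ∈ logRectangle (s / 2) (angularWidth b δ), ‖Λ u‖ ≤ 3 / 4 ∧
      (∀ v ∈ logRectangle (s / 2) (angularWidth b δ), ‖Λ u - Λ v‖ ≤ L * ‖u - v‖) ∧
      ((monicOPUC μ n).eval (b * z₀ * Complex.exp u) = 0 ↔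
        Complex.exp (n * u) = ratioG b c F (b * z₀) / z₀ ^ n * Complex.exp (Λ u)) ∧
      ((monicOPUC μ n).eval (b * z₀ * Complex.exp u) = 0 →
        (monicOPUC μ n).derivative.eval (b * z₀ * Complex.exp u) ≠ 0) ∧
      ‖Λ u - Complex.log (ratioG b c F (b * z₀ * Complex.exp u) / ratioG b c F (b * z₀))‖ ≤
        E * Θ ^ n) := by
  obtain ⟨E, hE, hle⟩ := h.norm_monicOPUC_sub_le
  obtain ⟨m, hm, hlow⟩ := h.exists_le_norm_reflected
  have hG0 := h.ratioG_ne_zero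
  set G₀ := ratioG b c F (b * z₀) with hG₀
  have ha : 0 < ‖G₀‖ := norm_pos_iff.2 hG0
  have hb := h.b_pos
  have hbc : (b : ℂ) ≠ 0 := by exact_mod_cast hb.ne'
  have hz₀ := h.base_ne_zero
  have hs := h.s_pos
  have hΘ := h.geometric.rate_pos
  set E₁ : ℝ := E / (m * ‖G₀‖) with hE₁
  have hE₁0 : 0 < E₁ := by positivity
  have htend : Filter.Tendsto (fun n : ℕ => E₁ * Θ ^ n) Filter.atTop (nhds 0) := by
    simpa using (tendsto_pow_atTop_nhds_zero_of_lt_one hΘ.le h.geometric.rate_lt).const_mul E₁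
  obtain ⟨N, hN⟩ := Filter.eventually_atTop.1
    (htend.eventually (gt_mem_nhds (show (0 : ℝ) < 1 / 4 by norm_num)))
  -- Cauchy's estimate for Λ': |Λ| ≤ 3/4 on disks of radius s/4 about points of the smaller
  -- rectangle.
  set L : ℝ := 3 / 4 / (s / 4) with hL
  obtain ⟨N', hN'⟩ := exists_nat_gt L
  refine ⟨L, 2 * E₁, max N N', by positivity, by positivity, fun n hn => ?_⟩
  have hnN : E₁ * Θ ^ n < 1 / 4 := hN n ((le_max_left _ _).trans hn)
  have hnL : L < n := hN'.trans_le (by exact_mod_cast (le_max_right _ _).trans hn)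
  set Q := openLogRectangle s (angularWidth b δ + s) with hQ
  have hQopen : IsOpen Q := isOpen_openLogRectangle _ _
  set R : ℂ → ℂ := fun u => reflectedLimit μ b c (b * z₀ * Complex.exp u) with hR
  have hRd : ∀ u ∈ Q, DifferentiableAt ℂ R u := by
    intro v hv
    have hv' := openLogRectangle_subset _ _ hv
    obtain ⟨h2, h3⟩ := h.norm_bounds hv'
    have h4 : DifferentiableAt ℂ (fun u => (b : ℂ) * z₀ * Complex.exp u) v := by fun_prop
    have h5 := h.geometric.differentiableAt_reflectedLimit (h.rate_lt.trans_le h2) h3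
      (h.good.2 _ (h.norm_sub_lt hv')).2.2.1
    exact h5.comp v h4
  have hR0 : ∀ u ∈ Q, R u ≠ 0 := fun u hu => norm_pos_iff.1 (hm.trans_le (hlow u hu))
  -- Defined so that Φₙ = 0 exactly when z₀ⁿ e^{nu} = G₀ p(u), with no error term. The asymptotics
  -- say that p is within E₁Θⁿ of g/G₀, so |p − 1| ≤ 1/4 + 1/4 and Λ = log p is available.
  set p : ℂ → ℂ := fun u => z₀ ^ n * Complex.exp (n * u) / G₀ -
    (monicOPUC μ n).eval (b * z₀ * Complex.exp u) * (b ^ n * R u * G₀)⁻¹ with hp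
  have hden : ∀ u ∈ Q, (b : ℂ) ^ n * R u * G₀ ≠ 0 := fun u hu =>
    mul_ne_zero (mul_ne_zero (pow_ne_zero _ hbc) (hR0 u hu)) hG0
  have hinv : ∀ u ∈ Q, DifferentiableAt ℂ (fun u => ((b : ℂ) ^ n * R u * G₀)⁻¹) u := fun u hu =>
    (((hRd u hu).const_mul _).mul_const _).fun_inv (hden u hu)
  have hpd : ∀ u ∈ Q, DifferentiableAt ℂ p u := fun u hu =>
    DifferentiableAt.fun_sub (by fun_prop) (DifferentiableAt.fun_mul (by fun_prop) (hinv u hu))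
  have hpG : ∀ u ∈ Q, ‖p u - ratioG b c F (b * z₀ * Complex.exp u) / G₀‖ ≤ E₁ * Θ ^ n := by
    intro u hu
    have h1 : p u - ratioG b c F (b * z₀ * Complex.exp u) / G₀ =
        -((monicOPUC μ n).eval (b * z₀ * Complex.exp u) - b ^ n * R u *
          (z₀ ^ n * Complex.exp (n * u) - ratioG b c F (b * z₀ * Complex.exp u))) /
          (b ^ n * R u * G₀) := by
      have h2 := hR0 u hu
      simp only [hp]
      field_simp
      ring
    rw [h1, norm_div, norm_neg, norm_mul, norm_mul, norm_pow, Complex.norm_real,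
      Real.norm_of_nonneg hb.le]
    calc _ ≤ E * (b * Θ) ^ n / (b ^ n * m * ‖G₀‖) := by
          have h3 := hle n u hu
          have h4 := hlow u hu
          gcongr
      _ = _ := by rw [hE₁, mul_pow]; field_simp
  have hG4 : ∀ u ∈ Q, ‖ratioG b c F (b * z₀ * Complex.exp u) / G₀ - 1‖ ≤ 1 / 4 := by
    intro u hu
    have h1 := (h.good.2 _ (h.norm_sub_lt (openLogRectangle_subset _ _ hu))).2.2.2.2
    have h2 : ratioG b c F (b * z₀ * Complex.exp u) / G₀ - 1 =
        (ratioG b c F (b * z₀ * Complex.exp u) - G₀) / G₀ := by field_simp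
    rw [h2, norm_div, div_le_iff₀ ha]
    linarith
  have hp2 : ∀ u ∈ Q, ‖p u - 1‖ ≤ 1 / 2 := by
    intro u hu
    have h1 := norm_add_le (p u - ratioG b c F (b * z₀ * Complex.exp u) / G₀)
      (ratioG b c F (b * z₀ * Complex.exp u) / G₀ - 1)
    rw [sub_add_sub_cancel] at h1
    linarith [hpG u hu, hG4 u hu]
  have hslit : ∀ u ∈ Q, p u ∈ Complex.slitPlane := by
    intro u hu
    left
    have h2 := (Complex.abs_re_le_norm (p u - 1)).trans (hp2 u hu)
    rw [Complex.sub_re, Complex.one_re, abs_le] at h2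
    linarith
  have hΛd : ∀ u ∈ Q, DifferentiableAt ℂ (fun u => Complex.log (p u)) u := fun u hu =>
    (hpd u hu).clog (hslit u hu)
  have hΛn : ∀ u ∈ Q, ‖Complex.log (p u)‖ ≤ 3 / 4 := by
    intro u hu
    have h1 := Complex.norm_log_one_add_half_le_self (hp2 u hu)
    rw [add_sub_cancel] at h1
    linarith [hp2 u hu]
  have hball : ∀ u ∈ logRectangle (s / 2) (angularWidth b δ), Metric.closedBall u (s / 4) ⊆ Q := by
    intro u hu
    have := closedBall_subset_openLogRectangle (half_pos hs) hu
    rw [show s / 2 / 2 = s / 4 by ring, add_halves] at this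
    refine this.trans fun v hv => ?_
    rw [mem_openLogRectangle] at hv
    rw [hQ, mem_openLogRectangle]
    exact ⟨hv.1, by linarith [hv.2]⟩
  have hsub : logRectangle (s / 2) (angularWidth b δ) ⊆ Q := fun u hu =>
    hball u hu (Metric.mem_closedBall_self (by positivity))
  have hderiv : ∀ u ∈ logRectangle (s / 2) (angularWidth b δ),
      ‖deriv (fun u => Complex.log (p u)) u‖ ≤ L := by
    intro u hu
    refine Complex.norm_deriv_le_of_forall_mem_sphere_norm_le (by positivity) ?_ fun v hv =>
      hΛn v (hball u hu (Metric.sphere_subset_closedBall hv))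
    refine DifferentiableOn.diffContOnCl fun v hv => ?_
    exact (hΛd v (hball u hu (Metric.closure_ball_subset_closedBall hv))).differentiableWithinAt
  refine ⟨fun u => Complex.log (p u), fun u hu => ⟨hΛn u (hsub hu), fun v hv => ?_, ?_, ?_, ?_⟩⟩
  · exact (convex_logRectangle _ _).norm_image_sub_le_of_norm_deriv_le
      (fun w hw => hΛd w (hsub hw)) hderiv hv hu
  · have h1 := hden u (hsub hu)
    rw [Complex.exp_log (Complex.slitPlane_ne_zero (hslit u (hsub hu)))]
    have h2 : G₀ / z₀ ^ n * p u = Complex.exp (n * u) -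
        (monicOPUC μ n).eval (b * z₀ * Complex.exp u) * (b ^ n * R u * G₀)⁻¹ * (G₀ / z₀ ^ n) := by
      have h3 := hR0 u (hsub hu)
      simp only [hp]
      field_simp
    rw [h2]
    constructor
    · intro h0; rw [h0]; ring
    · intro h0
      have h3 : (monicOPUC μ n).eval (b * z₀ * Complex.exp u) * (b ^ n * R u * G₀)⁻¹ *
          (G₀ / z₀ ^ n) = 0 := by linear_combination h0
      have h4 : G₀ / z₀ ^ n ≠ 0 := div_ne_zero hG0 (pow_ne_zero _ hz₀)
      exact (mul_eq_zero.1 ((mul_eq_zero.1 h3).resolve_right h4)).resolve_right (inv_ne_zero h1)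
  -- At a double zero the product term in p has zero derivative, so p' = np and Λ' = n, against |Λ'|
  -- ≤ L < n.
  · intro h0 h0'
    have huQ := hsub hu
    have hP : HasDerivAt (fun u => (monicOPUC μ n).eval (b * z₀ * Complex.exp u)) 0 u := by
      have h1 := (monicOPUC μ n).hasDerivAt (b * z₀ * Complex.exp u)
      have h2 : HasDerivAt (fun u => (b : ℂ) * z₀ * Complex.exp u)
        (b * z₀ * Complex.exp u) u := (Complex.hasDerivAt_exp u).const_mul _
      have h3 := h1.comp u h2
      rw [h0', zero_mul] at h3
      exact h3
    have hexp : HasDerivAt (fun u : ℂ => z₀ ^ n * Complex.exp (n * u) / G₀)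
        (n * (z₀ ^ n * Complex.exp (n * u) / G₀)) u := by
      have h1 : HasDerivAt (fun u : ℂ => (n : ℂ) * u) n u := by
        simpa using (hasDerivAt_id u).const_mul (n : ℂ)
      refine ((h1.cexp.const_mul (z₀ ^ n)).div_const G₀).congr_deriv ?_
      ring
    have hpn : HasDerivAt p (n * p u) u := by
      refine (hexp.fun_sub (hP.fun_mul (hinv u huQ).hasDerivAt)).congr_deriv ?_
      simp only [hp, h0]
      ring
    have hΛ := hpn.clog (hslit u huQ)
    have h1 := hderiv u hu
    rw [hΛ.deriv, mul_div_cancel_right₀ _ (Complex.slitPlane_ne_zero (hslit u huQ)),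
      Complex.norm_natCast] at h1
    exact absurd h1 (not_le.2 hnL)
  · refine (norm_log_sub_log_le (hp2 u (hsub hu)) ((hG4 u (hsub hu)).trans (by norm_num))).trans ?_
    rw [mul_assoc 2]
    exact mul_le_mul_of_nonneg_left (hpG u (hsub hu)) zero_le_two

end CriticalChart

/-! ### Zero-free regions on both sides of the critical circle -/

namespace CriticalChart

variable {μ : Measure Circle} {b Θ : ℝ} {c : ℂ} {A Δ₂ : ℝ} {F : ℂ → ℂ} {κ : ℝ} {z₀ : ℂ} {δ s : ℝ}

theorem norm_sub_lt_of_abs_le (h : CriticalChart μ b Θ c A Δ₂ F κ z₀ δ s) {u : ℂ}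
    (h1 : |u.im| ≤ angularWidth b δ) (h2 : |b * Real.exp u.re - b| ≤ δ / 2) :
    ‖b * z₀ * Complex.exp u - b * z₀‖ < δ := by
  have hb := h.b_pos
  refine (norm_mul_exp_sub_le hb h.norm_base u).trans_lt ?_
  have h3 : b * |Real.exp u.re - 1| = |b * Real.exp u.re - b| := by
    rw [← abs_of_pos hb, ← abs_mul, abs_of_pos hb]; ring_nf
  have h4 : b * |u.im| ≤ δ * (1 + b) / 4 := by
    rw [← h.mul_angularWidth]; gcongr
  nlinarith [h.geometric.b_lt, h.δ_pos]

variable [IsFiniteMeasure μ]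

/-- For |z| ≤ ρ < b the bⁿ term dominates: its coefficient is bounded below since Ψ is bounded away
from 0 and |z − b| ≤ 2b. -/
theorem eval_ne_zero_inner (h : CriticalChart μ b Θ c A Δ₂ F κ z₀ δ s) :
    ∃ N : ℕ, ∀ n ≥ N, ∀ z : ℂ, ‖z‖ ≤ b * Real.exp (-(s / 2)) → (monicOPUC μ n).eval z ≠ 0 := by
  have hb := h.b_pos
  have hs := h.s_pos
  set ρ := b * Real.exp (-(s / 2)) with hρ
  have hρb : ρ < b := mul_lt_of_lt_one_right hb
    (by rw [← Real.exp_zero, Real.exp_lt_exp]; linarith)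
  have hρ0 : 0 < ρ := by positivity
  obtain ⟨E, hE, hle⟩ := h.geometric.norm_monicOPUC_sub_le_inner
    (h.rate_lt.trans_le (mul_le_mul_of_nonneg_left (Real.exp_le_exp.2 (by linarith)) hb.le)) hρb
  obtain ⟨m, hm, hlow⟩ := exists_le_norm_dualLimit h.geometric.nontrivial hb h.geometric.b_lt
    h.geometric.norm_le
  have hc : 0 < ‖c‖ := norm_pos_iff.2 h.c_ne
  have htend : Filter.Tendsto (fun n : ℕ => E * (ρ / b) ^ n) Filter.atTop (nhds 0) := by
    simpa using (tendsto_pow_atTop_nhds_zero_of_lt_one (by positivity)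
      ((div_lt_one hb).2 hρb)).const_mul E
  obtain ⟨N, hN⟩ := Filter.eventually_atTop.1
    (htend.eventually (gt_mem_nhds (show (0 : ℝ) < ‖c‖ * m / (2 * b) by positivity)))
  refine ⟨N, fun n hn z hz h0 => ?_⟩
  have h1 := hle n z hz
  have hz1 : ‖z‖ ≤ 1 := hz.trans (hρb.le.trans h.geometric.b_lt.le)
  have h2 : ‖z - b‖ ≤ 2 * b := by
    have := norm_sub_le z (b : ℂ)
    rw [Complex.norm_real, Real.norm_of_nonneg hb.le] at this
    linarith
  have h3 : 0 < ‖z - b‖ := by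
    refine norm_pos_iff.2 (sub_ne_zero.2 ?_)
    rintro rfl
    rw [Complex.norm_real, Real.norm_of_nonneg hb.le] at hz
    linarith
  rw [h0, zero_sub, norm_neg, norm_mul, norm_pow, Complex.norm_real, Real.norm_of_nonneg hb.le,
    norm_div, norm_mul, RCLike.norm_conj] at h1
  have h4 : ‖c‖ * m / (2 * b) ≤ ‖c‖ * ‖dualLimit μ z‖ / ‖z - b‖ := by
    have := hlow z hz1
    gcongr
  have h5 : b ^ n * (‖c‖ * m / (2 * b)) ≤ E * ρ ^ n :=
    (mul_le_mul_of_nonneg_left h4 (by positivity)).trans h1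
  have h6 := hN n hn
  rw [div_pow, mul_div_assoc', div_lt_iff₀ (by positivity)] at h6
  linarith

/-- Here Φₙ/zⁿ tends to conj Ψ(1/conj z), whose nonvanishing is known only on the good disk. Hence
the restriction to a compact piece of it, unlike in the inner region. -/
theorem eval_ne_zero_outer (h : CriticalChart μ b Θ c A Δ₂ F κ z₀ δ s) :
    ∃ N : ℕ, ∀ n ≥ N, ∀ u : ℂ, s / 2 ≤ u.re → |u.im| ≤ angularWidth b δ →
      |b * Real.exp u.re - b| ≤ δ / 2 → (monicOPUC μ n).eval (b * z₀ * Complex.exp u) ≠ 0 := by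
  have hb := h.b_pos
  have hs := h.s_pos
  have hz₀ := h.base_ne_zero
  have hbc : (b : ℂ) ≠ 0 := by exact_mod_cast hb.ne'
  set S : Set ℂ := (Set.Icc (s / 2) 1 ×ℂ Set.Icc (-angularWidth b δ) (angularWidth b δ)) ∩
    {u | |b * Real.exp u.re - b| ≤ δ / 2} with hS
  have hSc : IsCompact S := (isCompact_Icc.reProdIm isCompact_Icc).inter_right
    (isClosed_le (by fun_prop) continuous_const)
  have hpt : ∀ u ∈ S, ‖b * z₀ * Complex.exp u - b * z₀‖ < δ ∧
      b * Real.exp (s / 2) ≤ ‖b * z₀ * Complex.exp u‖ := by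
    rintro u ⟨hu1, hu2⟩
    rw [Complex.mem_reProdIm, Set.mem_Icc, Set.mem_Icc, ← abs_le] at hu1
    refine ⟨h.norm_sub_lt_of_abs_le hu1.2 hu2, ?_⟩
    rw [norm_mul_exp hb h.norm_base]
    have := hu1.1.1
    gcongr
  set ρ := b * Real.exp (s / 2) with hρ
  have hρb : b < ρ := lt_mul_of_one_lt_right hb (Real.one_lt_exp_iff.2 (by linarith))
  have hρ0 : 0 < ρ := by positivity
  have hρ1 : ρ ≤ 1 := (mul_le_mul_of_nonneg_left (Real.exp_le_exp.2 (by linarith))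
    hb.le).trans h.exp_lt.le
  have hlt : ∀ u ∈ S, ‖1 / conj (b * z₀ * Complex.exp u)‖ < 1 / b := fun u hu => by
    rw [norm_one_div_conj]
    exact one_div_lt_one_div_of_lt hb (hρb.trans_le (hpt u hu).2)
  have hcont : ContinuousOn (fun u => ‖dualLimit μ (1 / conj (b * z₀ * Complex.exp u))‖) S := by
    intro u hu
    have h1 := (h.geometric.differentiableAt_dualLimit (hlt u hu)).continuousAt
    have h2 : ContinuousAt (fun u => 1 / conj ((b : ℂ) * z₀ * Complex.exp u)) u := by
      refine ContinuousAt.div (by fun_prop) (by fun_prop) ?_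
      simp [hbc, hz₀]
    exact (ContinuousAt.comp (g := dualLimit μ)
      (f := fun u => 1 / conj ((b : ℂ) * z₀ * Complex.exp u)) h1 h2).norm.continuousWithinAt
  obtain ⟨m, hm, hlow⟩ := hSc.exists_forall_le' hcont (a := 0) fun u hu => by
    have h1 := (h.good.2 _ (hpt u hu).1).2.2.2.1
    rw [h.eq_dual _ (hlt u hu)] at h1
    exact norm_pos_iff.2 (right_ne_zero_of_mul h1)
  obtain ⟨E, hE, hle⟩ := h.geometric.norm_monicOPUC_div_sub_le hρb hρ1
  have htend : Filter.Tendsto (fun n : ℕ => E * (b / ρ) ^ n) Filter.atTop (nhds 0) := by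
    simpa using (tendsto_pow_atTop_nhds_zero_of_lt_one (by positivity)
      ((div_lt_one hρ0).2 hρb)).const_mul E
  obtain ⟨N, hN⟩ := Filter.eventually_atTop.1 (htend.eventually (gt_mem_nhds hm))
  refine ⟨N, fun n hn u hu1 hu2 hu3 h0 => ?_⟩
  have huS : u ∈ S := by
    refine ⟨?_, hu3⟩
    rw [Complex.mem_reProdIm, Set.mem_Icc, Set.mem_Icc, ← abs_le]
    refine ⟨⟨hu1, ?_⟩, hu2⟩
    have h1 := (abs_le.1 hu3).2
    -- From δ ≤ b; this yields Re u ≤ 1, the right edge chosen for the compact set.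
    have h2 : Real.exp u.re ≤ 2 := by
      by_contra! h3
      nlinarith [mul_lt_mul_of_pos_left h3 hb, h.δ_le]
    linarith [Real.add_one_le_exp u.re]
  have h1 := hle n _ (hpt u huS).2
  rw [h0, zero_div, zero_sub, norm_neg, RCLike.norm_conj] at h1
  linarith [hlow u huS, hN n hn]

end CriticalChart

/-! ### Tools for the count: fixed points, phases, multiplicities -/

/-- A contraction argument for `n u = y + Λ(u)`. -/
theorem exists_unique_solution {S : Set ℂ} {Λ : ℂ → ℂ} {L r : ℝ} {n : ℕ} (hn : 0 < n) (y : ℂ)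
    (hr0 : 0 ≤ r) (hL0 : 0 ≤ L) (hL : L < n) (hball : Metric.closedBall (y / n) (r / n) ⊆ S)
    (hr : ∀ u ∈ S, ‖Λ u‖ ≤ r)
    (hlip : ∀ u ∈ S, ∀ v ∈ S, ‖Λ u - Λ v‖ ≤ L * ‖u - v‖) :
    ∃ u ∈ S, n * u = y + Λ u ∧ ∀ v ∈ S, n * v = y + Λ v → v = u := by
  have hn' : (0 : ℝ) < n := by exact_mod_cast hn
  have hnc : (n : ℂ) ≠ 0 := by exact_mod_cast hn.ne'
  set T : ℂ → ℂ := fun u => (y + Λ u) / n with hT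
  set B := Metric.closedBall (y / n) (r / n) with hB
  have hmaps : Set.MapsTo T B B := by
    intro u hu
    rw [hB, Metric.mem_closedBall, dist_eq_norm, hT]
    have : (y + Λ u) / n - y / n = Λ u / n := by ring
    rw [this, norm_div, Complex.norm_natCast]
    exact div_le_div_of_nonneg_right (hr u (hball hu)) hn'.le
  have hTlip : ∀ u ∈ S, ∀ v ∈ S, ‖T u - T v‖ ≤ L / n * ‖u - v‖ := by
    intro u hu v hv
    have : T u - T v = (Λ u - Λ v) / n := by rw [hT]; ring
    rw [this, norm_div, Complex.norm_natCast, div_mul_eq_mul_div]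
    exact div_le_div_of_nonneg_right (hlip u hu v hv) hn'.le
  have huniq : ∀ u ∈ S, ∀ v ∈ S, n * u = y + Λ u → n * v = y + Λ v → v = u := by
    intro u hu v hv h1 h2
    have h3 : (n : ℂ) * (v - u) = Λ v - Λ u := by linear_combination h2 - h1
    have h4 := hlip v hv u hu
    rw [← h3, norm_mul, Complex.norm_natCast] at h4
    have h5 : ‖v - u‖ ≤ 0 := by
      by_contra! h6
      nlinarith [mul_lt_mul_of_pos_right hL h6]
    exact sub_eq_zero.1 (norm_le_zero_iff.1 h5)
  have hK : (L / n).toNNReal < 1 := by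
    rw [← NNReal.coe_lt_coe, Real.coe_toNNReal _ (by positivity)]
    exact (div_lt_one hn').2 hL
  have hcontr : ContractingWith (L / n).toNNReal (hmaps.restrict T B B) := by
    refine ⟨hK, LipschitzWith.of_dist_le_mul fun u v => ?_⟩
    rw [Real.coe_toNNReal _ (by positivity), Subtype.dist_eq, Subtype.dist_eq, dist_eq_norm,
      dist_eq_norm]
    exact hTlip u (hball u.2) v (hball v.2)
  obtain ⟨u, huB, hu, -⟩ := hcontr.exists_fixedPoint' Metric.isClosed_closedBall.isComplete hmaps
    (Metric.mem_closedBall_self (div_nonneg hr0 hn'.le)) (edist_ne_top _ _)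
  have hu' : n * u = y + Λ u := by
    have h1 : (y + Λ u) / n = u := hu
    rw [← h1, mul_div_cancel₀ _ hnc, h1]
  exact ⟨u, hball huB, hu', fun v hv h2 => huniq u (hball huB) v hv hu' h2⟩

theorem slotPhase_mem (G z₀ : ℂ) (n : ℕ) :
    0 ≤ slotPhase G z₀ n ∧ slotPhase G z₀ n < 2 * Real.pi := by
  have := toIcoMod_mem_Ico Real.two_pi_pos 0 (Complex.arg (G / z₀ ^ n))
  rw [zero_add] at this
  exact this

theorem exp_slotPhase {G z₀ : ℂ} (hG : G ≠ 0) (hz₀ : ‖z₀‖ = 1) (n : ℕ) (l : ℤ) :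
    Complex.exp (Real.log ‖G‖ + (slotPhase G z₀ n + 2 * Real.pi * l) * Complex.I) =
      G / z₀ ^ n := by
  have h1 := toIcoMod_add_toIcoDiv_zsmul Real.two_pi_pos 0 (Complex.arg (G / z₀ ^ n))
  set k := toIcoDiv Real.two_pi_pos 0 (Complex.arg (G / z₀ ^ n))
  have h2 : slotPhase G z₀ n = Complex.arg (G / z₀ ^ n) - k * (2 * Real.pi) := by
    rw [slotPhase, ← zsmul_eq_mul]; linarith
  have h3 : ‖G / z₀ ^ n‖ = ‖G‖ := by rw [norm_div, norm_pow, hz₀, one_pow, div_one]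
  have h4 : (Real.log ‖G‖ : ℂ) + (slotPhase G z₀ n + 2 * Real.pi * l) * Complex.I =
      Real.log ‖G‖ + Complex.arg (G / z₀ ^ n) * Complex.I +
        ((l - k : ℤ) : ℂ) * (2 * Real.pi * Complex.I) := by
    rw [h2]; push_cast; ring
  rw [h4, Complex.exp_add, Complex.exp_int_mul_two_pi_mul_I, mul_one, Complex.exp_add,
    ← Complex.ofReal_exp, Real.exp_log (norm_pos_iff.2 hG), ← h3,
    Complex.norm_mul_exp_arg_mul_I]

/-- Simplicity and injectivity make both multisets duplicate-free, so equality as sets suffices. -/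
theorem zerosIn_eq_map {P : ℂ[X]} (hP : P ≠ 0) {S : Set ℂ} {f : ℤ → ℂ} {s : Finset ℤ}
    (hinj : Set.InjOn f s) (hmem : ∀ z, z ∈ S ∧ P.eval z = 0 ↔ ∃ l ∈ s, f l = z)
    (hsimple : ∀ z ∈ S, P.eval z = 0 → P.derivative.eval z ≠ 0) :
    zerosIn P S = s.val.map f := by
  classical
  refine (Multiset.Nodup.ext ?_ ?_).2 fun z => ?_
  · unfold zerosIn
    rw [Multiset.nodup_iff_count_le_one]
    intro z
    rw [Multiset.count_filter]
    split_ifs with hz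
    · rw [count_roots]
      by_contra! hlt
      have := (one_lt_rootMultiplicity_iff_isRoot hP).1 hlt
      exact hsimple z hz this.1 this.2
    · exact zero_le_one
  · exact s.nodup.map_on fun x hx y hy hxy => hinj hx hy hxy
  · unfold zerosIn
    rw [Multiset.mem_filter, mem_roots hP, Multiset.mem_map, IsRoot.def, and_comm, hmem]
    rfl

/-- The logarithm `log |G| + i (ψ + 2πℓ)` of `z₀⁻ⁿ G`. -/
noncomputable def slotLog (G z₀ : ℂ) (n : ℕ) (l : ℤ) : ℂ :=
  Real.log ‖G‖ + (slotPhase G z₀ n + 2 * Real.pi * l) * Complex.I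

theorem slotLog_re (G z₀ : ℂ) (n : ℕ) (l : ℤ) : (slotLog G z₀ n l).re = Real.log ‖G‖ := by
  simp [slotLog]

theorem slotLog_im (G z₀ : ℂ) (n : ℕ) (l : ℤ) :
    (slotLog G z₀ n l).im = slotPhase G z₀ n + 2 * Real.pi * l := by
  simp [slotLog]

theorem IsAdmissibleSlot.of_mem_Icc {δ : ℝ} {n : ℕ} {j₁ j₂ l : ℤ} (h₁ : IsAdmissibleSlot δ n j₁)
    (h₂ : IsAdmissibleSlot δ n j₂) (hl : l ∈ Finset.Icc j₁ j₂) : IsAdmissibleSlot δ n l := by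
  obtain ⟨h3, h4⟩ := Finset.mem_Icc.1 hl
  have h5 : |(l : ℝ)| ≤ max |(j₁ : ℝ)| |(j₂ : ℝ)| :=
    abs_le_max_abs_abs (by exact_mod_cast h3) (by exact_mod_cast h4)
  unfold IsAdmissibleSlot at *
  have h6 : (max |(j₁ : ℝ)| |(j₂ : ℝ)| = |(j₁ : ℝ)|) ∨ (max |(j₁ : ℝ)| |(j₂ : ℝ)| = |(j₂ : ℝ)|) :=
    max_choice _ _
  have h7 := Real.two_pi_pos
  rcases h6 with h6 | h6 <;> rw [h6] at h5 <;> nlinarith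

theorem IsAdmissibleSlot.abs_lt {δ : ℝ} {n : ℕ} {l : ℤ} (h : IsAdmissibleSlot δ n l) (hδ : 0 < δ) :
    2 * Real.pi * |(l : ℝ)| < n * δ / 2 := by
  unfold IsAdmissibleSlot at h
  linarith

theorem closedBall_div_subset_logRectangle {s t : ℝ} {n : ℕ} (hn : 0 < n) {y : ℂ}
    (h1 : (|y.re| + 3 / 4) / n ≤ s) (h2 : (|y.im| + 3 / 4) / n ≤ t) :
    Metric.closedBall (y / n) (3 / 4 / n) ⊆ logRectangle s (t) := by
  intro u hu
  have hn' : (0 : ℝ) < n := by exact_mod_cast hn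
  rw [Metric.mem_closedBall, dist_eq_norm] at hu
  have h3 := (Complex.abs_re_le_norm _).trans hu
  have h4 := (Complex.abs_im_le_norm _).trans hu
  rw [Complex.sub_re, Complex.div_natCast_re] at h3
  rw [Complex.sub_im, Complex.div_natCast_im] at h4
  have h5 := abs_sub_abs_le_abs_sub u.re (y.re / n)
  have h6 := abs_sub_abs_le_abs_sub u.im (y.im / n)
  rw [abs_div, Nat.abs_cast] at h5 h6
  rw [mem_logRectangle]
  rw [add_div] at h1 h2
  exact ⟨by linarith, by linarith⟩

/-! ### One zero in each slot, in the logarithmic coordinate -/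

namespace CriticalChart

variable {μ : Measure Circle} {b Θ : ℝ} {c : ℂ} {A Δ₂ : ℝ} {F : ℂ → ℂ} {κ : ℝ} {z₀ : ℂ} {δ s : ℝ}

theorem norm_point (h : CriticalChart μ b Θ c A Δ₂ F κ z₀ δ s) (u : ℂ) :
    ‖b * z₀ * Complex.exp u‖ = b * Real.exp u.re :=
  norm_mul_exp h.b_pos h.norm_base u

/-- The angular width is at most 1/2 < π, so the principal argument does not wrap. -/
theorem arg_point (h : CriticalChart μ b Θ c A Δ₂ F κ z₀ δ s) {u : ℂ}
    (hu : |u.im| ≤ angularWidth b δ) : Complex.arg (b * z₀ * Complex.exp u / z₀) = u.im := by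
  have h1 : b * z₀ * Complex.exp u / z₀ = b * Complex.exp u := by
    field_simp [h.base_ne_zero]
  have h2 := abs_le.1 (hu.trans h.angularWidth_le)
  have h3 := Real.pi_gt_three
  rw [h1, Complex.arg_real_mul _ h.b_pos, Complex.arg_exp, toIocMod_eq_self]
  constructor <;> linarith

/-- A point of the plane off the origin in the logarithmic coordinate. -/
theorem exists_point (h : CriticalChart μ b Θ c A Δ₂ F κ z₀ δ s) {z : ℂ} (hz : z ≠ 0) :
    ∃ u : ℂ, b * z₀ * Complex.exp u = z ∧ u.im = Complex.arg (z / z₀) := by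
  have hb : (b : ℂ) ≠ 0 := by exact_mod_cast h.b_pos.ne'
  have hz₀ := h.base_ne_zero
  refine ⟨Complex.log (z / (b * z₀)), ?_, ?_⟩
  · rw [Complex.exp_log (by positivity)]
    field_simp
  · have h1 : z / z₀ = b * (z / (b * z₀)) := by field_simp
    rw [Complex.log_im, h1, Complex.arg_real_mul _ h.b_pos]

/-- In order: contraction; conversion of an error Θⁿ into 1/n; zeros inside the rectangle; zeros
inside the radial range, through |eˣ − 1| ≤ 2|x|; and room for all slots, where 3π covers the phase
ψₙ < 2π plus half a slot. -/
theorem eventually_large (h : CriticalChart μ b Θ c A Δ₂ F κ z₀ δ s) (L B : ℝ) :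
    ∃ N : ℕ, ∀ n ≥ N, 0 < n ∧ L < n ∧ n * Θ ^ n ≤ 1 ∧ B / n ≤ s / 2 ∧
      B / n < δ / (4 * b) ∧ 3 * Real.pi / n + δ / 2 ≤ angularWidth b δ := by
  have hΘ0 := h.geometric.rate_pos
  have h1 : ∀ᶠ n : ℕ in Filter.atTop, L < n := tendsto_natCast_atTop_atTop.eventually_gt_atTop L
  have h2 : ∀ᶠ n : ℕ in Filter.atTop, (n : ℝ) * Θ ^ n ≤ 1 :=
    (tendsto_self_mul_const_pow_of_lt_one hΘ0.le h.geometric.rate_lt).eventually_le_const one_pos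
  have hdiv : ∀ x : ℝ, Filter.Tendsto (fun n : ℕ => x / n) Filter.atTop (nhds 0) :=
    tendsto_const_div_atTop_nhds_zero_nat
  have h3 := (hdiv B).eventually_le_const (half_pos h.s_pos)
  have h4 := (hdiv B).eventually_lt_const (show 0 < δ / (4 * b) from
    div_pos h.δ_pos (mul_pos four_pos h.b_pos))
  have h5 := (hdiv (3 * Real.pi)).eventually_le_const (sub_pos.2 h.lt_angularWidth)
  obtain ⟨N, hN⟩ := Filter.eventually_atTop.1
    ((Filter.eventually_gt_atTop 0).and (h1.and (h2.and (h3.and (h4.and h5)))))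
  refine ⟨N, fun n hn => ?_⟩
  obtain ⟨g0, g1, g2, g3, g4, g5⟩ := hN n hn
  exact ⟨g0, g1, g2, g3, g4, by linarith⟩

/-- In the logarithmic coordinate: the zeros of `Φₙ` are simple, one for each slot. -/
theorem exists_solutions [IsFiniteMeasure μ] (h : CriticalChart μ b Θ c A Δ₂ F κ z₀ δ s) :
    ∃ E : ℝ, 0 ≤ E ∧ ∃ N : ℕ, ∀ n ≥ N, 0 < n ∧
      (|Real.log ‖ratioG b c F (b * z₀)‖| + 1) / n < δ / (4 * b) ∧
      (|Real.log ‖ratioG b c F (b * z₀)‖| + 1) / n ≤ s / 2 ∧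
      ∃ v : ℤ → ℂ,
      (∀ l : ℤ, IsAdmissibleSlot δ n l → |(v l).im| ≤ angularWidth b δ ∧
        ‖n * v l - slotLog (ratioG b c F (b * z₀)) z₀ n l‖ ≤ 3 / 4 ∧
        ‖n * v l - slotLog (ratioG b c F (b * z₀)) z₀ n l -
          Complex.log (ratioG b c F (b * z₀ * Complex.exp (v l)) / ratioG b c F (b * z₀))‖
          ≤ E / n ∧
        (monicOPUC μ n).eval (b * z₀ * Complex.exp (v l)) = 0 ∧
        (monicOPUC μ n).derivative.eval (b * z₀ * Complex.exp (v l)) ≠ 0) ∧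
      ∀ j₁ j₂ : ℤ, IsAdmissibleSlot δ n j₁ → IsAdmissibleSlot δ n j₂ →
        ∀ z ∈ sectorAnnulus b δ (slotPhase (ratioG b c F (b * z₀)) z₀ n) z₀ n j₁ j₂,
          (monicOPUC μ n).eval z = 0 →
            ∃ l ∈ Finset.Icc j₁ j₂, b * z₀ * Complex.exp (v l) = z := by
  obtain ⟨L, E, N₀, hL, hE, hlog⟩ := h.exists_log
  obtain ⟨N₁, hin⟩ := h.eval_ne_zero_inner
  obtain ⟨N₂, hout⟩ := h.eval_ne_zero_outer
  set G := ratioG b c F (b * z₀) with hG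
  obtain ⟨N₃, hlarge⟩ := h.eventually_large L (|Real.log ‖G‖| + 1)
  have hb := h.b_pos
  have hδ := h.δ_pos
  have hpi := Real.pi_gt_three
  refine ⟨E, hE, max (max N₀ N₁) (max N₂ N₃), fun n hn => ?_⟩
  simp only [ge_iff_le, max_le_iff] at hn
  obtain ⟨hn0, hnL, hnΘ, hnre, hnb, hnim⟩ := hlarge n hn.2.2
  obtain ⟨Λ, hΛ⟩ := hlog n hn.1.1
  have hn' : (0 : ℝ) < n := by exact_mod_cast hn0
  have hψ := slotPhase_mem G z₀ n
  have hball : ∀ l, IsAdmissibleSlot δ n l → Metric.closedBall (slotLog G z₀ n l / n) (3 / 4 / n) ⊆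
      logRectangle (s / 2) (angularWidth b δ) := by
    intro l hl
    refine closedBall_div_subset_logRectangle hn0 ?_ ?_
    · rw [slotLog_re]
      exact le_trans (by gcongr; norm_num) hnre
    · rw [slotLog_im]
      refine le_trans ?_ hnim
      have h1 := abs_add_le (slotPhase G z₀ n) (2 * Real.pi * l)
      rw [abs_of_nonneg hψ.1, abs_mul, abs_of_pos Real.two_pi_pos] at h1
      have h2 := hl.abs_lt hδ
      rw [div_le_iff₀ hn', add_mul, div_mul_cancel₀ _ hn'.ne']
      linarith
  have hsol : ∀ l, IsAdmissibleSlot δ n l → ∃ u ∈ logRectangle (s / 2) (angularWidth b δ),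
      n * u = slotLog G z₀ n l + Λ u ∧ ∀ v ∈ logRectangle (s / 2) (angularWidth b δ),
        n * v = slotLog G z₀ n l + Λ v → v = u := fun l hl =>
    exists_unique_solution hn0 _ (by norm_num) hL hnL (hball l hl) (fun u hu => (hΛ u hu).1)
      fun u hu => (hΛ u hu).2.1
  -- The integer ℓ enters as the 2πi ambiguity of the logarithm in the zero equation.
  have hiff : ∀ u ∈ logRectangle (s / 2) (angularWidth b δ),
      (monicOPUC μ n).eval (b * z₀ * Complex.exp u) = 0 ↔ ∃ l : ℤ, n * u = slotLog G z₀ n l + Λ u := by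
    intro u hu
    rw [(hΛ u hu).2.2.1, ← exp_slotPhase h.ratioG_ne_zero h.norm_base n 0, ← Complex.exp_add,
      Complex.exp_eq_exp_iff_exists_int]
    refine exists_congr fun l => ?_
    simp only [slotLog, ← hG]
    push_cast
    constructor <;> intro hl <;> linear_combination hl
  choose! v hvmem hveq hvuniq using hsol
  refine ⟨hn0, hnb, hnre, v, fun l hl => ?_, fun j₁ j₂ hj₁ hj₂ z hz hz0 => ?_⟩
  · have h1 : n * v l - slotLog G z₀ n l = Λ (v l) := by rw [hveq l hl]; ring
    have h2 := (hiff _ (hvmem l hl)).2 ⟨l, hveq l hl⟩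
    obtain ⟨h3, -, -, h4, h5⟩ := hΛ _ (hvmem l hl)
    refine ⟨(mem_logRectangle.1 (hvmem l hl)).2, h1 ▸ h3, ?_, h2, h4 h2⟩
    rw [h1]
    refine h5.trans ?_
    rw [le_div_iff₀ hn', mul_assoc, mul_comm _ (n : ℝ)]
    exact mul_le_of_le_one_right hE hnΘ
  · obtain ⟨hz1, hz2, hz3⟩ := hz
    have hzb : |‖z‖ - b| < δ / 2 := by
      have h1 : ‖z‖ / b - 1 = (‖z‖ - b) / b := by field_simp
      rw [h1, abs_div, abs_of_pos hb, div_lt_div_iff₀ hb (by positivity)] at hz1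
      nlinarith
    have hzne : z ≠ 0 := by
      rintro rfl
      rw [norm_zero, zero_sub, abs_neg, abs_of_pos hb] at hzb
      linarith [h.δ_le]
    obtain ⟨u, rfl, hu⟩ := h.exists_point hzne
    rw [← hu] at hz2 hz3
    rw [h.norm_point] at hzb
    have hscale : ∀ j : ℤ, slotPhase G z₀ n / n + 2 * Real.pi * j / n =
        (slotPhase G z₀ n + 2 * Real.pi * j) / n := fun j => by ring
    rw [hscale, ← sub_div, div_lt_iff₀ hn'] at hz2
    rw [hscale, ← add_div, lt_div_iff₀ hn'] at hz3
    have him : |u.im| ≤ angularWidth b δ := by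
      refine le_trans ?_ hnim
      have h1 := hj₁.abs_lt hδ
      have h2 := hj₂.abs_lt hδ
      have h3 := mul_le_mul_of_nonneg_left (neg_abs_le (j₁ : ℝ)) Real.two_pi_pos.le
      have h4 := mul_le_mul_of_nonneg_left (le_abs_self (j₂ : ℝ)) Real.two_pi_pos.le
      rw [← sub_le_iff_le_add, le_div_iff₀ hn', sub_mul, ← abs_of_pos hn', ← abs_mul, abs_of_pos hn']
      suffices |u.im * n| ≤ 3 * Real.pi + n * δ / 2 by linarith
      rw [abs_le]
      constructor <;> linarith
    -- The zero-free regions confine a zero of the sector to the rectangle where Λ is defined.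
    have hre : |u.re| ≤ s / 2 := by
      by_contra! hlt
      rcases lt_abs.1 hlt with h1 | h1
      · exact hout n hn.2.1 u h1.le him hzb.le hz0
      · refine hin n hn.1.2 _ ?_ hz0
        rw [h.norm_point]
        gcongr
        linarith
    have hmem := mem_logRectangle.2 ⟨hre, him⟩
    obtain ⟨l, hl⟩ := (hiff u hmem).1 hz0
    have h1 := (Complex.abs_im_le_norm (Λ u)).trans (hΛ u hmem).1
    have h2 : u.im * n = slotPhase G z₀ n + 2 * Real.pi * l + (Λ u).im := by
      have := congrArg Complex.im hl
      rw [Complex.add_im, slotLog_im, ← Complex.ofReal_natCast, Complex.im_ofReal_mul] at this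
      rw [mul_comm, this]
    obtain ⟨h3, h4⟩ := abs_le.1 h1
    -- The sector allows half a slot, π, beyond the extreme centres, and Λ moves n·Im u by at most
    -- 3/4. As π + 3/4 < 2π, no index outside the range can occur.
    have hlmem : l ∈ Finset.Icc j₁ j₂ := by
      rw [Finset.mem_Icc]
      constructor
      · have : (j₁ : ℝ) < l + 1 := by
          by_contra! h5
          nlinarith
        exact Int.lt_add_one_iff.1 (by exact_mod_cast this)
      · have : (l : ℝ) < j₂ + 1 := by
          by_contra! h5
          nlinarith
        exact Int.lt_add_one_iff.1 (by exact_mod_cast this)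
    exact ⟨l, hlmem, by rw [← hvuniq l (hj₁.of_mem_Icc hj₂ hlmem) u hmem hl]⟩

end CriticalChart

/-! ### Back to modulus and argument -/

namespace CriticalChart

variable {μ : Measure Circle} {b Θ : ℝ} {c : ℂ} {A Δ₂ : ℝ} {F : ℂ → ℂ} {κ : ℝ} {z₀ : ℂ} {δ s : ℝ}

theorem norm_div_point (h : CriticalChart μ b Θ c A Δ₂ F κ z₀ δ s) (u : ℂ) :
    ‖b * z₀ * Complex.exp u‖ / b = Real.exp u.re := by
  rw [h.norm_point, mul_div_cancel_left₀ _ h.b_pos.ne']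

theorem mul_abs_re_le {n : ℕ} {u G z₀ : ℂ} {l : ℤ} (hu : ‖n * u - slotLog G z₀ n l‖ ≤ 3 / 4) :
    n * |u.re| ≤ |Real.log ‖G‖| + 1 := by
  have h1 := (Complex.abs_re_le_norm _).trans hu
  rw [Complex.sub_re, slotLog_re, ← Complex.ofReal_natCast, Complex.re_ofReal_mul] at h1
  have h2 := abs_sub_abs_le_abs_sub (n * u.re) (Real.log ‖G‖)
  rw [abs_mul, Nat.abs_cast] at h2
  linarith

theorem abs_mul_im_sub_le {n : ℕ} {u G z₀ : ℂ} {l : ℤ}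
    (hu : ‖n * u - slotLog G z₀ n l‖ ≤ 3 / 4) :
    |n * u.im - (slotPhase G z₀ n + 2 * Real.pi * l)| ≤ 3 / 4 := by
  have h1 := (Complex.abs_im_le_norm _).trans hu
  rwa [Complex.sub_im, slotLog_im, ← Complex.ofReal_natCast, Complex.im_ofReal_mul] at h1

/-- With ℓ bounded, u = O(1/n); this is what removes the O(δ/n) term in (c). -/
theorem norm_le_div {n : ℕ} (hn : 0 < n) {u G z₀ : ℂ} {l : ℤ}
    (hu : ‖n * u - slotLog G z₀ n l‖ ≤ 3 / 4) :
    ‖u‖ ≤ (|Real.log ‖G‖| + 1 + 3 * Real.pi) * (1 + |(l : ℝ)|) / n := by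
  have hn' : (0 : ℝ) < n := by exact_mod_cast hn
  have h1 := mul_abs_re_le hu
  have h2 := abs_mul_im_sub_le hu
  have h3 := abs_sub_abs_le_abs_sub (n * u.im) (slotPhase G z₀ n + 2 * Real.pi * l)
  have h4 := abs_add_le (slotPhase G z₀ n) (2 * Real.pi * l)
  have hψ := slotPhase_mem G z₀ n
  rw [abs_of_nonneg hψ.1, abs_mul (2 * Real.pi), abs_of_pos Real.two_pi_pos] at h4
  rw [abs_mul, Nat.abs_cast] at h3
  have h5 := mul_le_mul_of_nonneg_right (Complex.norm_le_abs_re_add_abs_im u) hn'.le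
  have h6 : 0 ≤ (|Real.log ‖G‖| + 1) * |(l : ℝ)| := by positivity
  rw [le_div_iff₀ hn']
  have h7 := Real.pi_gt_three
  have h8 : 0 ≤ Real.pi * |(l : ℝ)| := by positivity
  linarith

theorem mem_sectorAnnulus (h : CriticalChart μ b Θ c A Δ₂ F κ z₀ δ s) {n : ℕ} (hn : 0 < n)
    {u G : ℂ} {l : ℤ} (hB : (|Real.log ‖G‖| + 1) / n < δ / (4 * b))
    (hs : (|Real.log ‖G‖| + 1) / n ≤ s / 2) (him : |u.im| ≤ angularWidth b δ)
    (hu : ‖n * u - slotLog G z₀ n l‖ ≤ 3 / 4) :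
    b * z₀ * Complex.exp u ∈ sectorAnnulus b δ (slotPhase G z₀ n) z₀ n l l := by
  have hn' : (0 : ℝ) < n := by exact_mod_cast hn
  have hb := h.b_pos
  have hpi := Real.pi_gt_three
  have h1 : |u.re| ≤ (|Real.log ‖G‖| + 1) / n := by
    rw [le_div_iff₀ hn', mul_comm]
    exact mul_abs_re_le hu
  have h2 : |u.re| ≤ 1 := by
    linarith [h.s_le, h.δ_le, h.geometric.b_lt]
  obtain ⟨h3, h4⟩ := abs_le.1 (abs_mul_im_sub_le hu)
  refine ⟨?_, ?_, ?_⟩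
  · rw [h.norm_div_point]
    refine (Real.abs_exp_sub_one_le h2).trans_lt ?_
    have h5 : δ / (2 * b) = 2 * (δ / (4 * b)) := by field_simp; ring
    linarith
  · rw [h.arg_point him, ← add_div, ← sub_div, div_lt_iff₀ hn']
    linarith
  · rw [h.arg_point him, ← add_div, ← add_div, lt_div_iff₀ hn']
    linarith

/-- Modulus and argument of a zero, in terms of `λ = log (g(z) / g(b z₀))`. -/
theorem abs_sub_le_of_log (h : CriticalChart μ b Θ c A Δ₂ F κ z₀ δ s) {n : ℕ} (hn : 0 < n)
    {u : ℂ} {l : ℤ} {E : ℝ} (him : |u.im| ≤ angularWidth b δ)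
    (hs : (|Real.log ‖ratioG b c F (b * z₀)‖| + 1) / n ≤ s / 2)
    (hG : ratioG b c F (b * z₀ * Complex.exp u) ≠ 0)
    (hu : ‖n * u - slotLog (ratioG b c F (b * z₀)) z₀ n l‖ ≤ 3 / 4)
    (hE : ‖n * u - slotLog (ratioG b c F (b * z₀)) z₀ n l -
      Complex.log (ratioG b c F (b * z₀ * Complex.exp u) / ratioG b c F (b * z₀))‖ ≤ E / n) :
    |‖b * z₀ * Complex.exp u‖ / b -
        (1 + Real.log ‖ratioG b c F (b * z₀ * Complex.exp u)‖ / n)| ≤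
      ((|Real.log ‖ratioG b c F (b * z₀)‖| + 1) ^ 2 + E) / (n : ℝ) ^ 2 ∧
    |Complex.arg (b * z₀ * Complex.exp u / z₀) - ((slotPhase (ratioG b c F (b * z₀)) z₀ n +
        Complex.arg (ratioG b c F (b * z₀ * Complex.exp u) / ratioG b c F (b * z₀))) / n +
          2 * Real.pi * l / n)| ≤
      ((|Real.log ‖ratioG b c F (b * z₀)‖| + 1) ^ 2 + E) / (n : ℝ) ^ 2 := by
  set G := ratioG b c F (b * z₀)
  set Gz := ratioG b c F (b * z₀ * Complex.exp u)
  have hn' : (0 : ℝ) < n := by exact_mod_cast hn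
  have hG0 : G ≠ 0 := h.ratioG_ne_zero
  have h1 : |u.re| ≤ (|Real.log ‖G‖| + 1) / n := by
    rw [le_div_iff₀ hn', mul_comm]
    exact mul_abs_re_le hu
  have h2 : |u.re| ≤ 1 := by
    linarith [h.s_le, h.δ_le, h.geometric.b_lt]
  have h3 := (Complex.abs_re_le_norm _).trans hE
  have h4 := (Complex.abs_im_le_norm _).trans hE
  rw [Complex.sub_re, Complex.sub_re, slotLog_re, Complex.log_re, norm_div,
    Real.log_div (norm_ne_zero_iff.2 hG) (norm_ne_zero_iff.2 hG0), ← Complex.ofReal_natCast,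
    Complex.re_ofReal_mul] at h3
  rw [Complex.sub_im, Complex.sub_im, slotLog_im, Complex.log_im, ← Complex.ofReal_natCast,
    Complex.im_ofReal_mul] at h4
  have hE2 : E / n / n = E / (n : ℝ) ^ 2 := by rw [div_div, sq]
  rw [h.norm_div_point, h.arg_point him, add_div _ E]
  constructor
  · have h5 := Real.abs_exp_sub_one_sub_id_le h2
    have h6 : u.re ^ 2 ≤ (|Real.log ‖G‖| + 1) ^ 2 / (n : ℝ) ^ 2 := by
      rw [← div_pow, ← sq_abs]
      gcongr
    have h7 : |u.re - Real.log ‖Gz‖ / n| ≤ E / (n : ℝ) ^ 2 := by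
      have : u.re - Real.log ‖Gz‖ / n =
          (n * u.re - Real.log ‖G‖ - (Real.log ‖Gz‖ - Real.log ‖G‖)) / n := by
        field_simp; ring
      rw [this, abs_div, Nat.abs_cast, ← hE2]
      gcongr
    have h8 : Real.exp u.re - (1 + Real.log ‖Gz‖ / n) =
      (Real.exp u.re - 1 - u.re) + (u.re - Real.log ‖Gz‖ / n) := by ring
    rw [h8]
    exact (abs_add_le _ _).trans (add_le_add (h5.trans h6) h7)
  · refine le_add_of_nonneg_of_le (by positivity) ?_
    have : u.im - ((slotPhase G z₀ n + Complex.arg (Gz / G)) / n + 2 * Real.pi * l / n) =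
        (n * u.im - (slotPhase G z₀ n + 2 * Real.pi * l) - Complex.arg (Gz / G)) / n := by
      field_simp; ring
    rw [this, abs_div, Nat.abs_cast, ← hE2]
    gcongr

end CriticalChart

/-- Replacing `g(z)` by `g(b z₀)` costs `|log (g(z) / g(b z₀))| / n`. -/
theorem abs_sub_log_div_le {G G' : ℂ} (hG : G ≠ 0) (hG' : G' ≠ 0) {n : ℕ} {x X : ℝ}
    (hx : |x - (1 + Real.log ‖G'‖ / n)| ≤ X) :
    |x - (1 + Real.log ‖G‖ / n)| ≤ ‖Complex.log (G' / G)‖ / n + X := by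
  have h1 := Complex.abs_re_le_norm (Complex.log (G' / G))
  rw [Complex.log_re, norm_div,
    Real.log_div (norm_ne_zero_iff.2 hG') (norm_ne_zero_iff.2 hG)] at h1
  have h2 : x - (1 + Real.log ‖G‖ / n) =
      (Real.log ‖G'‖ - Real.log ‖G‖) / n + (x - (1 + Real.log ‖G'‖ / n)) := by ring
  rw [h2]
  refine (abs_add_le _ _).trans (add_le_add ?_ hx)
  rw [abs_div, Nat.abs_cast]
  gcongr

theorem abs_sub_arg_div_le {G G' : ℂ} {n : ℕ} {x ψ y X : ℝ}
    (hx : |x - ((ψ + Complex.arg (G' / G)) / n + y)| ≤ X) :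
    |x - (ψ / n + y)| ≤ ‖Complex.log (G' / G)‖ / n + X := by
  have h1 := Complex.abs_im_le_norm (Complex.log (G' / G))
  rw [Complex.log_im] at h1
  have h2 : x - (ψ / n + y) =
      Complex.arg (G' / G) / n + (x - ((ψ + Complex.arg (G' / G)) / n + y)) := by ring
  rw [h2]
  refine (abs_add_le _ _).trans (add_le_add ?_ hx)
  rw [abs_div, Nat.abs_cast]
  gcongr

theorem zerosIn_C_mul {a : ℂ} (ha : a ≠ 0) (P : ℂ[X]) (S : Set ℂ) :
    zerosIn (C a * P) S = zerosIn P S := by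
  rw [zerosIn, zerosIn, roots_C_mul P ha]

namespace CriticalChart

variable {μ : Measure Circle} {b Θ : ℝ} {c : ℂ} {A Δ₂ : ℝ} {F : ℂ → ℂ} {κ : ℝ} {z₀ : ℂ} {δ s : ℝ}

/-- The zeros of `φₙ` near `b z₀`, slot by slot. -/
theorem exists_zeros [IsFiniteMeasure μ] (h : CriticalChart μ b Θ c A Δ₂ F κ z₀ δ s) {K : ℝ}
    (hK0 : 0 ≤ K) (hK : ∀ z : ℂ, ‖z - b * z₀‖ < δ →
      ‖Complex.log (ratioG b c F z / ratioG b c F (b * z₀))‖ ≤ K * ‖z - b * z₀‖) :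
    ∃ (K' : ℝ) (N : ℕ), ∀ n ≥ N, ∃ z : ℤ → ℂ,
      (∀ j₁ j₂ : ℤ, IsAdmissibleSlot δ n j₁ → IsAdmissibleSlot δ n j₂ →
        zerosIn (orthonormalOPUC μ n) (sectorAnnulus b δ
            (slotPhase (ratioG b c F (b * z₀)) z₀ n) z₀ n j₁ j₂)
          = (Finset.Icc j₁ j₂).val.map z) ∧
      ∀ l : ℤ, IsAdmissibleSlot δ n l →
        z l ∈ sectorAnnulus b δ (slotPhase (ratioG b c F (b * z₀)) z₀ n) z₀ n l l ∧
        |‖z l‖ / b - (1 + Real.log ‖ratioG b c F (z l)‖ / n)| ≤ K' / (n : ℝ) ^ 2 ∧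
        |Complex.arg (z l / z₀) - ((slotPhase (ratioG b c F (b * z₀)) z₀ n +
            Complex.arg (ratioG b c F (z l) / ratioG b c F (b * z₀))) / n +
              2 * Real.pi * l / n)| ≤ K' / (n : ℝ) ^ 2 ∧
        ∀ X : ℝ, X = K * δ ∨ X = K' * (1 + |(l : ℝ)|) / n →
          |‖z l‖ / b - (1 + Real.log ‖ratioG b c F (b * z₀)‖ / n)| ≤
            X / n + K' / (n : ℝ) ^ 2 ∧
          |Complex.arg (z l / z₀) -
            (slotPhase (ratioG b c F (b * z₀)) z₀ n / n + 2 * Real.pi * l / n)| ≤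
            X / n + K' / (n : ℝ) ^ 2 := by
  obtain ⟨E, hE, N, hN⟩ := h.exists_solutions
  set G := ratioG b c F (b * z₀) with hGdef
  set B := |Real.log ‖G‖| + 1 with hB
  have hb := h.b_pos
  have hpi := Real.pi_gt_three
  -- B² comes from eˣ − 1 − x with |x| ≤ B/n, E from Λ − log(g/g(bz₀)), and the last term from the
  -- Lipschitz bound at distance at most 2b|u|.
  refine ⟨B ^ 2 + E + 2 * K * b * (B + 3 * Real.pi), N, fun n hn => ?_⟩
  obtain ⟨hn0, hnb, hns, v, hv, hconv⟩ := hN n hn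
  have hn' : (0 : ℝ) < n := by exact_mod_cast hn0
  have hmem : ∀ l, IsAdmissibleSlot δ n l → b * z₀ * Complex.exp (v l) ∈
      sectorAnnulus b δ (slotPhase G z₀ n) z₀ n l l := fun l hl =>
    h.mem_sectorAnnulus hn0 hnb hns (hv l hl).1 (hv l hl).2.1
  refine ⟨fun l => b * z₀ * Complex.exp (v l), fun j₁ j₂ hj₁ hj₂ => ?_, fun l hl => ?_⟩
  · rw [orthonormalOPUC, zerosIn_C_mul (inv_ne_zero (by
      exact_mod_cast (circleNorm_pos h.geometric.nontrivial (monicOPUC_ne_zero n)).ne'))]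
    have hadm : ∀ l ∈ Finset.Icc j₁ j₂, IsAdmissibleSlot δ n l := fun l hl =>
      hj₁.of_mem_Icc hj₂ hl
    refine zerosIn_eq_map (monicOPUC_ne_zero n) ?_ (fun z => ⟨fun hz => ?_, ?_⟩) ?_
    -- Equal points have equal n·Im u, which lies within 3/4 of both slot centres, while distinct
    -- centres are at least 2π apart.
    · intro l hl k hk hlk
      have hl' := hv l (hadm l hl)
      have hk' := hv k (hadm k hk)
      have h1 : (v l).im = (v k).im := by
        rw [← h.arg_point hl'.1, ← h.arg_point hk'.1]
        exact congrArg (fun z => Complex.arg (z / z₀)) hlk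
      obtain ⟨h2, h3⟩ := abs_le.1 (abs_mul_im_sub_le hl'.2.1)
      obtain ⟨h4, h5⟩ := abs_le.1 (abs_mul_im_sub_le hk'.2.1)
      rw [h1] at h2 h3
      have h6 : (l : ℝ) < k + 1 := by
        by_contra! h7
        nlinarith
      have h8 : (k : ℝ) < l + 1 := by
        by_contra! h7
        nlinarith
      have h9 : l < k + 1 := by exact_mod_cast h6
      have h10 : k < l + 1 := by exact_mod_cast h8
      omega
    · exact hconv j₁ j₂ hj₁ hj₂ z hz.1 hz.2
    · rintro ⟨l, hl, rfl⟩
      refine ⟨?_, (hv l (hadm l hl)).2.2.2.1⟩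
      obtain ⟨h1, h2, h3⟩ := hmem l (hadm l hl)
      obtain ⟨h4, h5⟩ := Finset.mem_Icc.1 hl
      have h4' : (j₁ : ℝ) ≤ l := by exact_mod_cast h4
      have h5' : (l : ℝ) ≤ j₂ := by exact_mod_cast h5
      refine ⟨h1, lt_of_le_of_lt ?_ h2, lt_of_lt_of_le h3 ?_⟩ <;> gcongr
    · intro z hz hz0
      obtain ⟨l, hl, rfl⟩ := hconv j₁ j₂ hj₁ hj₂ z hz hz0
      exact (hv l (hadm l hl)).2.2.2.2
  · obtain ⟨him, hu, hlog, -, -⟩ := hv l hl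
    have hre : |(v l).re| ≤ s / 2 := by
      refine le_trans ?_ hns
      rw [le_div_iff₀ hn', mul_comm]
      exact mul_abs_re_le hu
    have hdist : ‖b * z₀ * Complex.exp (v l) - b * z₀‖ < δ :=
      h.norm_sub_lt (mem_logRectangle.2 ⟨by linarith [h.s_pos], by linarith [h.s_pos]⟩)
    have hGz : ratioG b c F (b * z₀ * Complex.exp (v l)) ≠ 0 := by
      intro h0
      have h1 := (h.good.2 _ hdist).2.2.2.2
      rw [h0, zero_sub, norm_neg] at h1
      linarith [norm_nonneg (ratioG b c F (b * z₀))]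
    obtain ⟨h1, h2⟩ := h.abs_sub_le_of_log hn0 him hns hGz hu hlog
    have hle : (B ^ 2 + E) / (n : ℝ) ^ 2 ≤
        (B ^ 2 + E + 2 * K * b * (B + 3 * Real.pi)) / (n : ℝ) ^ 2 := by
      have : 0 ≤ 2 * K * b * (B + 3 * Real.pi) := by positivity
      exact div_le_div_of_nonneg_right (by linarith) (by positivity)
    have h1' := h1.trans hle
    have h2' := h2.trans hle
    refine ⟨hmem l hl, h1', h2', fun X hX => ?_⟩
    have hXle : ‖Complex.log (ratioG b c F (b * z₀ * Complex.exp (v l)) / G)‖ ≤ X := by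
      refine (hK _ hdist).trans ?_
      rcases hX with rfl | rfl
      · gcongr
      · have h3 : ‖v l‖ ≤ 1 := by
          refine (Complex.norm_le_abs_re_add_abs_im _).trans ?_
          linarith [h.s_le, h.δ_le, h.geometric.b_lt, h.angularWidth_le]
        have h4 : ‖b * z₀ * Complex.exp (v l) - b * z₀‖ ≤ b * (2 * ‖v l‖) := by
          have : b * z₀ * Complex.exp (v l) - b * z₀ = b * z₀ * (Complex.exp (v l) - 1) := by ring
          rw [this, norm_mul, norm_mul, h.norm_base, Complex.norm_real,
            Real.norm_of_nonneg hb.le, mul_one]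
          gcongr
          exact Complex.norm_exp_sub_one_le h3
        calc K * ‖b * z₀ * Complex.exp (v l) - b * z₀‖
            ≤ K * (b * (2 * ((B + 3 * Real.pi) * (1 + |(l : ℝ)|) / n))) := by
              have := norm_le_div hn0 hu
              gcongr
              refine h4.trans ?_
              gcongr
          _ = 2 * K * b * (B + 3 * Real.pi) * (1 + |(l : ℝ)|) / n := by ring
          _ ≤ _ := by
              gcongr
              exact le_add_of_nonneg_left (by positivity)
    have h5 : ‖Complex.log (ratioG b c F (b * z₀ * Complex.exp (v l)) / G)‖ / n ≤ X / n := by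
      gcongr
    exact ⟨(abs_sub_log_div_le h.ratioG_ne_zero hGz h1').trans (add_le_add_left h5 _),
      (abs_sub_arg_div_le h2').trans (add_le_add_left h5 _)⟩

end CriticalChart
-- The theorem on the zeros near a regular point
theorem theorem11p1 (μ : Measure Circle) [IsProbabilityMeasure μ]
    (hμ : IsNontrivialOnCircle μ) (b : ℝ) (hb0 : 0 < b) (hb1 : b < 1) (c : ℂ) (hc : c ≠ 0)
    (hBLS : BLSCondition μ b c) :
    (∃ Δ₂ : ℝ, 0 < Δ₂ ∧ Δ₂ < 1 ∧ ∃ F : ℂ → ℂ, IsSzegoInvContinuation μ b Δ₂ F) ∧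
    ∀ Δ₂ : ℝ, 0 < Δ₂ → Δ₂ < 1 → ∀ F : ℂ → ℂ, IsSzegoInvContinuation μ b Δ₂ F →
    ∀ z₀ : ℂ, ‖z₀‖ = 1 → IsRegularPoint b F (b * z₀) →
      ratioG b c F (b * z₀) ≠ 0 ∧
      ∃ K : ℝ, ∀ δ : ℝ, IsGoodRadius b c Δ₂ F (b * z₀) δ →
      ∃ (K' : ℝ) (N : ℕ) (z : ℕ → ℤ → ℂ),
        -- the number of zeros, and their labelling, one in each slot
        (∀ n ≥ N, ∀ j₁ j₂ : ℤ, j₁ ≤ j₂ → IsAdmissibleSlot δ n j₁ → IsAdmissibleSlot δ n j₂ →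
          ((zerosIn (orthonormalOPUC μ n) (sectorAnnulus b δ
            (slotPhase (ratioG b c F (b * z₀)) z₀ n) z₀ n j₁ j₂)).card : ℤ) = j₂ - j₁ + 1 ∧
          zerosIn (orthonormalOPUC μ n) (sectorAnnulus b δ
            (slotPhase (ratioG b c F (b * z₀)) z₀ n) z₀ n j₁ j₂)
            = (Finset.Icc j₁ j₂).val.map (z n)) ∧
        (∀ n ≥ N, ∀ l : ℤ, IsAdmissibleSlot δ n l →
          z n l ∈ sectorAnnulus b δ (slotPhase (ratioG b c F (b * z₀)) z₀ n) z₀ n l l ∧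
          -- the modulus
          |‖z n l‖ / b - (1 + Real.log ‖ratioG b c F (z n l)‖ / n)| ≤ K' / (n : ℝ) ^ 2 ∧
          |‖z n l‖ / b - (1 + Real.log ‖ratioG b c F (b * z₀)‖ / n)|
            ≤ K * δ / n + K' / (n : ℝ) ^ 2 ∧
          -- the argument
          |Complex.arg (z n l / z₀) -
            ((slotPhase (ratioG b c F (b * z₀)) z₀ n +
                Complex.arg (ratioG b c F (z n l) / ratioG b c F (b * z₀))) / n +
              2 * Real.pi * l / n)| ≤ K' / (n : ℝ) ^ 2 ∧
          |Complex.arg (z n l / z₀) -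
            (slotPhase (ratioG b c F (b * z₀)) z₀ n / n + 2 * Real.pi * l / n)|
            ≤ K * δ / n + K' / (n : ℝ) ^ 2) ∧
        -- boundedly many slots: no term of order `δ / n`
        (∀ J : ℕ, ∃ K'' : ℝ, ∀ n ≥ N, ∀ l : ℤ, IsAdmissibleSlot δ n l → |l| ≤ (J : ℤ) →
          |‖z n l‖ / b - (1 + Real.log ‖ratioG b c F (b * z₀)‖ / n)| ≤ K'' / (n : ℝ) ^ 2 ∧
          |Complex.arg (z n l / z₀) -
            (slotPhase (ratioG b c F (b * z₀)) z₀ n / n + 2 * Real.pi * l / n)|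
            ≤ K'' / (n : ℝ) ^ 2) := by
  obtain ⟨Θ, A, hgeo⟩ := hBLS.geometric hμ hb0 hb1
  obtain ⟨F₀, hF₀⟩ := hgeo.exists_continuation
  refine ⟨⟨Θ, hgeo.rate_pos, hgeo.rate_lt, F₀, hF₀⟩, fun Δ₂ hΔ hΔ1 F hF z₀ hz₀ hreg => ?_⟩
  obtain ⟨κ, hκ, hdual⟩ := hgeo.exists_continuation_eq
  obtain ⟨K, hK0, hK⟩ := hF.exists_norm_log_ratioG_le hb0 hb1 hc hΔ hΔ1 hreg
  refine ⟨hF.ratioG_ne_zero hb1 hc hreg, K, fun δ hδ => ?_⟩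
  obtain ⟨s, hs0, hs1, hs2, hs3, hs4⟩ := exists_chart_width hb0 hb1 hgeo.rate_lt hδ.1
  have h : CriticalChart μ b Θ c A Δ₂ F κ z₀ δ s :=
    ⟨hgeo, hc, hF, hΔ, hκ, hdual Δ₂ F hΔ hΔ1 hF, hz₀, hreg, hδ, hs0, hs1, hs2, hs3, hs4⟩
  obtain ⟨K', N, hN⟩ := h.exists_zeros hK0 (hK δ hδ)
  choose! z hz using hN
  refine ⟨K', N, z, fun n hn j₁ j₂ hj hj₁ hj₂ => ?_, fun n hn l hl => ?_, fun J => ?_⟩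
  · have h1 := (hz n hn).1 j₁ j₂ hj₁ hj₂
    refine ⟨?_, h1⟩
    rw [h1, Multiset.card_map, Finset.card_val, Int.card_Icc, Int.toNat_of_nonneg (by omega)]
    ring
  · obtain ⟨h1, h2, h3, h4⟩ := (hz n hn).2 l hl
    have h5 := h4 _ (Or.inl rfl)
    exact ⟨h1, h2, h5.1, h3, h5.2⟩
  -- The alternative X = K'(1 + |ℓ|)/n turns X/n into O(1/n²) when |ℓ| ≤ J. Absolute values are used
  -- because no sign of K' is recorded.
  · refine ⟨|K'| * (1 + J) + |K'|, fun n hn l hl hlJ => ?_⟩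
    have h5 := ((hz n hn).2 l hl).2.2.2 _ (Or.inr rfl)
    have hJ : |(l : ℝ)| ≤ J := by exact_mod_cast hlJ
    have h6 : K' * (1 + |(l : ℝ)|) / n / n + K' / (n : ℝ) ^ 2 ≤
        (|K'| * (1 + J) + |K'|) / (n : ℝ) ^ 2 := by
      rw [div_div, ← sq, ← add_div]
      gcongr <;> exact le_abs_self K'
    exact ⟨h5.1.trans h6, h5.2.trans h6⟩
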